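/- Let $\mathcal H,\mathcal U,\mathcal Y$ be complex Hilbert spaces, let $A:D(A)\to\mathcal H$ be the generator of a strongly continuous semigroup $(\mathcal T_t)_{t\ge0}$ on $\mathcal H$, let $B\in L(\mathcal U,\mathcal H)$, $C\in L(\mathcal H,\mathcal Y)$, $K\in L(\mathcal U,\mathcal H)$, $z\in\mathcal H$, $v\in\mathcal U$, and assume that $K$ is coercive, i.e. there is $m>0$ with $\langle K^*Ku,u\rangle\ge m\|u\|^2$ for all $u\in\mathcal U$. Put $$\ell(x,u)=\|Cx\|^2+\|Ku\|^2+2\operatorname{Re}\langle z,x\rangle+2\operatorname{Re}\langle v,u\rangle .$$ For $T>0$ and $x_0\in\mathcal H$ consider the optimal control problem of minimizing $\int_0^T\ell(x(t),u(t))\,dt$ over $u\in L^2([0,T],\mathcal U)$, where $x(t)=\mathcal T_tx_0+\int_0^t\mathcal T_{t-s}Bu(s)\,ds$ is the mild solution of $\dot x=Ax+Bu$, $x(0)=x_0$. Assume that $(A,B)$ is exponentially stabilizable (there is $F\in L(\mathcal H,\mathcal U)$ such that $A+BF$ generates an exponentially stable strongly continuous semigroup, i.e. one with operator norm at most $M_0e^{-\omega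 t}$ for all $t\ge0$, for some $M_0,\omega>0$) and that $(A,C)$ is exponentially detectable (there is $L\in L(\mathcal Y,\mathcal H)$ such that $A+LC$ generates an exponentially stable strongly continuous semigroup). Then: 1. for all $T>0$ and $x_0\in\mathcal H$ there is a unique optimal control $u^*_T(\cdot,x_0)\in L^2([0,T],\mathcal U)$; let $x^*_T(\cdot,x_0)$ be the corresponding optimal trajectory; 2. the optimal steady state problem of minimizing $\ell(x,u)$ over all $x\in D(A)$, $u\in\mathcal U$ with $Ax+Bu=0$ has a unique minimizer $(x_e,u_e)$; 3. the optimal control problem has the exponential (integral) turnpike property at $(x_e,u_e)$. That is, for every bounded neighborhood $\mathcal N$ of $x_e$: (i) for all $a,b\in[0,1]$ with $a\ne b$, $$\frac1{(b-a)T}\int_{aT}^{bT}x^*_T(t,x_0)\,dt\to x_e,\qquad \frac1{(b-a)T}\int_{aT}^{bT}u^*_T(t,x_0)\,dt\to u_e\qquad(T\to\infty),$$ uniformly in $x_0\in\mathcal N$; (ii) there are constants $M,w>0$ such that for all $T>0$, all $x_0\in\mathcal N$ and almost every $t\in[0,T]$, $$\|x^*_T(t,x_0)-x_e\|+\|u^*_T(t,x_0)-u_e\|\le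 M\bigl(e^{-wt}+e^{-w(T-t)}\bigr).$$ -/

import Mathlib

open Filter Topology MeasureTheory

namespace Turnpike

noncomputable section

/-- A strongly continuous semigroup of bounded operators on a complex Hilbert space.
Only the values `op t` with `0 ≤ t` are constrained, and only these are ever used. -/
structure C0Semigroup (H : Type*) [NormedAddCommGroup H] [InnerProductSpace ℂ H] where
  /-- the operator at time `t` -/
  op : ℝ → H →L[ℂ] H
  op_zero : op 0 = ContinuousLinearMap.id ℂ H
  op_add : ∀ s t : ℝ, 0 ≤ s → 0 ≤ t → op (s + t) = (op s).comp (op t)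
  tendsto_zero : ∀ x : H, Tendsto (fun t : ℝ => op t x) (𝓝[>] 0) (𝓝 x)

section Semigroups

variable {H : Type*} [NormedAddCommGroup H] [InnerProductSpace ℂ H]

/-- The (in general unbounded) operator `A` is the generator of the semigroup `S`:
`x ∈ D(A)` and `A x = y` exactly when `(S_t x - x) / t → y` as `t → 0+`. -/
def IsGenerator (A : H →ₗ.[ℂ] H) (S : C0Semigroup H) : Prop :=
  ∀ x y : H, (x, y) ∈ A.graph ↔
    Tendsto (fun t : ℝ => (t : ℂ)⁻¹ • (S.op t x - x)) (𝓝[>] 0) (𝓝 y)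

/-- `‖S_t‖ ≤ M e^{-ω t}` for all `t ≥ 0`, for some `M` and some `ω > 0`. -/
def C0Semigroup.ExponentiallyStable (S : C0Semigroup H) : Prop :=
  ∃ M ω : ℝ, 0 < M ∧ 0 < ω ∧ ∀ t : ℝ, 0 ≤ t → ‖S.op t‖ ≤ M * Real.exp (-ω * t)

/-- `A` generates an exponentially stable strongly continuous semigroup. -/
def GeneratesExponentiallyStable (A : H →ₗ.[ℂ] H) : Prop :=
  ∃ S : C0Semigroup H, IsGenerator A S ∧ S.ExponentiallyStable

end Semigroups

variable {H U Y : Type*}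
  [NormedAddCommGroup H] [InnerProductSpace ℂ H]
  [NormedAddCommGroup U] [InnerProductSpace ℂ U]
  [NormedAddCommGroup Y] [InnerProductSpace ℂ Y]

/-- `(A, B)` is exponentially stabilizable: for some bounded `F`, the operator `A + B F`, with
domain `D(A)`, generates an exponentially stable semigroup. -/
def ExponentiallyStabilizable (A : H →ₗ.[ℂ] H) (B : U →L[ℂ] H) : Prop :=
  ∃ F : H →L[ℂ] U, GeneratesExponentiallyStable ((B.comp F).toLinearMap +ᵥ A)

/-- `(A, C)` is exponentially detectable: for some bounded `L`, the operator `A + L C`, with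
domain `D(A)`, generates an exponentially stable semigroup. -/
def ExponentiallyDetectable (A : H →ₗ.[ℂ] H) (C : H →L[ℂ] Y) : Prop :=
  ∃ L : Y →L[ℂ] H, GeneratesExponentiallyStable ((L.comp C).toLinearMap +ᵥ A)

/-- `K` is coercive: `⟨K* K u, u⟩ ≥ m ‖u‖²` for some `m > 0`. -/
def Coercive [CompleteSpace H] [CompleteSpace U] (K : U →L[ℂ] H) : Prop :=
  ∃ m : ℝ, 0 < m ∧ ∀ u : U,
    m * ‖u‖ ^ 2 ≤ (inner ℂ (ContinuousLinearMap.adjoint K (K u)) u).re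

/-- The running cost `ℓ(x, u) = ‖C x‖² + ‖K u‖² + 2 Re ⟨z, x⟩ + 2 Re ⟨v, u⟩`. -/
def runningCost (C : H →L[ℂ] Y) (K : U →L[ℂ] H) (z : H) (v : U) (x : H) (u : U) : ℝ :=
  ‖C x‖ ^ 2 + ‖K u‖ ^ 2 + 2 * (inner ℂ z x).re + 2 * (inner ℂ v u).re

/-- The mild solution of `x' = A x + B u`, `x(0) = x₀`, where `A` generates `S`:
`x(t) = S_t x₀ + ∫₀ᵗ S_{t-s} B u(s) ds`. -/
def mildSolution (S : C0Semigroup H) (B : U →L[ℂ] H) (x₀ : H) (u : ℝ → U) (t : ℝ) : H :=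
  S.op t x₀ + ∫ s in (0 : ℝ)..t, S.op (t - s) (B (u s))

/-- The total cost `∫₀ᵀ ℓ(x(t), u(t)) dt` of the control `u` along its mild solution. -/
def totalCost (S : C0Semigroup H) (B : U →L[ℂ] H) (ℓ : H → U → ℝ)
    (T : ℝ) (x₀ : H) (u : ℝ → U) : ℝ :=
  ∫ t in (0 : ℝ)..T, ℓ (mildSolution S B x₀ u t) (u t)

/-- `u` represents an element of `L²([0,T], U)`. -/
def IsAdmissible (T : ℝ) (u : ℝ → U) : Prop :=
  MemLp u 2 (volume.restrict (Set.Icc 0 T))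

/-- `u` is an optimal control for the horizon `T` and the initial state `x₀`: it minimizes the
total cost over `L²([0,T], U)`. -/
def IsOptimalControl (S : C0Semigroup H) (B : U →L[ℂ] H) (ℓ : H → U → ℝ)
    (T : ℝ) (x₀ : H) (u : ℝ → U) : Prop :=
  IsAdmissible T u ∧
    ∀ u' : ℝ → U, IsAdmissible T u' → totalCost S B ℓ T x₀ u ≤ totalCost S B ℓ T x₀ u'

/-- For every horizon and every initial state an optimal control exists, and it is unique as an
element of `L²([0,T], U)`. -/
def HasUniqueOptimalControls (S : C0Semigroup H) (B : U →L[ℂ] H) (ℓ : H → U → ℝ) : Prop :=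
  ∀ T : ℝ, 0 < T → ∀ x₀ : H, ∃ u : ℝ → U, IsOptimalControl S B ℓ T x₀ u ∧
    ∀ u' : ℝ → U, IsOptimalControl S B ℓ T x₀ u' →
      u' =ᵐ[volume.restrict (Set.Icc 0 T)] u

/-- `(x, u)` is a controlled equilibrium: `x ∈ D(A)` and `A x + B u = 0`. -/
def IsControlledEquilibrium (A : H →ₗ.[ℂ] H) (B : U →L[ℂ] H) (x : H) (u : U) : Prop :=
  ∃ hx : x ∈ A.domain, A ⟨x, hx⟩ + B u = 0

/-- `(xe, ue)` is an optimal steady state: a minimizer of `ℓ` among controlled equilibria. -/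
def IsOptimalSteadyState (A : H →ₗ.[ℂ] H) (B : U →L[ℂ] H) (ℓ : H → U → ℝ)
    (xe : H) (ue : U) : Prop :=
  IsControlledEquilibrium A B xe ue ∧
    ∀ (x : H) (u : U), IsControlledEquilibrium A B x u → ℓ xe ue ≤ ℓ x u

/-- The integral turnpike property at `(xe, ue)`: for `0 ≤ a, b ≤ 1`, `a ≠ b`, the averages over
`[aT, bT]` of the optimal trajectory and of the optimal control converge to `xe` and `ue` as
`T → ∞`, uniformly for initial states in any bounded neighborhood of `xe`. -/
def HasIntegralTurnpike (S : C0Semigroup H) (B : U →L[ℂ] H) (ℓ : H → U → ℝ)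
    (xe : H) (ue : U) : Prop :=
  ∀ N : Set H, Bornology.IsBounded N → N ∈ 𝓝 xe → ∀ ε : ℝ, 0 < ε →
    ∀ a b : ℝ, a ∈ Set.Icc (0 : ℝ) 1 → b ∈ Set.Icc (0 : ℝ) 1 → a ≠ b →
      ∃ T₀ : ℝ, 0 < T₀ ∧ ∀ T : ℝ, T₀ ≤ T → ∀ x₀ ∈ N, ∀ u : ℝ → U,
        IsOptimalControl S B ℓ T x₀ u →
          ‖((b - a) * T)⁻¹ • (∫ t in (a * T)..(b * T), mildSolution S B x₀ u t) - xe‖ < ε ∧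
          ‖((b - a) * T)⁻¹ • (∫ t in (a * T)..(b * T), u t) - ue‖ < ε

/-- The exponential (integral) turnpike property at `(xe, ue)`: the integral turnpike property,
together with `‖x*(t) - xe‖ + ‖u*(t) - ue‖ ≤ M (e^{-wt} + e^{-w(T-t)})` on `[0,T]`, where `M` and
`w` are independent of `T` and of the initial state in a given bounded neighborhood of `xe`.
As the control is an element of `L²([0,T], U)`, the estimate is for almost every `t`. -/
def HasExponentialTurnpike (S : C0Semigroup H) (B : U →L[ℂ] H) (ℓ : H → U → ℝ)
    (xe : H) (ue : U) : Prop :=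
  HasIntegralTurnpike S B ℓ xe ue ∧
  ∀ N : Set H, Bornology.IsBounded N → N ∈ 𝓝 xe →
    ∃ M w : ℝ, 0 < M ∧ 0 < w ∧ ∀ T : ℝ, 0 < T → ∀ x₀ ∈ N, ∀ u : ℝ → U,
      IsOptimalControl S B ℓ T x₀ u →
        ∀ᵐ t ∂(volume.restrict (Set.Icc 0 T)),
          ‖mildSolution S B x₀ u t - xe‖ + ‖u t - ue‖ ≤
            M * (Real.exp (-w * t) + Real.exp (-w * (T - t)))

end

end Turnpike

/-! The argument uses only first-order conditions and energy estimates; no adjoint equation or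
Riccati operator occurs. Write controls as u = w + F x with a stabilizing F. For zero initial state
the trajectory is then the convolution of B w with the stable closed-loop semigroup `SF`; the
comparison of semigroups whose generators differ by a bounded operator (`mild_of_perturbed`,
`perturbed_of_mild`) makes this exact for mild solutions. Rewriting the same trajectory with the
detecting semigroup bounds the state by C x and u, so the quadratic part of the cost dominates κ‖w‖²
in L²(0,T) with κ independent of T (`exists_coercive`). The stationary version of this, with
inverses of the stable generators in place of the semigroups, gives the unique optimal steady state
and its first-order condition (`exists_optimalSteadyState`). Existence and uniqueness of optimal
controls need only the coercivity of K.

Now subtract the steady state. The first variation of the cost is the quadratic form of the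
deviation plus the derivative of ℓ at (xe, ue), integrated along the variation y. Since ∫ y = R ∫ B
w - R y(T), with -R the inverse of the closed-loop generator, the steady-state condition cancels all
of the latter except a term of size c‖y(T)‖ (`exists_abs_integral_costDeriv_le`). The deviation is
thus critical for a purely quadratic cost up to a boundary term.

Test this with the offset φ²w, where φ > 0 has a δ-Lipschitz logarithm and is at most one at both
ends of the horizon. Moving φ through the convolution produces an error of relative size δ, because
the kernel decays much faster than φ varies (`norm_weighted_conv_sub_le`). For small δ, coercivity
applied to φw absorbs the error and bounds φw in L², uniformly in T and φ
(`exists_weighted_energy_le`). The state is then bounded pointwise through the convolution, and the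
control almost everywhere by testing with a truncation of the control supported where it is too
large (`weighted_control_bound`). The weight φ(t) = 1/(e^{-δt} + e^{-δ(T-t)}) yields the exponential
estimate; integrating that estimate yields the averages. -/

namespace Turnpike

/-! ### Minimization of strongly convex quadratic functionals -/

lemma eq_zero_of_quadratic_nonneg {d q : ℝ} (h : ∀ t : ℝ, 0 ≤ 2 * t * d + t ^ 2 * q) : d = 0 := by
  by_contra hd
  have hq : 0 < |q| + 1 := by positivity
  -- For d ≠ 0 the value at this t is a positive multiple of q - 2(|q| + 1) < 0; the added one
  -- covers q = 0.
  have h1 := h (-d / (|q| + 1))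
  have h2 : 2 * (-d / (|q| + 1)) * d + (-d / (|q| + 1)) ^ 2 * q
      = d ^ 2 / (|q| + 1) ^ 2 * (q - 2 * (|q| + 1)) := by
    field_simp
    ring
  rw [h2] at h1
  have h3 : 0 < d ^ 2 / (|q| + 1) ^ 2 := by positivity
  have h4 := le_abs_self q
  have h5 := abs_nonneg q
  nlinarith

/-- A strongly convex continuous quadratic functional on a Banach space has a minimizer. -/
lemma exists_minimizer_of_quadratic {E : Type*} [NormedAddCommGroup E] [NormedSpace ℝ E]
    [CompleteSpace E] (J : E → ℝ) (D : E → E → ℝ) (q : E → ℝ) {m c : ℝ} (hm : 0 < m)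
    (hJ : ∀ u h, J (u + h) = J u + 2 * D u h + q h)
    (hDsmul : ∀ u (r : ℝ) h, D u (r • h) = r * D u h) (hqneg : ∀ h, q (-h) = q h)
    (hq : ∀ h, m * ‖h‖ ^ 2 ≤ q h) (hqc : ∀ h, q h ≤ c * ‖h‖ ^ 2)
    (hD : ∀ u, ∃ a : ℝ, ∀ h, |D u h| ≤ a * (1 + ‖h‖ ^ 2)) :
    ∃ u, ∀ u', J u ≤ J u' := by
  have hDneg : ∀ u h, D u (-h) = -D u h := fun u h => by
    have := hDsmul u (-1) h
    rwa [neg_one_smul, neg_one_mul] at this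
  -- The growth bound is only assumed in the crude form a(1 + ‖h‖²); evaluated on unit vectors,
  -- homogeneity turns it into a linear bound.
  replace hD : ∀ u, ∃ a : ℝ, ∀ h, |D u h| ≤ a * ‖h‖ := by
    intro u
    obtain ⟨a, ha⟩ := hD u
    refine ⟨2 * a, fun h => ?_⟩
    rcases eq_or_ne h 0 with rfl | hh
    · have := hDsmul u 0 0
      rw [zero_smul, zero_mul] at this
      simp [this]
    · have hn : 0 < ‖h‖ := norm_pos_iff.2 hh
      have h1 := ha (‖h‖⁻¹ • h)
      rw [hDsmul, abs_mul, abs_of_pos (inv_pos.2 hn), norm_smul, norm_inv, norm_norm,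
        inv_mul_cancel₀ hn.ne', inv_mul_le_iff₀ hn] at h1
      linarith
  have hbdd : BddBelow (Set.range J) := by
    obtain ⟨a, ha⟩ := hD 0
    refine ⟨J 0 - a ^ 2 / m, ?_⟩
    rintro _ ⟨u, rfl⟩
    have h1 := hJ 0 u
    rw [zero_add] at h1
    have h2 := (abs_le.1 (ha u)).1
    have h3 := hq u
    have h4 : 0 ≤ m * (‖u‖ - a / m) ^ 2 := by positivity
    have h5 : m * (‖u‖ - a / m) ^ 2 = m * ‖u‖ ^ 2 - 2 * (a * ‖u‖) + a ^ 2 / m := by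
      field_simp
      ring
    linarith
  have hcont : Continuous J := by
    rw [continuous_iff_continuousAt]
    intro u
    obtain ⟨a, ha⟩ := hD u
    have h1 : Tendsto (fun u' => 2 * (a * ‖u' - u‖) + (m + |c|) * ‖u' - u‖ ^ 2) (𝓝 u) (𝓝 0) := by
      have : Continuous fun u' : E => 2 * (a * ‖u' - u‖) + (m + |c|) * ‖u' - u‖ ^ 2 := by fun_prop
      simpa using this.tendsto u
    refine tendsto_iff_norm_sub_tendsto_zero.2 (squeeze_zero (fun _ => norm_nonneg _) ?_ h1)
    intro u'
    have h2 := hJ u (u' - u)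
    rw [add_sub_cancel] at h2
    have h3 := abs_le.1 (ha (u' - u))
    have h4 := hq (u' - u)
    have h5 := hqc (u' - u)
    have h6 : c * ‖u' - u‖ ^ 2 ≤ |c| * ‖u' - u‖ ^ 2 := by gcongr; exact le_abs_self c
    have h7 : 0 ≤ m * ‖u' - u‖ ^ 2 := by positivity
    rw [Real.norm_eq_abs, abs_le]
    constructor <;> nlinarith [abs_nonneg c, sq_nonneg ‖u' - u‖]
  set I := ⨅ u, J u with hI
  have hIle : ∀ u, I ≤ J u := fun u => ciInf_le hbdd u
  have hex : ∀ n : ℕ, ∃ u, J u < I + 1 / (n + 1 : ℝ) := fun n =>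
    exists_lt_of_ciInf_lt (by linarith [Nat.one_div_pos_of_nat (α := ℝ) (n := n)])
  choose s hs using hex
  -- Parallelogram argument: expanding J at the midpoint in the directions d and -d cancels the
  -- linear terms, so two nearly minimal points are close. A minimizing sequence is therefore
  -- Cauchy.
  have hpar : ∀ u u', m * ‖u - u'‖ ^ 2 ≤ 2 * (J u + J u' - 2 * I) := by
    intro u u'
    set d : E := (2 : ℝ)⁻¹ • (u - u') with hd
    set p : E := (2 : ℝ)⁻¹ • (u + u') with hp
    have e1 : u = p + d := by rw [hp, hd]; module
    have e2 : u' = p + -d := by rw [hp, hd]; module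
    have e3 : u - u' = (2 : ℝ) • d := by rw [hd]; module
    have h1 := hJ p d
    have h2 := hJ p (-d)
    rw [← e1] at h1
    rw [← e2, hDneg, hqneg] at h2
    have h3 := hIle p
    have h4 := hq d
    rw [e3, norm_smul]
    norm_num
    nlinarith
  have hcau : CauchySeq s := by
    refine Metric.cauchySeq_iff'.2 fun ε hε => ?_
    obtain ⟨n, hn⟩ := exists_nat_one_div_lt (show 0 < m * ε ^ 2 / 4 by positivity)
    refine ⟨n, fun k hk => ?_⟩
    have h1 := hpar (s k) (s n)
    have h2 := hs n
    have h3 := hs k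
    have h4 : 1 / (k + 1 : ℝ) ≤ 1 / (n + 1 : ℝ) := by gcongr
    rw [dist_eq_norm]
    have h5 : m * ‖s k - s n‖ ^ 2 < m * ε ^ 2 := by linarith
    exact lt_of_pow_lt_pow_left₀ 2 hε.le (lt_of_mul_lt_mul_left h5 hm.le)
  obtain ⟨u, hu⟩ := cauchySeq_tendsto_of_complete hcau
  refine ⟨u, fun u' => le_trans ?_ (hIle u')⟩
  have h1 : Tendsto (fun n => J (s n)) atTop (𝓝 (J u)) := (hcont.tendsto u).comp hu
  have h2 : Tendsto (fun n : ℕ => I + 1 / (n + 1 : ℝ)) atTop (𝓝 I) := by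
    simpa using tendsto_const_nhds.add (tendsto_one_div_add_atTop_nhds_zero_nat (𝕜 := ℝ))
  exact le_of_tendsto_of_tendsto' h1 h2 fun n => (hs n).le

/-! ### Local boundedness and strong continuity of semigroups -/

namespace C0Semigroup

variable {H : Type*} [NormedAddCommGroup H] [InnerProductSpace ℂ H]

lemma op_add_apply (S : C0Semigroup H) {s t : ℝ} (hs : 0 ≤ s) (ht : 0 ≤ t) (x : H) :
    S.op (s + t) x = S.op s (S.op t x) := by
  rw [S.op_add s t hs ht]; rfl

@[simp]
lemma op_zero_apply (S : C0Semigroup H) (x : H) : S.op 0 x = x := by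
  rw [S.op_zero]; rfl

lemma op_comm (S : C0Semigroup H) {s t : ℝ} (hs : 0 ≤ s) (ht : 0 ≤ t) (x : H) :
    S.op s (S.op t x) = S.op t (S.op s x) := by
  rw [← S.op_add_apply hs ht, ← S.op_add_apply ht hs, add_comm]

/-- Otherwise there are times tending to zero with unbounded operator norms, while each orbit
converges there; this contradicts the uniform boundedness principle. -/
lemma exists_bound_near_zero [CompleteSpace H] (S : C0Semigroup H) :
    ∃ δ M : ℝ, 0 < δ ∧ 0 ≤ M ∧ ∀ t ∈ Set.Icc 0 δ, ‖S.op t‖ ≤ M := by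
  by_contra! hcon
  have hex : ∀ n : ℕ, ∃ t ∈ Set.Icc (0 : ℝ) (1 / (n + 1)), (n + 1 : ℝ) < ‖S.op t‖ := fun n =>
    hcon (1 / (n + 1)) (n + 1) (by positivity) (by positivity)
  choose t ht hn using hex
  have hpos : ∀ n, 0 < t n := by
    intro n
    rcases (ht n).1.eq_or_lt with h | h
    · have h1 := hn n
      rw [← h, S.op_zero] at h1
      have h2 := ContinuousLinearMap.norm_id_le (𝕜 := ℂ) (E := H)
      have h3 : (0 : ℝ) ≤ n := n.cast_nonneg
      linarith
    · exact h
  have hlim : Tendsto t atTop (𝓝[>] 0) := by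
    refine tendsto_nhdsWithin_iff.2 ⟨?_, Eventually.of_forall hpos⟩
    exact squeeze_zero (fun n => (ht n).1) (fun n => (ht n).2)
      tendsto_one_div_add_atTop_nhds_zero_nat
  obtain ⟨C, hC⟩ := banach_steinhaus (g := fun n => S.op (t n)) fun x => by
    obtain ⟨c, hc⟩ := ((S.tendsto_zero x).comp hlim).norm.bddAbove_range
    exact ⟨c, fun n => hc ⟨n, rfl⟩⟩
  obtain ⟨n, hn'⟩ := exists_nat_gt C
  have h1 := hC n
  have h2 := hn n
  linarith

/-- The bound near zero is propagated in steps of length δ by the semigroup law. -/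
lemma exists_bound [CompleteSpace H] (S : C0Semigroup H) (T : ℝ) :
    ∃ M : ℝ, 0 ≤ M ∧ ∀ t ∈ Set.Icc 0 T, ‖S.op t‖ ≤ M := by
  obtain ⟨δ, M, hδ, hM, hb⟩ := S.exists_bound_near_zero
  have key : ∀ n : ℕ, ∃ M' : ℝ, 0 ≤ M' ∧ ∀ t ∈ Set.Icc 0 (n * δ), ‖S.op t‖ ≤ M' := by
    intro n
    induction n with
    | zero =>
      refine ⟨M, hM, fun t ht => hb t ⟨ht.1, ht.2.trans ?_⟩⟩
      simpa using hδ.le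
    | succ n ih =>
      obtain ⟨M', hM', hb'⟩ := ih
      refine ⟨M' + M' * M, by positivity, fun t ht => ?_⟩
      by_cases h : t ≤ n * δ
      · exact (hb' t ⟨ht.1, h⟩).trans (by nlinarith)
      · by_cases h2 : t ≤ δ
        · rcases n.eq_zero_or_pos with rfl | hn
          · have h3 : 1 ≤ 1 := le_rfl
            have h0 := hb t ⟨ht.1, h2⟩
            have h4 := hb' 0 (by simp)
            rw [S.op_zero] at h4
            -- For n = 0 the induction hypothesis only says ‖id‖ ≤ M', so the operator is factored
            -- as id ∘ S_t to fit under M' * M.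
            have h5 : ‖S.op t‖ ≤ ‖ContinuousLinearMap.id ℂ H‖ * ‖S.op t‖ := by
              simpa using ContinuousLinearMap.opNorm_comp_le (ContinuousLinearMap.id ℂ H) (S.op t)
            have h6 : ‖ContinuousLinearMap.id ℂ H‖ * ‖S.op t‖ ≤ M' * M := by gcongr
            linarith
          · exfalso
            have : (1 : ℝ) ≤ n := by exact_mod_cast hn
            nlinarith
        · push Not at h h2
          have e : t = (t - δ) + δ := by ring
          rw [e, S.op_add _ _ (by linarith) hδ.le]
          refine (ContinuousLinearMap.opNorm_comp_le _ _).trans ?_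
          have h1 := hb' (t - δ) ⟨by linarith, by
            have := ht.2; push_cast at this; linarith⟩
          have h2 := hb δ ⟨hδ.le, le_rfl⟩
          have : ‖S.op (t - δ)‖ * ‖S.op δ‖ ≤ M' * M := by gcongr
          linarith
  obtain ⟨n, hn⟩ := exists_nat_gt (T / δ)
  obtain ⟨M', hM', hb'⟩ := key n
  refine ⟨M', hM', fun t ht => hb' t ⟨ht.1, ht.2.trans ?_⟩⟩
  rw [div_lt_iff₀ hδ] at hn
  exact hn.le

lemma tendsto_abs (S : C0Semigroup H) (x : H) :
    Tendsto (fun t : ℝ => S.op |t| x) (𝓝 0) (𝓝 x) := by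
  have h1 : ContinuousWithinAt (fun t : ℝ => S.op t x) (Set.Ici 0) 0 := by
    rw [← continuousWithinAt_Ioi_iff_Ici]
    simpa [ContinuousWithinAt] using S.tendsto_zero x
  have h2 : Tendsto (fun t : ℝ => |t|) (𝓝 0) (𝓝[≥] 0) :=
    tendsto_nhdsWithin_iff.2 ⟨by simpa using (continuous_abs (G := ℝ)).tendsto 0,
      Eventually.of_forall fun t => abs_nonneg t⟩
  have h3 : Tendsto (fun t : ℝ => S.op t x) (𝓝[≥] 0) (𝓝 x) := by
    simpa [ContinuousWithinAt] using h1
  exact h3.comp h2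

variable [CompleteSpace H]

/-- Nothing is known about `op` at negative times; `max t 0` extends the orbit by a constant and
makes it continuous on all of ℝ. Continuity holds since two orbit values differ by S_{min}(S_{|a-b|}
x - x) up to sign, with S locally bounded. -/
lemma continuous_op_max (S : C0Semigroup H) (x : H) :
    Continuous fun t : ℝ => S.op (max t 0) x := by
  rw [continuous_iff_continuousAt]
  intro t
  obtain ⟨M, hM, hb⟩ := S.exists_bound (max t 0 + 1)
  have h1 : Tendsto (fun s : ℝ => M * ‖S.op |max s 0 - max t 0| x - x‖) (𝓝 t) (𝓝 0) := by
    have h2 : Tendsto (fun s : ℝ => max s 0 - max t 0) (𝓝 t) (𝓝 0) := by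
      have : Continuous fun s : ℝ => max s 0 - max t 0 := by fun_prop
      simpa using this.tendsto t
    have h3 := ((S.tendsto_abs x).comp h2).sub_const x
    simpa using h3.norm.const_mul M
  refine tendsto_iff_norm_sub_tendsto_zero.2
    (squeeze_zero' (Eventually.of_forall fun _ => norm_nonneg _) ?_ h1)
  filter_upwards [eventually_lt_nhds (show t < t + 1 by linarith)] with s hs
  have hs1 : max s 0 ≤ max t 0 + 1 := by
    refine max_le ?_ ?_
    · linarith [le_max_left t 0]
    · linarith [le_max_right t 0]
  have hs0 := le_max_right s 0
  have ht0 := le_max_right t 0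
  set a := max s 0
  set b := max t 0
  rcases le_total b a with h | h
  · have e : S.op a x - S.op b x = S.op b (S.op |a - b| x - x) := by
      rw [abs_of_nonneg (by linarith), map_sub, ← S.op_add_apply ht0 (by linarith)]
      congr 3
      ring
    rw [e]
    exact (S.op b).le_of_opNorm_le (hb b ⟨ht0, by linarith⟩) _
  · have e : S.op a x - S.op b x = - S.op a (S.op |a - b| x - x) := by
      rw [abs_of_nonpos (by linarith), map_sub, ← S.op_add_apply hs0 (by linarith), neg_sub]
      congr 3
      ring
    rw [e, norm_neg]
    exact (S.op a).le_of_opNorm_le (hb a ⟨hs0, hs1⟩) _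

/-- Joint continuity: the increment splits into S_{a'}(y' - y), controlled by local boundedness, and
the increment of a fixed orbit. -/
lemma continuous_op_max_apply (S : C0Semigroup H) {X : Type*} [TopologicalSpace X] {a : X → ℝ}
    {y : X → H} (ha : Continuous a) (hy : Continuous y) :
    Continuous fun p => S.op (max (a p) 0) (y p) := by
  rw [continuous_iff_continuousAt]
  intro p
  obtain ⟨M, hM, hb⟩ := S.exists_bound (max (a p) 0 + 1)
  have h1 : Tendsto (fun p' => M * ‖y p' - y p‖
      + ‖S.op (max (a p') 0) (y p) - S.op (max (a p) 0) (y p)‖) (𝓝 p) (𝓝 0) := by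
    have h2 : Tendsto (fun p' => ‖y p' - y p‖) (𝓝 p) (𝓝 0) := by
      have := (hy.tendsto p).sub_const (y p)
      simpa using this.norm
    have h3 := ((((S.continuous_op_max (y p)).comp ha).tendsto p).sub_const
      (S.op (max (a p) 0) (y p))).norm
    simpa using (h2.const_mul M).add h3
  refine tendsto_iff_norm_sub_tendsto_zero.2
    (squeeze_zero' (Eventually.of_forall fun _ => norm_nonneg _) ?_ h1)
  have hc : Continuous fun p' => max (a p') 0 := by fun_prop
  filter_upwards [hc.tendsto p |>.eventually
    (eventually_lt_nhds (show max (a p) 0 < max (a p) 0 + 1 by linarith))] with p' hp'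
  have e : S.op (max (a p') 0) (y p') - S.op (max (a p) 0) (y p)
      = S.op (max (a p') 0) (y p' - y p)
        + (S.op (max (a p') 0) (y p) - S.op (max (a p) 0) (y p)) := by
    rw [map_sub]; abel
  rw [e]
  refine (norm_add_le _ _).trans ?_
  gcongr
  exact (S.op _).le_of_opNorm_le (hb _ ⟨le_max_right _ _, hp'.le⟩) _

end C0Semigroup

/-! ### Generators and Duhamel's formula for bounded perturbations -/

section Generator

variable {H : Type*} [NormedAddCommGroup H] [InnerProductSpace ℂ H] {A : H →ₗ.[ℂ] H}
  {S : C0Semigroup H}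

lemma IsGenerator.tendsto (hA : IsGenerator A S) (x : A.domain) :
    Tendsto (fun t : ℝ => t⁻¹ • (S.op t x - x)) (𝓝[>] 0) (𝓝 (A x)) := by
  have h := (hA x (A x)).1 (A.mem_graph x)
  refine h.congr fun t => ?_
  rw [← Complex.ofReal_inv, Complex.coe_smul]

lemma IsGenerator.of_tendsto (hA : IsGenerator A S) {x y : H}
    (h : Tendsto (fun t : ℝ => t⁻¹ • (S.op t x - x)) (𝓝[>] 0) (𝓝 y)) :
    ∃ hx : x ∈ A.domain, A ⟨x, hx⟩ = y := by
  have h1 : (x, y) ∈ A.graph := by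
    refine (hA x y).2 (h.congr fun t => ?_)
    rw [← Complex.ofReal_inv, Complex.coe_smul]
  obtain ⟨w, hw1, hw2⟩ := (LinearPMap.mem_graph_iff A).1 h1
  dsimp only at hw1 hw2
  subst hw1
  exact ⟨w.2, hw2⟩

/-- The difference quotients at zero commute with S_t, so their limit passes through S_t. -/
lemma IsGenerator.op_mem (hA : IsGenerator A S) {t : ℝ} (ht : 0 ≤ t) (x : A.domain) :
    ∃ hx : S.op t x ∈ A.domain, A ⟨S.op t x, hx⟩ = S.op t (A x) := by
  refine hA.of_tendsto ((((S.op t).continuous.tendsto _).comp (hA.tendsto x)).congr' ?_)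
  filter_upwards [self_mem_nhdsWithin] with s hs
  have hs : (0 : ℝ) < s := hs
  rw [Function.comp_apply, ContinuousLinearMap.map_smul_of_tower, map_sub, S.op_comm ht hs.le]

lemma hasDerivWithinAt_Ioi_of_tendsto {f : ℝ → H} {y : H} {s : ℝ}
    (h : Tendsto (fun t : ℝ => t⁻¹ • (f (s + t) - f s)) (𝓝[>] 0) (𝓝 y)) :
    HasDerivWithinAt f y (Set.Ioi s) s := by
  rw [hasDerivWithinAt_iff_tendsto_slope' (by simp)]
  have h1 : Tendsto (fun r : ℝ => r - s) (𝓝[>] s) (𝓝[>] 0) := by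
    refine tendsto_nhdsWithin_iff.2 ⟨?_, ?_⟩
    · have : Tendsto (fun r : ℝ => r - s) (𝓝 s) (𝓝 (s - s)) :=
        (continuous_id.sub continuous_const).tendsto s
      rw [sub_self] at this
      exact this.mono_left nhdsWithin_le_nhds
    · filter_upwards [self_mem_nhdsWithin] with r hr
      simpa using hr
  refine (h.comp h1).congr fun r => ?_
  simp [slope_def_module]

variable [CompleteSpace H]

/-- Comparison of two semigroups whose generators differ by a bounded operator. -/
lemma op_sub_op_of_mem_domain (hA : IsGenerator A S) {P : H →L[ℂ] H} {S' : C0Semigroup H}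
    (hA' : IsGenerator (P.toLinearMap +ᵥ A) S') (x : A.domain) {t : ℝ} (ht : 0 ≤ t) :
    ∫ s in (0 : ℝ)..t, S.op (max (t - s) 0) (P (S'.op (max s 0) x)) = S'.op t x - S.op t x := by
  have hcont : Continuous fun s : ℝ => S.op (max (t - s) 0) (S'.op (max s 0) x) :=
    S.continuous_op_max_apply (by fun_prop) (S'.continuous_op_max _)
  have hcont' : Continuous fun s : ℝ => S.op (max (t - s) 0) (P (S'.op (max s 0) x)) :=
    S.continuous_op_max_apply (by fun_prop) (P.continuous.comp (S'.continuous_op_max _))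
  -- Duhamel: s ↦ S_{t-s} S'_s x runs from S_t x to S'_t x. This version of the fundamental theorem
  -- needs only right derivatives, which is what the generators supply.
  have h := intervalIntegral.integral_eq_sub_of_hasDeriv_right_of_le ht
    (f := fun s : ℝ => S.op (max (t - s) 0) (S'.op (max s 0) x))
    (f' := fun s : ℝ => S.op (max (t - s) 0) (P (S'.op (max s 0) x)))
    hcont.continuousOn ?_ (hcont'.intervalIntegrable _ _)
  · simpa [ht] using h
  rintro s ⟨hs0, hst⟩
  apply hasDerivWithinAt_Ioi_of_tendsto
  obtain ⟨hy, -⟩ := hA'.op_mem hs0.le (show (P.toLinearMap +ᵥ A).domain from x)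
  change S'.op s (x : H) ∈ A.domain at hy
  set y : A.domain := ⟨S'.op s x, hy⟩ with hydef
  -- With y = S'_s x in the domain, the two difference quotients differ in the limit by (A + P) y -
  -- A y = P y. The increment of S_{t-s} S'_s x is S_{t-s-h} applied to S'_h y - S_h y.
  have h1 : Tendsto (fun h : ℝ => h⁻¹ • (S'.op h y - S.op h y)) (𝓝[>] 0) (𝓝 (P y)) := by
    have e1 := (hA'.tendsto (show (P.toLinearMap +ᵥ A).domain from y)).sub (hA.tendsto y)
    have e2 : (P.toLinearMap +ᵥ A) (show (P.toLinearMap +ᵥ A).domain from y) - A y = P y := by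
      rw [LinearPMap.vadd_apply]
      change P y + A y - A y = P y
      abel
    rw [e2] at e1
    refine e1.congr fun h => ?_
    rw [← smul_sub]
    congr 1
    change S'.op h y - y - (S.op h y - y) = _
    abel
  obtain ⟨M, hM, hb⟩ := S.exists_bound t
  have h2 : Tendsto (fun h : ℝ => S.op (max (t - (s + h)) 0) (h⁻¹ • (S'.op h y - S.op h y)))
      (𝓝[>] 0) (𝓝 (S.op (max (t - s) 0) (P y))) := by
    have e0 : Continuous fun h : ℝ => S.op (max (t - (s + h)) 0) (P y) :=
      S.continuous_op_max_apply (by fun_prop) continuous_const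
    have e1 : Tendsto (fun h : ℝ => S.op (max (t - (s + h)) 0) (P y)) (𝓝[>] 0)
        (𝓝 (S.op (max (t - s) 0) (P y))) := by
      have := e0.tendsto 0
      rw [add_zero] at this
      exact this.mono_left nhdsWithin_le_nhds
    have e2 : Tendsto (fun h : ℝ => S.op (max (t - (s + h)) 0)
        (h⁻¹ • (S'.op h y - S.op h y) - P y)) (𝓝[>] 0) (𝓝 0) := by
      have e3 := (tendsto_iff_norm_sub_tendsto_zero.1 h1).const_mul M
      rw [mul_zero] at e3
      refine squeeze_zero_norm' ?_ e3
      filter_upwards [self_mem_nhdsWithin] with h hh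
      have hh : (0 : ℝ) < h := hh
      exact (S.op _).le_of_opNorm_le
        (hb _ ⟨le_max_right _ _, max_le (by linarith) ht⟩) _
    have e4 := e2.add e1
    rw [zero_add] at e4
    refine e4.congr fun h => ?_
    rw [← map_add, sub_add_cancel]
  have hty : S'.op (max s 0) x = y := by rw [max_eq_left hs0.le]
  rw [hty]
  refine h2.congr' ?_
  filter_upwards [self_mem_nhdsWithin, nhdsWithin_le_nhds
    (eventually_lt_nhds (show 0 < t - s by linarith))] with h hh hh2
  have hh : (0 : ℝ) < h := hh
  rw [max_eq_left (show 0 ≤ t - (s + h) by linarith), max_eq_left (show 0 ≤ t - s by linarith),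
    max_eq_left (show 0 ≤ s + h by linarith), ContinuousLinearMap.map_smul_of_tower, map_sub]
  congr 2
  · rw [add_comm s h, S'.op_add_apply hh.le hs0.le]
  · rw [← S.op_add_apply (by linarith) hh.le]
    congr 2
    ring

lemma op_sub_of_mem_domain (hA : IsGenerator A S) (x : A.domain) {t : ℝ} (ht : 0 ≤ t) :
    ∫ s in (0 : ℝ)..t, S.op (max s 0) (A x) = S.op t x - x := by
  have h := intervalIntegral.integral_eq_sub_of_hasDeriv_right_of_le ht
    (f := fun s : ℝ => S.op (max s 0) x) (f' := fun s : ℝ => S.op (max s 0) (A x))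
    (S.continuous_op_max _).continuousOn ?_ ((S.continuous_op_max _).intervalIntegrable _ _)
  · simpa [ht] using h
  rintro s ⟨hs0, -⟩
  apply hasDerivWithinAt_Ioi_of_tendsto
  rw [max_eq_left hs0.le]
  refine (((S.op s).continuous.tendsto _).comp (hA.tendsto x)).congr' ?_
  filter_upwards [self_mem_nhdsWithin] with h hh
  have hh : (0 : ℝ) < h := hh
  rw [Function.comp_apply, ContinuousLinearMap.map_smul_of_tower, map_sub,
    max_eq_left (by linarith),
    S.op_add_apply hs0.le hh.le]

/-- `S_t` applied to an orbit segment shifts the segment. -/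
lemma op_integral_sub (S : C0Semigroup H) (x : H) (a t : ℝ) (ht : 0 ≤ t) (ha : 0 ≤ a) :
    S.op t (∫ s in (0 : ℝ)..a, S.op (max s 0) x) - ∫ s in (0 : ℝ)..a, S.op (max s 0) x
      = (∫ s in a..(a + t), S.op (max s 0) x) - ∫ s in (0 : ℝ)..t, S.op (max s 0) x := by
  have hc := S.continuous_op_max x
  have hi : ∀ a b, IntervalIntegrable (fun s : ℝ => S.op (max s 0) x) volume a b :=
    fun a b => hc.intervalIntegrable a b
  have h1 : S.op t (∫ s in (0 : ℝ)..a, S.op (max s 0) x)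
      = ∫ s in t..(a + t), S.op (max s 0) x := by
    rw [← ContinuousLinearMap.intervalIntegral_comp_comm _ (hi _ _)]
    have h2 := intervalIntegral.integral_comp_add_right (a := 0) (b := a)
      (fun s : ℝ => S.op (max s 0) x) t
    rw [zero_add] at h2
    rw [← h2]
    refine intervalIntegral.integral_congr fun s hs => ?_
    rw [Set.uIcc_of_le ha] at hs
    rw [max_eq_left hs.1, max_eq_left (by linarith [hs.1]), add_comm, S.op_add_apply ht hs.1]
  rw [h1, ← intervalIntegral.integral_add_adjacent_intervals (hi 0 t) (hi t a),
    ← intervalIntegral.integral_add_adjacent_intervals (hi t a) (hi a (a + t))]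
  abel

lemma tendsto_average_nhdsGT {f : ℝ → H} (hf : Continuous f) (a : ℝ) :
    Tendsto (fun t : ℝ => t⁻¹ • ∫ s in a..(a + t), f s) (𝓝[>] 0) (𝓝 (f a)) := by
  have h := (intervalIntegral.integral_hasDerivAt_right (hf.intervalIntegrable a a)
    (hf.stronglyMeasurableAtFilter _ _) hf.continuousAt).tendsto_slope_zero_right
  simpa using h

/-- The averages a⁻¹ ∫₀ᵃ S_s x ds lie in the domain, since shifting an orbit segment only changes
its two ends, and they tend to x. -/
lemma IsGenerator.dense_domain (hA : IsGenerator A S) : Dense (A.domain : Set H) := by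
  intro x
  have hc := S.continuous_op_max x
  have h1 := tendsto_average_nhdsGT hc 0
  simp only [zero_add, max_self, S.op_zero_apply] at h1
  refine mem_closure_of_tendsto h1 ?_
  filter_upwards [self_mem_nhdsWithin] with a ha
  have ha : (0 : ℝ) < a := ha
  have h2 := (tendsto_average_nhdsGT hc a).sub (tendsto_average_nhdsGT hc 0)
  obtain ⟨h3, -⟩ := hA.of_tendsto (x := ∫ s in (0 : ℝ)..a, S.op (max s 0) x) (h2.congr' (by
    filter_upwards [self_mem_nhdsWithin] with t ht
    rw [op_integral_sub S x a t (le_of_lt ht) ha.le, ← smul_sub, zero_add]))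
  rw [← Complex.coe_smul]
  exact A.domain.smul_mem _ h3

/-- Both sides are continuous in x, and they agree on the dense domain. -/
lemma op_sub_op (hA : IsGenerator A S) {P : H →L[ℂ] H} {S' : C0Semigroup H}
    (hA' : IsGenerator (P.toLinearMap +ᵥ A) S') (x : H) {t : ℝ} (ht : 0 ≤ t) :
    ∫ s in (0 : ℝ)..t, S.op (max (t - s) 0) (P (S'.op (max s 0) x)) = S'.op t x - S.op t x := by
  have hcl : Continuous fun x : H =>
      ∫ s in (0 : ℝ)..t, S.op (max (t - s) 0) (P (S'.op (max s 0) x)) := by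
    obtain ⟨M, hM, hb⟩ := S.exists_bound t
    obtain ⟨M', hM', hb'⟩ := S'.exists_bound t
    have hi : ∀ x, IntervalIntegrable (fun s : ℝ => S.op (max (t - s) 0) (P (S'.op (max s 0) x)))
        volume 0 t := fun x => Continuous.intervalIntegrable
      (S.continuous_op_max_apply (by fun_prop) (P.continuous.comp (S'.continuous_op_max _))) _ _
    refine (LipschitzWith.of_dist_le_mul (K := ⟨M * (‖P‖ * M') * |t - 0|, by positivity⟩)
      fun x y => ?_).continuous
    rw [dist_eq_norm, dist_eq_norm, ← intervalIntegral.integral_sub (hi x) (hi y)]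
    change _ ≤ M * (‖P‖ * M') * |t - 0| * ‖x - y‖
    rw [mul_right_comm]
    refine intervalIntegral.norm_integral_le_of_norm_le_const fun s hs => ?_
    rw [Set.uIoc_of_le ht] at hs
    rw [← map_sub, ← map_sub, ← map_sub, mul_assoc, mul_assoc]
    refine (S.op _).le_of_opNorm_le_of_le (hb _ ⟨le_max_right _ _, max_le ?_ ht⟩) ?_
    · linarith [hs.1]
    refine P.le_of_opNorm_le_of_le le_rfl ?_
    exact (S'.op _).le_of_opNorm_le (hb' _ ⟨le_max_right _ _, max_le hs.2 ht⟩) _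
  have hcr : Continuous fun x : H => S'.op t x - S.op t x := by fun_prop
  exact congrFun (hcl.ext_on hA.dense_domain hcr fun x hx =>
    op_sub_op_of_mem_domain hA hA' ⟨x, hx⟩ ht) x

end Generator

/-! ### Measurability of operator-valued integrands and Fubini on a triangle -/

section Measurability

variable {α H E : Type*} [MeasurableSpace α] [NormedAddCommGroup H] [NormedSpace ℂ H]
  [NormedAddCommGroup E] [NormedSpace ℂ E]

/-- A semigroup need not be measurable in operator norm, so only the orbits are assumed measurable.
Approximating g by simple functions reduces the claim to them. -/
lemma stronglyMeasurable_clm_apply {Φ : α → H →L[ℂ] E} {g : α → H}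
    (hΦ : ∀ x, StronglyMeasurable fun a => Φ a x) (hg : StronglyMeasurable g) :
    StronglyMeasurable fun a => Φ a (g a) := by
  refine stronglyMeasurable_of_tendsto atTop (f := fun n a => Φ a (hg.approx n a)) (fun n => ?_)
    (tendsto_pi_nhds.2 fun a => ((Φ a).continuous.tendsto _).comp (hg.tendsto_approx a))
  induction hg.approx n using SimpleFunc.induction with
  | const c hs =>
    rename_i s
    have : (fun a => Φ a ((SimpleFunc.piecewise s hs (SimpleFunc.const α c)
        (SimpleFunc.const α 0)) a)) = s.indicator fun a => Φ a c := by
      ext a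
      by_cases ha : a ∈ s <;> simp [ha]
    rw [this]
    exact (hΦ c).indicator hs
  | add _ h1 h2 =>
    simpa [Pi.add_def] using h1.add h2

lemma aestronglyMeasurable_clm_apply {μ : Measure α} {Φ : α → H →L[ℂ] E} {g : α → H}
    (hΦ : ∀ x, StronglyMeasurable fun a => Φ a x) (hg : AEStronglyMeasurable g μ) :
    AEStronglyMeasurable (fun a => Φ a (g a)) μ :=
  ⟨fun a => Φ a (hg.mk g a), stronglyMeasurable_clm_apply hΦ hg.stronglyMeasurable_mk, by
    filter_upwards [hg.ae_eq_mk] with a ha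
    rw [ha]⟩

end Measurability

section Triangle

variable {H E : Type*} [NormedAddCommGroup H] [NormedSpace ℂ H]
  [NormedAddCommGroup E] [NormedSpace ℂ E]

/-- Fubini for g times the indicator of the triangle r ≤ s. -/
lemma integral_triangle_swap {G : Type*} [NormedAddCommGroup G] [NormedSpace ℝ G] {t : ℝ}
    (ht : 0 ≤ t) {g : ℝ → ℝ → G}
    (hg : Integrable (Function.uncurry g)
      ((volume.restrict (Set.Ioc 0 t)).prod (volume.restrict (Set.Ioc 0 t)))) :
    ∫ s in (0 : ℝ)..t, ∫ r in (0 : ℝ)..s, g s r = ∫ r in (0 : ℝ)..t, ∫ s in r..t, g s r := by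
  set μ := (volume : Measure ℝ).restrict (Set.Ioc 0 t)
  have hms : MeasurableSet {p : ℝ × ℝ | p.2 ≤ p.1} := measurableSet_le measurable_snd measurable_fst
  have h1 := integral_integral_swap (f := fun s r =>
    ({p : ℝ × ℝ | p.2 ≤ p.1}.indicator (Function.uncurry g)) (s, r)) (hg.indicator hms)
  rw [intervalIntegral.integral_of_le ht, intervalIntegral.integral_of_le ht]
  convert h1 using 1
  · refine setIntegral_congr_fun measurableSet_Ioc fun s hs => ?_
    rw [intervalIntegral.integral_of_le hs.1.le]
    have e : (fun r => {p : ℝ × ℝ | p.2 ≤ p.1}.indicator (Function.uncurry g) (s, r))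
        = (Set.Iic s).indicator (g s) := by
      ext r
      by_cases h : r ≤ s <;> simp [h]
    rw [e, setIntegral_indicator measurableSet_Iic]
    congr 2
    ext r
    simp only [Set.mem_Ioc, Set.mem_inter_iff, Set.mem_Iic]
    constructor
    · intro h; exact ⟨⟨h.1, h.2.trans hs.2⟩, h.2⟩
    · intro h; exact ⟨h.1.1, h.2⟩
  · refine setIntegral_congr_fun measurableSet_Ioc fun r hr => ?_
    -- The slice of the closed triangle contains its left end s = r, hence the closed interval.
    rw [intervalIntegral.integral_of_le hr.2, ← integral_Icc_eq_integral_Ioc]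
    have e : (fun s => {p : ℝ × ℝ | p.2 ≤ p.1}.indicator (Function.uncurry g) (s, r))
        = (Set.Ici r).indicator (fun s => g s r) := by
      ext s
      by_cases h : r ≤ s <;> simp [h]
    rw [e, setIntegral_indicator measurableSet_Ici]
    congr 2
    ext s
    simp only [Set.mem_Ioc, Set.mem_inter_iff, Set.mem_Ici, Set.mem_Icc]
    constructor
    · intro h; exact ⟨⟨hr.1.trans_le h.1, h.2⟩, h.1⟩
    · intro h; exact ⟨h.2, h.1.2⟩

lemma integrable_prod_clm_apply {μ : Measure ℝ} [IsFiniteMeasure μ] {Φ : ℝ × ℝ → H →L[ℂ] E} {c : ℝ}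
    {f : ℝ → H} (hΦ : ∀ x, StronglyMeasurable fun p => Φ p x)
    (hc : ∀ᵐ p ∂(μ.prod μ), ‖Φ p‖ ≤ c)
    (hf : Integrable f μ) :
    Integrable (fun p : ℝ × ℝ => Φ p (f p.2)) (μ.prod μ) := by
  have hf2 : Integrable (fun p : ℝ × ℝ => f p.2) (μ.prod μ) := hf.comp_snd μ
  refine Integrable.mono' (hf2.norm.const_mul c)
    (aestronglyMeasurable_clm_apply hΦ hf2.aestronglyMeasurable) ?_
  filter_upwards [hc] with p hp
  exact (Φ p).le_of_opNorm_le hp _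

lemma ae_mem_prod_Ioc (a t : ℝ) : ∀ᵐ p ∂(((volume : Measure ℝ).restrict (Set.Ioc a t)).prod
    ((volume : Measure ℝ).restrict (Set.Ioc a t))), p.1 ∈ Set.Ioc a t ∧ p.2 ∈ Set.Ioc a t := by
  rw [Measure.prod_restrict]
  exact ae_restrict_mem (measurableSet_Ioc.prod measurableSet_Ioc)

end Triangle

/-! ### Mild solutions under a change of semigroup -/

section Convolution

variable {H : Type*} [NormedAddCommGroup H] [InnerProductSpace ℂ H]

/-- The convolution `∫₀ᵗ S_{t-s} f(s) ds` of a semigroup with an inhomogeneity. -/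
noncomputable def C0Semigroup.conv (S : C0Semigroup H) (f : ℝ → H) (t : ℝ) : H :=
  ∫ s in (0 : ℝ)..t, S.op (t - s) (f s)

variable [CompleteSpace H]

lemma C0Semigroup.stronglyMeasurable_op_max (S : C0Semigroup H) {a : ℝ × ℝ → ℝ}
    (ha : Continuous a) (x : H) : StronglyMeasurable fun p => S.op (max (a p) 0) x :=
  (S.continuous_op_max_apply ha continuous_const).stronglyMeasurable

lemma C0Semigroup.intervalIntegrable_op (S : C0Semigroup H) {f : ℝ → H} {t : ℝ} (ht : 0 ≤ t)
    (hf : IntervalIntegrable f volume 0 t) :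
    IntervalIntegrable (fun s => S.op (t - s) (f s)) volume 0 t := by
  rw [intervalIntegrable_iff_integrableOn_Ioc_of_le ht] at hf ⊢
  obtain ⟨M, hM, hb⟩ := S.exists_bound t
  have h1 : AEStronglyMeasurable (fun s => S.op (max (t - s) 0) (f s))
      (volume.restrict (Set.Ioc 0 t)) :=
    aestronglyMeasurable_clm_apply (fun x => ((S.continuous_op_max x).comp
      (continuous_const.sub continuous_id)).stronglyMeasurable) hf.aestronglyMeasurable
  refine Integrable.mono' (hf.norm.const_mul M) (h1.congr ?_) ?_
  · filter_upwards [ae_restrict_mem measurableSet_Ioc] with s hs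
    rw [max_eq_left (by linarith [hs.2])]
  · filter_upwards [ae_restrict_mem measurableSet_Ioc] with s hs
    exact (S.op _).le_of_opNorm_le (hb _ ⟨by linarith [hs.2], by linarith [hs.1]⟩) _

lemma C0Semigroup.conv_add (S : C0Semigroup H) {f g : ℝ → H} {t : ℝ} (ht : 0 ≤ t)
    (hf : IntervalIntegrable f volume 0 t) (hg : IntervalIntegrable g volume 0 t) :
    S.conv (fun s => f s + g s) t = S.conv f t + S.conv g t := by
  simp only [C0Semigroup.conv, map_add]
  exact intervalIntegral.integral_add (S.intervalIntegrable_op ht hf)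
    (S.intervalIntegrable_op ht hg)

omit [CompleteSpace H] in
lemma C0Semigroup.conv_congr_ae (S : C0Semigroup H) {f g : ℝ → H} {t : ℝ} (ht : 0 ≤ t)
    (h : f =ᵐ[volume.restrict (Set.Ioc 0 t)] g) : S.conv f t = S.conv g t := by
  simp only [C0Semigroup.conv, intervalIntegral.integral_of_le ht]
  refine integral_congr_ae ?_
  filter_upwards [h] with s hs
  rw [hs]

/-- The convolution is a partial integral of a jointly measurable function on the triangle r ≤ s. -/
lemma C0Semigroup.aestronglyMeasurable_conv (S : C0Semigroup H) {f : ℝ → H} {t : ℝ}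
    (hf : AEStronglyMeasurable f (volume.restrict (Set.Ioc 0 t))) :
    AEStronglyMeasurable (S.conv f) (volume.restrict (Set.Ioc 0 t)) := by
  set μ := (volume : Measure ℝ).restrict (Set.Ioc 0 t)
  have h1 : AEStronglyMeasurable (fun p : ℝ × ℝ => S.op (max (p.1 - p.2) 0) (f p.2)) (μ.prod μ) :=
    aestronglyMeasurable_clm_apply (S.stronglyMeasurable_op_max (by fun_prop)) hf.comp_snd
  have hms : MeasurableSet {p : ℝ × ℝ | p.2 ≤ p.1} := measurableSet_le measurable_snd measurable_fst
  refine (h1.indicator hms).integral_prod_right'.congr ?_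
  filter_upwards [ae_restrict_mem measurableSet_Ioc] with s hs
  rw [C0Semigroup.conv, intervalIntegral.integral_of_le hs.1.le]
  have e : (fun r => {p : ℝ × ℝ | p.2 ≤ p.1}.indicator
      (fun p : ℝ × ℝ => S.op (max (p.1 - p.2) 0) (f p.2)) (s, r))
      = (Set.Iic s).indicator (fun r => S.op (s - r) (f r)) := by
    ext r
    by_cases h : r ≤ s <;> simp [h]
  rw [e, setIntegral_indicator measurableSet_Iic]
  congr 2
  ext r
  simp only [Set.mem_Ioc, Set.mem_inter_iff, Set.mem_Iic]
  constructor
  · intro h; exact ⟨h.1.1, h.2⟩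
  · intro h; exact ⟨⟨h.1, h.2.trans hs.2⟩, h.2⟩

omit [CompleteSpace H] in
lemma C0Semigroup.norm_conv_le (S : C0Semigroup H) {M : ℝ} {f : ℝ → H} {t T : ℝ} (ht : 0 ≤ t)
    (htT : t ≤ T) (hb : ∀ s ∈ Set.Icc 0 T, ‖S.op s‖ ≤ M) (hf : IntervalIntegrable f volume 0 T) :
    ‖S.conv f t‖ ≤ M * ∫ s in (0 : ℝ)..T, ‖f s‖ := by
  have hM : 0 ≤ M := (norm_nonneg _).trans (hb 0 ⟨le_rfl, ht.trans htT⟩)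
  have hft : IntervalIntegrable f volume 0 t := hf.mono_set (by
    rw [Set.uIcc_of_le ht, Set.uIcc_of_le (ht.trans htT)]
    exact Set.Icc_subset_Icc_right htT)
  have h1 : ‖S.conv f t‖ ≤ ∫ s in (0 : ℝ)..t, M * ‖f s‖ := by
    refine intervalIntegral.norm_integral_le_of_norm_le ht ?_ (hft.norm.const_mul M)
    refine Eventually.of_forall fun s hs => ?_
    exact (S.op _).le_of_opNorm_le (hb _ ⟨by linarith [hs.2], by linarith [hs.1]⟩) _
  refine h1.trans ?_
  rw [intervalIntegral.integral_const_mul]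
  gcongr
  exact intervalIntegral.integral_mono_interval le_rfl ht htT
    (Eventually.of_forall fun _ => norm_nonneg _) hf.norm

/-- If the generators of `S` and `S'` differ by the bounded operator `P`, a mild solution for `S'`
is a mild solution for `S` with the additional inhomogeneity `P y`. -/
lemma mild_of_perturbed {A : H →ₗ.[ℂ] H} {S S' : C0Semigroup H} (hA : IsGenerator A S)
    {P : H →L[ℂ] H} (hA' : IsGenerator (P.toLinearMap +ᵥ A) S') {x₀ : H} {f y : ℝ → H} {t : ℝ}
    (ht : 0 ≤ t) (hf : IntervalIntegrable f volume 0 t)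
    (hy : ∀ s ∈ Set.Icc 0 t, y s = S'.op s x₀ + S'.conv f s) :
    y t = S.op t x₀ + S.conv (fun s => f s + P (y s)) t := by
  have hfI := (intervalIntegrable_iff_integrableOn_Ioc_of_le ht).1 hf
  set μ := (volume : Measure ℝ).restrict (Set.Ioc 0 t) with hμ
  obtain ⟨M, hM, hb⟩ := S.exists_bound t
  obtain ⟨M', hM', hb'⟩ := S'.exists_bound t
  have hconvI : IntervalIntegrable (S'.conv f) volume 0 t := by
    rw [intervalIntegrable_iff_integrableOn_Ioc_of_le ht]
    refine Integrable.mono' (integrable_const (M' * ∫ s in (0 : ℝ)..t, ‖f s‖))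
      (S'.aestronglyMeasurable_conv hfI.aestronglyMeasurable) ?_
    filter_upwards [ae_restrict_mem measurableSet_Ioc] with s hs
    exact S'.norm_conv_le hs.1.le hs.2 hb' hf
  have hopI : IntervalIntegrable (fun s => S'.op (max s 0) x₀) volume 0 t :=
    (S'.continuous_op_max x₀).intervalIntegrable _ _
  have hPop : IntervalIntegrable (fun s => P (S'.op (max s 0) x₀)) volume 0 t :=
    (P.continuous.comp (S'.continuous_op_max x₀)).intervalIntegrable _ _
  have hPconv : IntervalIntegrable (fun s => P (S'.conv f s)) volume 0 t := by
    rw [intervalIntegrable_iff_integrableOn_Ioc_of_le ht] at hconvI ⊢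
    exact P.integrable_comp hconvI
  have hPy : (fun s => P (y s)) =ᵐ[μ] fun s => P (S'.op (max s 0) x₀) + P (S'.conv f s) := by
    filter_upwards [ae_restrict_mem measurableSet_Ioc] with s hs
    rw [hy s ⟨hs.1.le, hs.2⟩, map_add, max_eq_left hs.1.le]
  have hPyI : IntervalIntegrable (fun s => P (y s)) volume 0 t := by
    have := hPop.add hPconv
    rw [intervalIntegrable_iff_integrableOn_Ioc_of_le ht] at this ⊢
    exact this.congr hPy.symm
  -- The part of P y coming from the initial value is Duhamel's formula for x₀.
  have e1 : S.conv (fun s => P (S'.op (max s 0) x₀)) t = S'.op t x₀ - S.op t x₀ := by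
    rw [← op_sub_op hA hA' x₀ ht]
    refine intervalIntegral.integral_congr fun s hs => ?_
    rw [Set.uIcc_of_le ht] at hs
    dsimp only
    rw [max_eq_left (show 0 ≤ t - s by linarith [hs.2])]
  -- The part coming from the inhomogeneity: after exchanging the integrals, the inner one over s
  -- from r to t is Duhamel's formula for the vector f r on an interval of length t - r.
  have e2 : S.conv (fun s => P (S'.conv f s)) t = S'.conv f t - S.conv f t := by
    set Φ : ℝ × ℝ → H →L[ℂ] H := fun p =>
      (S.op (max (t - p.1) 0)).comp (P.comp (S'.op (max (p.1 - p.2) 0))) with hΦ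
    have hΦm : ∀ x, StronglyMeasurable fun p => Φ p x := fun x =>
      (S.continuous_op_max_apply (a := fun p : ℝ × ℝ => t - p.1)
        (y := fun p : ℝ × ℝ => P (S'.op (max (p.1 - p.2) 0) x)) (by fun_prop)
        (P.continuous.comp (S'.continuous_op_max_apply (by fun_prop)
          continuous_const))).stronglyMeasurable
    have hΦb : ∀ᵐ p ∂(μ.prod μ), ‖Φ p‖ ≤ M * (‖P‖ * M') := by
      filter_upwards [ae_mem_prod_Ioc 0 t] with p hp
      refine (ContinuousLinearMap.opNorm_comp_le _ _).trans ?_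
      gcongr
      · exact hb _ ⟨le_max_right _ _, max_le (by linarith [hp.1.1]) ht⟩
      refine (ContinuousLinearMap.opNorm_comp_le _ _).trans ?_
      gcongr
      exact hb' _ ⟨le_max_right _ _, max_le (by linarith [hp.1.2, hp.2.1]) ht⟩
    have hsw := integral_triangle_swap ht (g := fun s r => Φ (s, r) (f r))
      (integrable_prod_clm_apply hΦm hΦb hfI)
    have e3 : S.conv (fun s => P (S'.conv f s)) t
        = ∫ s in (0 : ℝ)..t, ∫ r in (0 : ℝ)..s, Φ (s, r) (f r) := by
      refine intervalIntegral.integral_congr fun s hs => ?_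
      rw [Set.uIcc_of_le ht] at hs
      have hfs : IntervalIntegrable f volume 0 s := hf.mono_set (by
        rw [Set.uIcc_of_le ht, Set.uIcc_of_le hs.1]
        exact Set.Icc_subset_Icc_right hs.2)
      dsimp only
      rw [C0Semigroup.conv, ← ContinuousLinearMap.comp_apply,
        ← ContinuousLinearMap.intervalIntegral_comp_comm _ (S'.intervalIntegrable_op hs.1 hfs)]
      refine intervalIntegral.integral_congr fun r hr => ?_
      rw [Set.uIcc_of_le hs.1] at hr
      simp only [hΦ, ContinuousLinearMap.comp_apply]
      rw [max_eq_left (show 0 ≤ t - s by linarith [hs.2]),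
        max_eq_left (show 0 ≤ s - r by linarith [hr.2])]
    rw [e3, hsw, C0Semigroup.conv, C0Semigroup.conv, ← intervalIntegral.integral_sub
      (S'.intervalIntegrable_op ht hf) (S.intervalIntegrable_op ht hf)]
    refine intervalIntegral.integral_congr fun r hr => ?_
    rw [Set.uIcc_of_le ht] at hr
    have htr : 0 ≤ t - r := by linarith [hr.2]
    rw [← op_sub_op hA hA' (f r) htr]
    have h2 := intervalIntegral.integral_comp_sub_right (a := r) (b := t)
      (fun σ : ℝ => S.op (max (t - r - σ) 0) (P (S'.op (max σ 0) (f r)))) r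
    rw [sub_self] at h2
    rw [← h2]
    refine intervalIntegral.integral_congr fun s _ => ?_
    simp only [hΦ, ContinuousLinearMap.comp_apply]
    rw [show t - r - (s - r) = t - s by ring]
  rw [S.conv_add ht hf hPyI, S.conv_congr_ae ht hPy, S.conv_add ht hPop hPconv, e1, e2,
    hy t ⟨ht, le_rfl⟩]
  abel

/-- The converse of `mild_of_perturbed`. -/
lemma perturbed_of_mild {A : H →ₗ.[ℂ] H} {S S' : C0Semigroup H} (hA : IsGenerator A S)
    {P : H →L[ℂ] H} (hA' : IsGenerator (P.toLinearMap +ᵥ A) S') {x₀ : H} {f y : ℝ → H} {t : ℝ}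
    (ht : 0 ≤ t) (hf : IntervalIntegrable f volume 0 t)
    (hy : ∀ s ∈ Set.Icc 0 t, y s = S.op s x₀ + S.conv f s) :
    y t = S'.op t x₀ + S'.conv (fun s => f s - P (y s)) t := by
  -- A is the perturbation of A + P by -P, so S and S' exchange roles.
  have hA2 : IsGenerator ((-P).toLinearMap +ᵥ (P.toLinearMap +ᵥ A)) S := by
    have e : (-P).toLinearMap +ᵥ (P.toLinearMap +ᵥ A) = A := by
      rw [vadd_vadd]
      simp
    rwa [e]
  simpa [sub_eq_add_neg] using mild_of_perturbed hA' hA2 ht hf hy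

end Convolution

/-! ### Inverse of the generator of an exponentially stable semigroup -/

section Resolvent

variable {H : Type*} [NormedAddCommGroup H] [InnerProductSpace ℂ H] [CompleteSpace H]

/-- The generator of an exponentially stable semigroup is boundedly invertible; `R` is the negative
of the inverse, i.e. `R x = ∫₀^∞ S_s x ds`. -/
lemma exists_neg_inverse_of_stable {A : H →ₗ.[ℂ] H} {S : C0Semigroup H} (hA : IsGenerator A S)
    (hS : S.ExponentiallyStable) :
    ∃ R : H →L[ℂ] H, (∀ x, ∃ hx : R x ∈ A.domain, A ⟨R x, hx⟩ = -x) ∧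
      (∀ x : A.domain, R (A x) = -x) ∧
      ∀ x t, 0 ≤ t → ∫ s in (0 : ℝ)..t, S.op (max s 0) x = R x - R (S.op t x) := by
  obtain ⟨M, ω, hM, hω, hb⟩ := hS
  have hcont := S.continuous_op_max
  have hii : ∀ x a b, IntervalIntegrable (fun s : ℝ => S.op (max s 0) x) volume a b :=
    fun x a b => (hcont x).intervalIntegrable a b
  have hdom : ∀ x, ∀ᵐ s ∂(volume.restrict (Set.Ioi (0 : ℝ))),
      ‖S.op (max s 0) x‖ ≤ M * Real.exp (-ω * s) * ‖x‖ := by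
    intro x
    filter_upwards [ae_restrict_mem measurableSet_Ioi] with s hs
    have hs : (0 : ℝ) < s := hs
    rw [max_eq_left hs.le]
    exact (S.op s).le_of_opNorm_le (hb s hs.le) x
  have hdomI : ∀ x : H, IntegrableOn (fun s : ℝ => M * Real.exp (-ω * s) * ‖x‖) (Set.Ioi 0) :=
    fun x => ((exp_neg_integrableOn_Ioi 0 hω).const_mul M).mul_const ‖x‖
  have hint : ∀ x, IntegrableOn (fun s : ℝ => S.op (max s 0) x) (Set.Ioi 0) := fun x =>
    (hdomI x).mono' (hcont x).aestronglyMeasurable (hdom x)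
  set R : H →L[ℂ] H := LinearMap.mkContinuous
    { toFun := fun x => ∫ s in Set.Ioi (0 : ℝ), S.op (max s 0) x
      map_add' := fun x y => by
        simp only [map_add]
        exact integral_add (hint x) (hint y)
      map_smul' := fun c x => by
        simp only [map_smul, RingHom.id_apply]
        exact integral_smul c _ } (∫ s in Set.Ioi (0 : ℝ), M * Real.exp (-ω * s)) (fun x => by
    refine (norm_integral_le_of_norm_le (hdomI x) (hdom x)).trans ?_
    rw [integral_mul_const]) with hR
  have hlim : ∀ x, Tendsto (fun a => ∫ s in (0 : ℝ)..a, S.op (max s 0) x) atTop (𝓝 (R x)) :=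
    fun x => intervalIntegral_tendsto_integral_Ioi 0 (hint x) tendsto_id
  have hdecay : ∀ x, Tendsto (fun t => S.op t x) atTop (𝓝 0) := by
    intro x
    have h1 : Tendsto (fun t : ℝ => M * Real.exp (-ω * t) * ‖x‖) atTop (𝓝 0) := by
      have h2 : Tendsto (fun t : ℝ => Real.exp (-ω * t)) atTop (𝓝 0) :=
        Real.tendsto_exp_atBot.comp (tendsto_id.const_mul_atTop_of_neg (by linarith))
      simpa using (h2.const_mul M).mul_const ‖x‖
    refine squeeze_zero_norm' ?_ h1
    filter_upwards [eventually_ge_atTop 0] with t ht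
    exact (S.op t).le_of_opNorm_le (hb t ht) x
  refine ⟨R, fun x => ?_, fun x => ?_, fun x t ht => ?_⟩
  -- Let the length of the orbit segment in `op_integral_sub` tend to infinity: its far end vanishes
  -- and S_t R x - R x = -∫₀ᵗ S_s x ds remains. Dividing by t gives A R x = -x.
  · have h1 : ∀ t : ℝ, 0 ≤ t → S.op t (R x) - R x = -∫ s in (0 : ℝ)..t, S.op (max s 0) x := by
      intro t ht
      have h2 := ((((S.op t).continuous.tendsto _).comp (hlim x)).sub (hlim x))
      have h3 : Tendsto (fun a => (∫ s in a..(a + t), S.op (max s 0) x)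
          - ∫ s in (0 : ℝ)..t, S.op (max s 0) x) atTop
          (𝓝 (R x - R x - ∫ s in (0 : ℝ)..t, S.op (max s 0) x)) := by
        refine Tendsto.sub_const ?_ _
        refine (((hlim x).comp (tendsto_atTop_add_const_right _ t tendsto_id)).sub (hlim x)).congr
          fun a => ?_
        exact intervalIntegral.integral_interval_sub_left (hii _ _ _) (hii _ _ _)
      rw [sub_self, zero_sub] at h3
      refine tendsto_nhds_unique h2 (h3.congr' ?_)
      filter_upwards [eventually_ge_atTop 0] with a ha
      exact (op_integral_sub S x a t ht ha).symm
    have h2 := (tendsto_average_nhdsGT (hcont x) 0).neg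
    simp only [zero_add, max_self, S.op_zero_apply] at h2
    refine hA.of_tendsto (h2.congr' ?_)
    filter_upwards [self_mem_nhdsWithin] with t ht
    rw [h1 t (le_of_lt ht), smul_neg]
  · refine tendsto_nhds_unique (hlim (A x)) ?_
    have h1 := (hdecay x).sub_const (x : H)
    rw [zero_sub] at h1
    refine h1.congr' ?_
    filter_upwards [eventually_ge_atTop 0] with t ht
    exact (op_sub_of_mem_domain hA x ht).symm
  -- R S_t x is the tail beyond t of the integral defining R x.
  · have h1 : Tendsto (fun a => (∫ s in (0 : ℝ)..(a + t), S.op (max s 0) x)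
        - ∫ s in (0 : ℝ)..t, S.op (max s 0) x) atTop
        (𝓝 (R x - ∫ s in (0 : ℝ)..t, S.op (max s 0) x)) :=
      ((hlim x).comp (tendsto_atTop_add_const_right _ t tendsto_id)).sub_const _
    have h2 : R (S.op t x) = R x - ∫ s in (0 : ℝ)..t, S.op (max s 0) x := by
      refine tendsto_nhds_unique (hlim (S.op t x)) (h1.congr' ?_)
      filter_upwards [eventually_ge_atTop 0] with a ha
      rw [intervalIntegral.integral_interval_sub_left (hii _ _ _) (hii _ _ _)]
      have h3 := intervalIntegral.integral_comp_add_right (a := 0) (b := a)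
        (fun s : ℝ => S.op (max s 0) x) t
      rw [zero_add] at h3
      rw [← h3]
      refine intervalIntegral.integral_congr fun s hs => ?_
      rw [Set.uIcc_of_le ha] at hs
      rw [max_eq_left hs.1, max_eq_left (by linarith [hs.1]), S.op_add_apply hs.1 ht]
    rw [h2]
    abel

end Resolvent

/-! ### Energies on the horizon and exponential kernels -/

section Energy

/-- Lebesgue measure on the time horizon `(0, T]`. -/
noncomputable abbrev horizon (T : ℝ) : Measure ℝ := volume.restrict (Set.Ioc 0 T)

/-- The squared `L²` norm on the time horizon `(0, T]`. -/
noncomputable def energy {E : Type*} [NormedAddCommGroup E] (T : ℝ) (f : ℝ → E) : ℝ :=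
  ∫ t, ‖f t‖ ^ 2 ∂horizon T

variable {E F : Type*} [NormedAddCommGroup E] [NormedAddCommGroup F]

lemma energy_nonneg (T : ℝ) (f : ℝ → E) : 0 ≤ energy T f :=
  integral_nonneg fun _ => by positivity

lemma energy_mono {T : ℝ} {f : ℝ → E} {g : ℝ → F} (hg : MemLp g 2 (horizon T))
    (h : ∀ᵐ t ∂horizon T, ‖f t‖ ≤ ‖g t‖) : energy T f ≤ energy T g := by
  refine integral_mono_of_nonneg (Eventually.of_forall fun _ => by positivity)
    (hg.integrable_norm_pow two_ne_zero) ?_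
  filter_upwards [h] with t ht
  gcongr

lemma energy_add_le {T : ℝ} {f g : ℝ → E} (hf : MemLp f 2 (horizon T))
    (hg : MemLp g 2 (horizon T)) :
    energy T (fun t => f t + g t) ≤ 2 * energy T f + 2 * energy T g := by
  have h1 := hf.integrable_norm_pow two_ne_zero
  have h2 := hg.integrable_norm_pow two_ne_zero
  rw [energy, energy, energy, ← integral_const_mul, ← integral_const_mul, ← integral_add
    (h1.const_mul 2) (h2.const_mul 2)]
  refine integral_mono_of_nonneg (Eventually.of_forall fun _ => by positivity)
    ((h1.const_mul 2).add (h2.const_mul 2)) (Eventually.of_forall fun t => ?_)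
  dsimp only
  have h3 := norm_add_le (f t) (g t)
  nlinarith [norm_nonneg (f t + g t), sq_nonneg (‖f t‖ - ‖g t‖), norm_nonneg (f t),
    norm_nonneg (g t)]

lemma energy_clm_le [NormedSpace ℂ E] [NormedSpace ℂ F] (L : E →L[ℂ] F) {T : ℝ} {f : ℝ → E}
    (hf : MemLp f 2 (horizon T)) : energy T (fun t => L (f t)) ≤ ‖L‖ ^ 2 * energy T f := by
  rw [energy, energy, ← integral_const_mul]
  refine integral_mono_of_nonneg (Eventually.of_forall fun _ => by positivity)
    ((hf.integrable_norm_pow two_ne_zero).const_mul _) (Eventually.of_forall fun t => ?_)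
  dsimp only
  rw [← mul_pow]
  gcongr
  exact L.le_opNorm _

lemma memLp_clm [NormedSpace ℂ E] [NormedSpace ℂ F] (L : E →L[ℂ] F) {μ : Measure ℝ} {f : ℝ → E}
    (hf : MemLp f 2 μ) : MemLp (fun t => L (f t)) 2 μ :=
  L.comp_memLp' hf

lemma MemLp.intervalIntegrable_of_le {T t : ℝ} {f : ℝ → E} (hf : MemLp f 2 (horizon T))
    (ht : 0 ≤ t) (htT : t ≤ T) : IntervalIntegrable f volume 0 t := by
  rw [intervalIntegrable_iff_integrableOn_Ioc_of_le ht]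
  exact IntegrableOn.mono_set (hf.integrable one_le_two) (Set.Ioc_subset_Ioc_right htT)

end Energy

section ExponentialKernel

/-- Convolution of a scalar function with the kernel `exp (-α t)` on `[0, t]`. -/
noncomputable def expConv (α : ℝ) (f : ℝ → ℝ) (t : ℝ) : ℝ :=
  ∫ s in (0 : ℝ)..t, Real.exp (-α * (t - s)) * f s

lemma intervalIntegrable_exp_mul {α t a b : ℝ} {f : ℝ → ℝ} (hf : IntervalIntegrable f volume a b) :
    IntervalIntegrable (fun s => Real.exp (-α * (t - s)) * f s) volume a b :=
  hf.continuousOn_mul (by fun_prop)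

lemma integral_exp_le {α t : ℝ} (hα : 0 < α) :
    ∫ s in (0 : ℝ)..t, Real.exp (-α * (t - s)) ≤ 1 / α := by
  have h : ∀ s ∈ Set.uIcc 0 t, HasDerivAt (fun s => Real.exp (-α * (t - s)) / α)
      (Real.exp (-α * (t - s))) s := by
    intro s _
    have h1 : HasDerivAt (fun s => -α * (t - s)) α s := by
      simpa using ((hasDerivAt_id s).const_sub t).const_mul (-α)
    have h2 := h1.exp.div_const α
    rwa [mul_div_cancel_right₀ _ hα.ne'] at h2
  rw [intervalIntegral.integral_eq_sub_of_hasDerivAt h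
    (Continuous.intervalIntegrable (by fun_prop) _ _)]
  simp only [sub_self, mul_zero, Real.exp_zero]
  have : 0 ≤ Real.exp (-α * (t - 0)) / α := by positivity
  linarith

/-- Cauchy–Schwarz for the kernel, whose mass is at most 1/α. -/
lemma sq_expConv_le {α t : ℝ} (hα : 0 < α) (ht : 0 ≤ t) {f : ℝ → ℝ}
    (hf : IntervalIntegrable f volume 0 t)
    (hf2 : IntervalIntegrable (fun s => f s ^ 2) volume 0 t) :
    expConv α f t ^ 2 ≤ 1 / α * expConv α (fun s => f s ^ 2) t := by
  set I := expConv α f t with hI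
  -- The weighted integral of (f - l)² is nonnegative; l is α times the convolution because that
  -- minimizes the resulting bound once the kernel mass is replaced by 1/α.
  set l := I * α with hl
  have h0 : 0 ≤ ∫ s in (0 : ℝ)..t, Real.exp (-α * (t - s)) * (f s - l) ^ 2 :=
    intervalIntegral.integral_nonneg ht fun s _ => by positivity
  have h1 : ∫ s in (0 : ℝ)..t, Real.exp (-α * (t - s)) * (f s - l) ^ 2
      = expConv α (fun s => f s ^ 2) t - 2 * l * I
        + l ^ 2 * ∫ s in (0 : ℝ)..t, Real.exp (-α * (t - s)) := by
    have i1 := intervalIntegrable_exp_mul (α := α) (t := t) hf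
    have i2 := intervalIntegrable_exp_mul (α := α) (t := t) hf2
    have i3 : IntervalIntegrable (fun s => Real.exp (-α * (t - s))) volume 0 t :=
      Continuous.intervalIntegrable (by fun_prop) _ _
    rw [hI, expConv, expConv, ← intervalIntegral.integral_const_mul,
      ← intervalIntegral.integral_const_mul, ← intervalIntegral.integral_sub i2 (i1.const_mul _),
      ← intervalIntegral.integral_add (i2.sub (i1.const_mul _)) (i3.const_mul _)]
    refine intervalIntegral.integral_congr fun s _ => ?_
    ring
  rw [h1] at h0
  have h2 := integral_exp_le (t := t) hα
  have h3 : l ^ 2 * ∫ s in (0 : ℝ)..t, Real.exp (-α * (t - s)) ≤ l ^ 2 * (1 / α) := by gcongr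
  have h4 : l ^ 2 * (1 / α) = I ^ 2 * α := by rw [hl]; field_simp
  have h5 : I ^ 2 * α ≤ expConv α (fun s => f s ^ 2) t := by
    have : 2 * l * I = 2 * (I ^ 2 * α) := by rw [hl]; ring
    linarith
  rw [one_div, ← div_eq_inv_mul, le_div_iff₀ hα]
  exact h5

lemma expConv_le_integral {α t T : ℝ} (hα : 0 ≤ α) (ht : 0 ≤ t) (htT : t ≤ T) {f : ℝ → ℝ}
    (hf : ∀ s, 0 ≤ f s) (hfi : IntervalIntegrable f volume 0 T) :
    expConv α f t ≤ ∫ s in (0 : ℝ)..T, f s := by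
  have hft : IntervalIntegrable f volume 0 t := hfi.mono_set (by
    rw [Set.uIcc_of_le ht, Set.uIcc_of_le (ht.trans htT)]
    exact Set.Icc_subset_Icc_right htT)
  refine (intervalIntegral.integral_mono_on ht (intervalIntegrable_exp_mul hft) hft
    fun s hs => ?_).trans (intervalIntegral.integral_mono_interval le_rfl ht htT
    (Eventually.of_forall hf) hfi)
  refine mul_le_of_le_one_left (hf s) (Real.exp_le_one_iff.2 ?_)
  nlinarith [hs.2]

lemma integral_mul_expConv {α T : ℝ} (hT : 0 ≤ T) {a b : ℝ → ℝ}
    (ha : IntervalIntegrable a volume 0 T) (hb : IntervalIntegrable b volume 0 T) :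
    ∫ t in (0 : ℝ)..T, a t * expConv α b t
      = ∫ s in (0 : ℝ)..T, b s * ∫ t in s..T, Real.exp (-α * (t - s)) * a t := by
  rw [intervalIntegrable_iff_integrableOn_Ioc_of_le hT] at ha hb
  -- The triangle lemma asks for integrability on the whole square, where t - s may be negative;
  -- there the kernel is bounded by e^{|α|T}.
  have h1 : Integrable (Function.uncurry fun t s => Real.exp (-α * (t - s)) * (a t * b s))
      ((horizon T).prod (horizon T)) := by
    refine (ha.mul_prod hb).bdd_mul (c := Real.exp (|α| * T))
      (Continuous.aestronglyMeasurable (by fun_prop)) ?_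
    filter_upwards [ae_mem_prod_Ioc 0 T] with p hp
    rw [Real.norm_eq_abs, Real.abs_exp, Real.exp_le_exp]
    have h2 : |p.1 - p.2| ≤ T := by
      rw [abs_le]; constructor <;> linarith [hp.1.1, hp.1.2, hp.2.1, hp.2.2]
    calc -α * (p.1 - p.2) ≤ |-α * (p.1 - p.2)| := le_abs_self _
      _ = |α| * |p.1 - p.2| := by rw [abs_mul, abs_neg]
      _ ≤ |α| * T := by gcongr
  have h2 := integral_triangle_swap hT h1
  convert h2 using 1
  · refine intervalIntegral.integral_congr fun t _ => ?_
    rw [expConv, ← intervalIntegral.integral_const_mul]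
    refine intervalIntegral.integral_congr fun s _ => ?_
    ring
  · refine intervalIntegral.integral_congr fun s _ => ?_
    rw [← intervalIntegral.integral_const_mul]
    refine intervalIntegral.integral_congr fun t _ => ?_
    ring

lemma integral_exp_tail_le {α s T : ℝ} (hα : 0 < α) :
    ∫ t in s..T, Real.exp (-α * (t - s)) ≤ 1 / α := by
  have h : ∀ t ∈ Set.uIcc s T, HasDerivAt (fun t => -(Real.exp (-α * (t - s)) / α))
      (Real.exp (-α * (t - s))) t := by
    intro t _
    have h1 : HasDerivAt (fun t => -α * (t - s)) (-α) t := by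
      simpa using ((hasDerivAt_id t).sub_const s).const_mul (-α)
    have h2 := (h1.exp.div_const α).neg
    rw [mul_neg, neg_div, neg_neg, mul_div_cancel_right₀ _ hα.ne'] at h2
    exact h2
  rw [intervalIntegral.integral_eq_sub_of_hasDerivAt h
    (Continuous.intervalIntegrable (by fun_prop) _ _)]
  simp only [sub_self, mul_zero, Real.exp_zero]
  have : 0 ≤ Real.exp (-α * (T - s)) / α := by positivity
  linarith

/-- The kernel factors as e^{-αt} e^{αs}, which leaves a primitive. -/
lemma continuousOn_expConv {α T : ℝ} {f : ℝ → ℝ} (hf : IntegrableOn f (Set.Ioc 0 T)) :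
    ContinuousOn (expConv α f) (Set.Icc 0 T) := by
  have h1 : ContinuousOn (fun t => ∫ s in Set.Ioc 0 t, Real.exp (α * s) * f s) (Set.Icc 0 T) := by
    apply intervalIntegral.continuousOn_primitive
    rw [integrableOn_Icc_iff_integrableOn_Ioc]
    rcases le_total 0 T with hT | hT
    · rw [← intervalIntegrable_iff_integrableOn_Ioc_of_le hT] at hf ⊢
      exact hf.continuousOn_mul (by fun_prop)
    · simp [Set.Ioc_eq_empty (not_lt.2 hT)]
  have h2 : ContinuousOn (fun t => Real.exp (-α * t) *
      ∫ s in Set.Ioc 0 t, Real.exp (α * s) * f s) (Set.Icc 0 T) :=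
    ContinuousOn.mul (by fun_prop) h1
  refine h2.congr fun t ht => ?_
  dsimp only
  rw [← intervalIntegral.integral_of_le ht.1, expConv, ← intervalIntegral.integral_const_mul]
  refine intervalIntegral.integral_congr fun s _ => ?_
  rw [← mul_assoc, ← Real.exp_add]
  congr 2
  ring

/-- Schur test: after Cauchy–Schwarz in s, exchanging the integrals leaves the mass of the kernel in
t, again at most 1/α. The constant does not depend on T. -/
lemma integral_sq_expConv_le {α T : ℝ} (hα : 0 < α) (hT : 0 ≤ T) {f : ℝ → ℝ}
    (hf : MemLp f 2 (horizon T)) :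
    MemLp (expConv α f) 2 (horizon T) ∧
      energy T (expConv α f) ≤ (1 / α) ^ 2 * energy T f := by
  have hfi : ∀ t, 0 ≤ t → t ≤ T → IntervalIntegrable f volume 0 t := fun t =>
    MemLp.intervalIntegrable_of_le hf
  have hf2I : IntegrableOn (fun s => f s ^ 2) (Set.Ioc 0 T) := hf.integrable_sq
  have hf2 : ∀ t, 0 ≤ t → t ≤ T → IntervalIntegrable (fun s => f s ^ 2) volume 0 t :=
    fun t ht htT => by
      rw [intervalIntegrable_iff_integrableOn_Ioc_of_le ht]
      exact hf2I.mono_set (Set.Ioc_subset_Ioc_right htT)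
  have hc := continuousOn_expConv (α := α) (hf.integrable one_le_two)
  have hc2 := continuousOn_expConv (α := α) hf2I
  have hsq : IntegrableOn (fun t => expConv α f t ^ 2) (Set.Ioc 0 T) :=
    (hc.pow 2).integrableOn_Icc.mono_set Set.Ioc_subset_Icc_self
  have hm : AEStronglyMeasurable (expConv α f) (horizon T) :=
    (hc.mono Set.Ioc_subset_Icc_self).aestronglyMeasurable measurableSet_Ioc
  refine ⟨(memLp_two_iff_integrable_sq hm).2 hsq, ?_⟩
  have h1 : energy T (expConv α f) ≤ ∫ t in (0 : ℝ)..T, 1 / α * expConv α (fun s => f s ^ 2) t := by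
    rw [intervalIntegral.integral_of_le hT]
    simp only [energy, Real.norm_eq_abs, sq_abs]
    refine setIntegral_mono_on hsq
      ((hc2.integrableOn_Icc.mono_set Set.Ioc_subset_Icc_self).const_mul _) measurableSet_Ioc ?_
    exact fun t ht => sq_expConv_le hα ht.1.le (hfi t ht.1.le ht.2) (hf2 t ht.1.le ht.2)
  refine h1.trans ?_
  rw [integral_mul_expConv hT intervalIntegrable_const (hf2 T hT le_rfl),
    intervalIntegral.integral_of_le hT, energy, ← integral_const_mul]
  simp only [Real.norm_eq_abs, sq_abs]
  refine integral_mono_of_nonneg ?_ (hf2I.const_mul _) ?_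
  · filter_upwards [ae_restrict_mem measurableSet_Ioc] with s hs
    refine mul_nonneg (sq_nonneg _) (intervalIntegral.integral_nonneg hs.2 fun t _ => ?_)
    positivity
  · filter_upwards [ae_restrict_mem measurableSet_Ioc] with s hs
    rw [intervalIntegral.integral_mul_const, mul_comm]
    have := integral_exp_tail_le (s := s) (T := T) hα
    have h3 : (∫ t in s..T, Real.exp (-α * (t - s))) * (1 / α) ≤ (1 / α) ^ 2 := by
      rw [sq]; gcongr
    gcongr

lemma sq_expConv_le_energy {α t T : ℝ} (hα : 0 < α) (ht : 0 ≤ t) (htT : t ≤ T) {f : ℝ → ℝ}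
    (hf : MemLp f 2 (horizon T)) : expConv α f t ^ 2 ≤ 1 / α * energy T f := by
  have hf2I : IntegrableOn (fun s => f s ^ 2) (Set.Ioc 0 T) := hf.integrable_sq
  have hf2 : IntervalIntegrable (fun s => f s ^ 2) volume 0 T := by
    rw [intervalIntegrable_iff_integrableOn_Ioc_of_le (ht.trans htT)]
    exact hf2I
  have hf2t : IntervalIntegrable (fun s => f s ^ 2) volume 0 t := by
    rw [intervalIntegrable_iff_integrableOn_Ioc_of_le ht]
    exact hf2I.mono_set (Set.Ioc_subset_Ioc_right htT)
  refine (sq_expConv_le hα ht (MemLp.intervalIntegrable_of_le hf ht htT) hf2t).trans ?_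
  gcongr
  refine (expConv_le_integral hα.le ht htT (fun s => sq_nonneg _) hf2).trans_eq ?_
  rw [intervalIntegral.integral_of_le (ht.trans htT), energy]
  simp

variable {E : Type*} [NormedAddCommGroup E]

lemma memLp_of_norm_le_expConv {α c T : ℝ} (hα : 0 < α) (hT : 0 ≤ T) {y : ℝ → E}
    {b : ℝ → ℝ} (hy : AEStronglyMeasurable y (horizon T)) (hb : MemLp b 2 (horizon T))
    (h : ∀ t ∈ Set.Icc 0 T, ‖y t‖ ≤ c * expConv α b t) :
    MemLp y 2 (horizon T) ∧ energy T y ≤ (c / α) ^ 2 * energy T b ∧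
      ∀ t ∈ Set.Icc 0 T, ‖y t‖ ^ 2 ≤ c ^ 2 / α * energy T b := by
  obtain ⟨h1, h2⟩ := integral_sq_expConv_le hα hT hb
  have h3 : MemLp (fun t => c * expConv α b t) 2 (horizon T) := h1.const_mul c
  have h4 : ∀ᵐ t ∂horizon T, ‖y t‖ ≤ ‖c * expConv α b t‖ := by
    filter_upwards [ae_restrict_mem measurableSet_Ioc] with t ht
    exact (h t ⟨ht.1.le, ht.2⟩).trans (le_abs_self _)
  refine ⟨h3.mono hy h4, (energy_mono h3 h4).trans ?_, fun t ht => ?_⟩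
  · have : energy T (fun t => c * expConv α b t) = c ^ 2 * energy T (expConv α b) := by
      simp only [energy, norm_mul, mul_pow, integral_const_mul, Real.norm_eq_abs, sq_abs]
    rw [this]
    calc c ^ 2 * energy T (expConv α b) ≤ c ^ 2 * ((1 / α) ^ 2 * energy T b) := by gcongr
      _ = _ := by ring
  · calc ‖y t‖ ^ 2 ≤ (c * expConv α b t) ^ 2 := by gcongr; exact h t ht
      _ = c ^ 2 * expConv α b t ^ 2 := by ring
      _ ≤ c ^ 2 * (1 / α * energy T b) := by
        gcongr; exact sq_expConv_le_energy hα ht.1 ht.2 hb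
      _ = _ := by ring

end ExponentialKernel

/-! ### The quadratic cost and its derivative -/

section Cost

lemma sq_norm_add {E : Type*} [NormedAddCommGroup E] [InnerProductSpace ℂ E] (a b : E) :
    ‖a + b‖ ^ 2 = ‖a‖ ^ 2 + 2 * (inner ℂ a b).re + ‖b‖ ^ 2 := by
  simpa using norm_add_sq (𝕜 := ℂ) a b

variable {H U Y : Type*}
  [NormedAddCommGroup H] [InnerProductSpace ℂ H]
  [NormedAddCommGroup U] [InnerProductSpace ℂ U]
  [NormedAddCommGroup Y] [InnerProductSpace ℂ Y]

/-- The bilinear form `Re ⟨C x, C x'⟩ + Re ⟨K u, K u'⟩`. -/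
noncomputable def costForm (C : H →L[ℂ] Y) (K : U →L[ℂ] H) (x : H) (u : U) (x' : H) (u' : U) : ℝ :=
  (inner ℂ (C x) (C x')).re + (inner ℂ (K u) (K u')).re

/-- Half the derivative of the running cost at `(x, u)` in the direction `(x', u')`. -/
noncomputable def costDeriv (C : H →L[ℂ] Y) (K : U →L[ℂ] H) (z : H) (v : U)
    (x : H) (u : U) (x' : H) (u' : U) :
    ℝ :=
  costForm C K x u x' u' + ((inner ℂ z x').re + (inner ℂ v u').re)

variable (C : H →L[ℂ] Y) (K : U →L[ℂ] H) (z : H) (v : U)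

lemma runningCost_add (x x' : H) (u u' : U) :
    runningCost C K z v (x + x') (u + u') = runningCost C K z v x u
      + 2 * costDeriv C K z v x u x' u' + (‖C x'‖ ^ 2 + ‖K u'‖ ^ 2) := by
  simp only [runningCost, costDeriv, costForm, map_add, sq_norm_add, inner_add_right,
    Complex.add_re]
  ring

lemma costDeriv_smul (r : ℝ) (x x' : H) (u u' : U) :
    costDeriv C K z v x u (r • x') (r • u') = r * costDeriv C K z v x u x' u' := by
  simp only [costDeriv, costForm, ContinuousLinearMap.map_smul_of_tower, inner_smul_right_eq_smul,
    Complex.smul_re, smul_eq_mul]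
  ring

/-- Separates the derivative into the quadratic form of the deviation and the derivative at the
reference point, which becomes the boundary term when that point is the optimal steady state. -/
lemma costDeriv_sub (x xe x' : H) (u ue u' : U) :
    costDeriv C K z v x u x' u'
      = costForm C K (x - xe) (u - ue) x' u' + costDeriv C K z v xe ue x' u' := by
  simp only [costDeriv, costForm, map_sub, inner_sub_left, Complex.sub_re]
  ring

lemma abs_re_inner_le {E : Type*} [NormedAddCommGroup E] [InnerProductSpace ℂ E] (a b : E) :
    |(inner ℂ a b).re| ≤ ‖a‖ * ‖b‖ :=
  (Complex.abs_re_le_norm _).trans (norm_inner_le_norm a b)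

lemma abs_costForm_le (x x' : H) (u u' : U) :
    |costForm C K x u x' u'| ≤ ‖C‖ ^ 2 * (‖x‖ * ‖x'‖) + ‖K‖ ^ 2 * (‖u‖ * ‖u'‖) := by
  have h1 := abs_re_inner_le (C x) (C x')
  have h2 := abs_re_inner_le (K u) (K u')
  have h3 : ‖C x‖ * ‖C x'‖ ≤ (‖C‖ * ‖x‖) * (‖C‖ * ‖x'‖) := by
    gcongr <;> exact C.le_opNorm _
  have h4 : ‖K u‖ * ‖K u'‖ ≤ (‖K‖ * ‖u‖) * (‖K‖ * ‖u'‖) := by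
    gcongr <;> exact K.le_opNorm _
  refine (abs_add_le _ _).trans ?_
  linarith

lemma abs_costDeriv_le (x x' : H) (u u' : U) :
    |costDeriv C K z v x u x' u'| ≤
      (‖C‖ ^ 2 * ‖x‖ + ‖z‖) * ‖x'‖ + (‖K‖ ^ 2 * ‖u‖ + ‖v‖) * ‖u'‖ := by
  have h1 := abs_costForm_le C K x x' u u'
  have h2 := abs_re_inner_le z x'
  have h3 := abs_re_inner_le v u'
  refine (abs_add_le _ _).trans ((add_le_add h1 (abs_add_le _ _)).trans ?_)
  linarith

lemma Coercive.exists_le [CompleteSpace H] [CompleteSpace U] {K : U →L[ℂ] H} (hK : Coercive K) :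
    ∃ m : ℝ, 0 < m ∧ ∀ u, m * ‖u‖ ^ 2 ≤ ‖K u‖ ^ 2 := by
  obtain ⟨m, hm, h⟩ := hK
  refine ⟨m, hm, fun u => (h u).trans_eq ?_⟩
  rw [ContinuousLinearMap.adjoint_inner_left]
  simpa using inner_self_eq_norm_sq (𝕜 := ℂ) (K u)

end Cost

/-! ### Optimal steady states -/

section SteadyState

variable {H U Y : Type*}
  [NormedAddCommGroup H] [InnerProductSpace ℂ H] [CompleteSpace H]
  [NormedAddCommGroup U] [InnerProductSpace ℂ U]
  [NormedAddCommGroup Y] [InnerProductSpace ℂ Y]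
  {A : H →ₗ.[ℂ] H} {S : C0Semigroup H} {B : U →L[ℂ] H} {C : H →L[ℂ] Y} {K : U →L[ℂ] H}

omit [CompleteSpace H] in
/-- Controlled equilibria of a stabilized system are parametrized by the feedback offset
`w = u - F x`. -/
lemma isControlledEquilibrium_iff {F : H →L[ℂ] U} {R : H →L[ℂ] H}
    (hR1 : ∀ x, ∃ hx : R x ∈ ((B.comp F).toLinearMap +ᵥ A).domain,
      ((B.comp F).toLinearMap +ᵥ A) ⟨R x, hx⟩ = -x)
    (hR2 : ∀ x : ((B.comp F).toLinearMap +ᵥ A).domain, R (((B.comp F).toLinearMap +ᵥ A) x) = -x)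
    (x : H) (u : U) :
    IsControlledEquilibrium A B x u ↔ x = R (B (u - F x)) := by
  constructor
  · rintro ⟨hx, h⟩
    have h1 := hR2 (show ((B.comp F).toLinearMap +ᵥ A).domain from ⟨x, hx⟩)
    rw [LinearPMap.vadd_apply] at h1
    change R (B (F x) + A ⟨x, hx⟩) = -x at h1
    rw [eq_neg_of_add_eq_zero_left h] at h1
    have e : B (F x) + -B u = -B (u - F x) := by rw [map_sub]; abel
    rw [e, map_neg, neg_inj] at h1
    exact h1.symm
  · intro h
    obtain ⟨hx, h1⟩ := hR1 (B (u - F x))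
    rw [LinearPMap.vadd_apply] at h1
    have hx' : R (B (u - F x)) ∈ A.domain := hx
    change B (F (R (B (u - F x)))) + A ⟨R (B (u - F x)), hx'⟩ = _ at h1
    simp only [← h] at h1 hx'
    refine ⟨hx', ?_⟩
    have h2 : A ⟨x, hx'⟩ = -(B u - B (F x)) - B (F x) := by
      rw [← map_sub, ← h1]
      abel
    rw [h2]
    abel

/-- Integrating S_s A x = -S_s B u over [0, t] gives S_t x - x; reflecting s to t - s turns the
integral into the convolution. -/
lemma IsControlledEquilibrium.mild_eq {x : H} {u : U} (hA : IsGenerator A S)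
    (h : IsControlledEquilibrium A B x u) {t : ℝ} (ht : 0 ≤ t) :
    S.op t x + S.conv (fun _ => B u) t = x := by
  obtain ⟨hx, h⟩ := h
  have h1 := op_sub_of_mem_domain hA ⟨x, hx⟩ ht
  rw [eq_neg_of_add_eq_zero_left h] at h1
  have h2 : S.conv (fun _ => B u) t = ∫ s in (0 : ℝ)..t, S.op (max s 0) (B u) := by
    have h3 := intervalIntegral.integral_comp_sub_left (a := 0) (b := t)
      (fun s : ℝ => S.op (max s 0) (B u)) t
    rw [sub_self, sub_zero] at h3
    rw [← h3]
    refine intervalIntegral.integral_congr fun s hs => ?_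
    rw [Set.uIcc_of_le ht] at hs
    dsimp only
    rw [max_eq_left (by linarith [hs.2])]
  simp only [map_neg, intervalIntegral.integral_neg] at h1
  rw [h2, ← neg_neg (∫ s in (0 : ℝ)..t, S.op (max s 0) (B u)), h1]
  abel

omit [CompleteSpace H] in
/-- Detectability bounds the state of a controlled equilibrium by its output and control. -/
lemma IsControlledEquilibrium.norm_le {L : Y →L[ℂ] H} {R : H →L[ℂ] H}
    (hR2 : ∀ x : ((L.comp C).toLinearMap +ᵥ A).domain, R (((L.comp C).toLinearMap +ᵥ A) x) = -x)
    {x : H} {u : U} (h : IsControlledEquilibrium A B x u) :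
    ‖x‖ ≤ ‖R‖ * (‖L‖ * ‖C x‖ + ‖B‖ * ‖u‖) := by
  obtain ⟨hx, h⟩ := h
  -- At an equilibrium (A + L C) x = L C x - B u, and R inverts the left side up to sign.
  have h1 := hR2 (show ((L.comp C).toLinearMap +ᵥ A).domain from ⟨x, hx⟩)
  rw [LinearPMap.vadd_apply] at h1
  change R (L (C x) + A ⟨x, hx⟩) = -x at h1
  rw [← norm_neg x, ← h1, eq_neg_of_add_eq_zero_left h]
  refine R.le_of_opNorm_le_of_le le_rfl ((norm_add_le _ _).trans ?_)
  rw [norm_neg]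
  gcongr
  · exact L.le_opNorm _
  · exact B.le_opNorm _

variable [CompleteSpace U]

/-- Existence, uniqueness and first-order optimality condition for optimal steady states. -/
lemma exists_optimalSteadyState (hK : Coercive K) (z : H) (v : U) {F : H →L[ℂ] U} {R : H →L[ℂ] H}
    (hR1 : ∀ x, ∃ hx : R x ∈ ((B.comp F).toLinearMap +ᵥ A).domain,
      ((B.comp F).toLinearMap +ᵥ A) ⟨R x, hx⟩ = -x)
    (hR2 : ∀ x : ((B.comp F).toLinearMap +ᵥ A).domain, R (((B.comp F).toLinearMap +ᵥ A) x) = -x)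
    {L : Y →L[ℂ] H} {Q : H →L[ℂ] H}
    (hQ : ∀ x : ((L.comp C).toLinearMap +ᵥ A).domain,
      Q (((L.comp C).toLinearMap +ᵥ A) x) = -x) :
    ∃ xe ue, IsOptimalSteadyState A B (runningCost C K z v) xe ue ∧
      (∀ x u, IsOptimalSteadyState A B (runningCost C K z v) x u → x = xe ∧ u = ue) ∧
      ∀ w, costDeriv C K z v xe ue (R (B w)) (w + F (R (B w))) = 0 := by
  have heq := isControlledEquilibrium_iff hR1 hR2
  -- X w and V w are the state and the control of the equilibrium with feedback offset w, so the
  -- constrained problem becomes a free one in w.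
  set X : U →L[ℂ] H := R.comp B with hX
  set V : U →L[ℂ] U := ContinuousLinearMap.id ℂ U + F.comp X with hV
  have hVa : ∀ w, V w = w + F (X w) := fun w => rfl
  have heq' : ∀ w, IsControlledEquilibrium A B (X w) (V w) := fun w => by
    rw [heq, hVa, add_sub_cancel_right]; rfl
  obtain ⟨m, hm, hKm⟩ := hK.exists_le
  set J : U → ℝ := fun w => runningCost C K z v (X w) (V w) with hJ
  set D : U → U → ℝ := fun w h => costDeriv C K z v (X w) (V w) (X h) (V h) with hD
  set q : U → ℝ := fun h => ‖C (X h)‖ ^ 2 + ‖K (V h)‖ ^ 2 with hq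
  have hexp : ∀ w h, J (w + h) = J w + 2 * D w h + q h := fun w h => by
    simp only [hJ, hD, hq, map_add, ← runningCost_add]
  have hDsmul : ∀ w (r : ℝ) h, D w (r • h) = r * D w h := fun w r h => by
    simp only [hD, ContinuousLinearMap.map_smul_of_tower, costDeriv_smul]
  have hqsmul : ∀ (r : ℝ) h, q (r • h) = r ^ 2 * q h := fun r h => by
    simp only [hq, ContinuousLinearMap.map_smul_of_tower, norm_smul, mul_pow, Real.norm_eq_abs,
      sq_abs]
    ring
  set a := 1 + ‖F‖ * ‖Q‖ * ‖B‖ with ha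
  set b := ‖F‖ * ‖Q‖ * ‖L‖ with hb
  have ha1 : 0 < a := by positivity
  -- Since h = V h - F X h and detectability bounds X h by C X h and V h, the offset is bounded by C
  -- X h and V h; coercivity of K replaces V h by K V h. The constant comes from (s + t)² ≤ 2s² +
  -- 2t².
  have hcoer : ∀ h, (2 * a ^ 2 / m + 2 * b ^ 2)⁻¹ * ‖h‖ ^ 2 ≤ q h := by
    intro h
    rw [inv_mul_le_iff₀ (by positivity)]
    have h1 := (heq' h).norm_le hQ
    have h2 : ‖h‖ ≤ a * ‖V h‖ + b * ‖C (X h)‖ := by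
      have e : h = V h - F (X h) := by rw [hVa]; abel
      have h3 : ‖h‖ ≤ ‖V h‖ + ‖F (X h)‖ := by
        conv_lhs => rw [e]
        exact norm_sub_le _ _
      have h4 : ‖F (X h)‖ ≤ ‖F‖ * (‖Q‖ * (‖L‖ * ‖C (X h)‖ + ‖B‖ * ‖V h‖)) :=
        F.le_of_opNorm_le_of_le le_rfl h1
      rw [ha, hb]
      nlinarith
    have h3 := hKm (V h)
    have h4 : ‖V h‖ ^ 2 ≤ ‖K (V h)‖ ^ 2 / m := by rw [le_div_iff₀ hm]; linarith
    have h5 : ‖h‖ ^ 2 ≤ (a * ‖V h‖ + b * ‖C (X h)‖) ^ 2 := by gcongr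
    have h6 : a ^ 2 * ‖V h‖ ^ 2 ≤ a ^ 2 * (‖K (V h)‖ ^ 2 / m) := by gcongr
    have h7 : 2 * a ^ 2 / m * ‖K (V h)‖ ^ 2 = 2 * (a ^ 2 * (‖K (V h)‖ ^ 2 / m)) := by ring
    have h8 : 0 ≤ 2 * a ^ 2 / m * ‖C (X h)‖ ^ 2 := by positivity
    have h9 : 0 ≤ b ^ 2 * ‖K (V h)‖ ^ 2 := by positivity
    simp only [hq]
    nlinarith [sq_nonneg (a * ‖V h‖ - b * ‖C (X h)‖)]
  obtain ⟨w, hw⟩ := exists_minimizer_of_quadratic J D q (m := (2 * a ^ 2 / m + 2 * b ^ 2)⁻¹)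
    (c := ‖C.comp X‖ ^ 2 + ‖K.comp V‖ ^ 2) (by positivity) hexp hDsmul
    (fun h => by simpa using hqsmul (-1) h) hcoer
    (fun h => by
      rw [add_mul, ← mul_pow, ← mul_pow]
      simp only [hq]
      gcongr
      · exact (C.comp X).le_opNorm h
      · exact (K.comp V).le_opNorm h)
    (fun w => by
      refine ⟨(‖C‖ ^ 2 * ‖X w‖ + ‖z‖) * ‖X‖ + (‖K‖ ^ 2 * ‖V w‖ + ‖v‖) * ‖V‖, fun h => ?_⟩
      refine (abs_costDeriv_le C K z v _ _ _ _).trans ?_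
      have h1 := X.le_opNorm h
      have h2 := V.le_opNorm h
      have h3 : ‖h‖ ≤ 1 + ‖h‖ ^ 2 := by nlinarith [sq_nonneg (‖h‖ - 1)]
      calc _ ≤ (‖C‖ ^ 2 * ‖X w‖ + ‖z‖) * (‖X‖ * ‖h‖)
            + (‖K‖ ^ 2 * ‖V w‖ + ‖v‖) * (‖V‖ * ‖h‖) := by gcongr
        _ = ((‖C‖ ^ 2 * ‖X w‖ + ‖z‖) * ‖X‖ + (‖K‖ ^ 2 * ‖V w‖ + ‖v‖) * ‖V‖) * ‖h‖ := by ring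
        _ ≤ _ := by gcongr)
  have hEL : ∀ h, D w h = 0 := fun h => eq_zero_of_quadratic_nonneg (q := q h) fun t => by
    have h1 := hw (w + t • h)
    rw [hexp, hDsmul, hqsmul] at h1
    linarith
  have hpar : ∀ x u, IsControlledEquilibrium A B x u → ∃ w', x = X w' ∧ u = V w' := by
    intro x u h
    have h1 : x = X (u - F x) := (heq x u).1 h
    exact ⟨u - F x, h1, by rw [hVa, ← h1, sub_add_cancel]⟩
  refine ⟨X w, V w, ⟨heq' w, fun x u h => ?_⟩, fun x u h => ?_, hEL⟩
  · obtain ⟨w', rfl, rfl⟩ := hpar x u h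
    exact hw w'
  · obtain ⟨w', rfl, rfl⟩ := hpar x u h.1
    have h1 := h.2 _ _ (heq' w)
    change J w' ≤ J w at h1
    -- Uniqueness: around the minimizer the linear term vanishes, so a second minimizer makes the
    -- coercive quadratic term zero.
    have h2 := hexp w (w' - w)
    rw [add_sub_cancel, hEL] at h2
    have h3 := hcoer (w' - w)
    have h4 : (2 * a ^ 2 / m + 2 * b ^ 2)⁻¹ * ‖w' - w‖ ^ 2 ≤ 0 := by linarith
    have h5 : ‖w' - w‖ ^ 2 ≤ 0 := by
      by_contra hcon
      push Not at hcon
      have : 0 < (2 * a ^ 2 / m + 2 * b ^ 2)⁻¹ * ‖w' - w‖ ^ 2 := by positivity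
      linarith
    have h6 : ‖w' - w‖ = 0 := by
      have := sq_nonneg ‖w' - w‖
      exact pow_eq_zero_iff two_ne_zero |>.1 (le_antisymm h5 this)
    rw [sub_eq_zero.1 (norm_eq_zero.1 h6)]
    exact ⟨rfl, rfl⟩

end SteadyState

/-! ### Existence, uniqueness and first-order condition for optimal controls -/

section Horizon

variable {E : Type*} [NormedAddCommGroup E] [InnerProductSpace ℂ E]

omit [InnerProductSpace ℂ E] in
lemma isAdmissible_iff {T : ℝ} {u : ℝ → E} : IsAdmissible T u ↔ MemLp u 2 (horizon T) := by
  rw [IsAdmissible, horizon, Measure.restrict_congr_set Ioc_ae_eq_Icc]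

lemma integrable_re_inner {μ : Measure ℝ} {f g : ℝ → E} (hf : MemLp f 2 μ) (hg : MemLp g 2 μ) :
    Integrable (fun t => (inner ℂ (f t) (g t)).re) μ := by
  have h := L2.integrable_inner (𝕜 := ℂ) (hf.toLp f) (hg.toLp g)
  refine (h.re).congr ?_
  filter_upwards [hf.coeFn_toLp, hg.coeFn_toLp] with t h1 h2
  rw [h1, h2]
  rfl

lemma energy_coeFn (T : ℝ) (f : Lp E 2 (horizon T)) : energy T f = ‖f‖ ^ 2 := by
  rw [← inner_self_eq_norm_sq (𝕜 := ℂ), L2.inner_def, ← integral_re (L2.integrable_inner f f),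
    energy]
  congr 1
  ext t
  exact (inner_self_eq_norm_sq (𝕜 := ℂ) (f t)).symm

lemma energy_congr_ae {F : Type*} [NormedAddCommGroup F] {T : ℝ} {f g : ℝ → F}
    (h : f =ᵐ[horizon T] g) : energy T f = energy T g := by
  refine integral_congr_ae ?_
  filter_upwards [h] with t ht
  rw [ht]

end Horizon

section Conv

variable {H : Type*} [NormedAddCommGroup H] [InnerProductSpace ℂ H]

lemma C0Semigroup.conv_smul (S : C0Semigroup H) (r : ℝ) (f : ℝ → H) (t : ℝ) :
    S.conv (fun s => r • f s) t = r • S.conv f t := by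
  simp only [C0Semigroup.conv, ContinuousLinearMap.map_smul_of_tower]
  exact intervalIntegral.integral_smul _ _

lemma C0Semigroup.norm_conv_le_expConv (S : C0Semigroup H) {M α : ℝ} {f : ℝ → H} {t : ℝ}
    (ht : 0 ≤ t) (hS : ∀ s ∈ Set.Icc 0 t, ‖S.op s‖ ≤ M * Real.exp (-α * s))
    (hf : IntervalIntegrable f volume 0 t) :
    ‖S.conv f t‖ ≤ M * expConv α (fun s => ‖f s‖) t := by
  have h1 : ‖S.conv f t‖ ≤ ∫ s in (0 : ℝ)..t, M * (Real.exp (-α * (t - s)) * ‖f s‖) := by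
    refine intervalIntegral.norm_integral_le_of_norm_le ht ?_
      ((intervalIntegrable_exp_mul hf.norm).const_mul M)
    refine Eventually.of_forall fun s hs => ?_
    rw [← mul_assoc]
    exact (S.op _).le_of_opNorm_le (hS _ ⟨by linarith [hs.2], by linarith [hs.1]⟩) _
  rwa [intervalIntegral.integral_const_mul] at h1

variable [CompleteSpace H]

lemma C0Semigroup.memLp_conv (S : C0Semigroup H) {M α T : ℝ} (hα : 0 < α) (hT : 0 ≤ T)
    (hS : ∀ s ∈ Set.Icc 0 T, ‖S.op s‖ ≤ M * Real.exp (-α * s)) {f : ℝ → H}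
    (hf : MemLp f 2 (horizon T)) :
    MemLp (S.conv f) 2 (horizon T) ∧ energy T (S.conv f) ≤ (M / α) ^ 2 * energy T f ∧
      ∀ t ∈ Set.Icc 0 T, ‖S.conv f t‖ ^ 2 ≤ M ^ 2 / α * energy T f := by
  have h := memLp_of_norm_le_expConv (c := M) hα hT (S.aestronglyMeasurable_conv hf.1) hf.norm
    (fun t ht => S.norm_conv_le_expConv ht.1 (fun s hs => hS s ⟨hs.1, hs.2.trans ht.2⟩)
      (MemLp.intervalIntegrable_of_le hf ht.1 ht.2))
  have e : energy T (fun s => ‖f s‖) = energy T f := by simp [energy]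
  rwa [e] at h

/-- On a fixed horizon every semigroup obeys a decay bound with rate one, at the price of a constant
depending on T. This makes the estimates for stable semigroups available for S itself where
uniformity in T is not needed. -/
lemma C0Semigroup.exists_bound_exp (S : C0Semigroup H) (T : ℝ) :
    ∃ M : ℝ, ∀ t ∈ Set.Icc 0 T, ‖S.op t‖ ≤ M * Real.exp (-1 * t) := by
  obtain ⟨M, hM, hb⟩ := S.exists_bound T
  refine ⟨M * Real.exp T, fun t ht => (hb t ht).trans ?_⟩
  rw [mul_assoc, ← Real.exp_add]
  have : 1 ≤ Real.exp (T + -1 * t) := Real.one_le_exp (by linarith [ht.2])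
  nlinarith

lemma C0Semigroup.memLp_op (S : C0Semigroup H) (x : H) (T : ℝ) :
    MemLp (fun t => S.op t x) 2 (horizon T) := by
  obtain ⟨M, hM, hb⟩ := S.exists_bound T
  refine MemLp.of_bound ((S.continuous_op_max x).aestronglyMeasurable.congr ?_) (M * ‖x‖) ?_
  · filter_upwards [ae_restrict_mem measurableSet_Ioc] with t ht
    rw [max_eq_left ht.1.le]
  · filter_upwards [ae_restrict_mem measurableSet_Ioc] with t ht
    exact (S.op t).le_of_opNorm_le (hb t ⟨ht.1.le, ht.2⟩) x

end Conv

section Control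

variable {H U Y : Type*}
  [NormedAddCommGroup H] [InnerProductSpace ℂ H] [CompleteSpace H]
  [NormedAddCommGroup U] [InnerProductSpace ℂ U]
  [NormedAddCommGroup Y] [InnerProductSpace ℂ Y]
  (S : C0Semigroup H) (B : U →L[ℂ] H)

omit [CompleteSpace H] in
lemma mildSolution_eq (x₀ : H) (u : ℝ → U) (t : ℝ) :
    mildSolution S B x₀ u t = S.op t x₀ + S.conv (fun s => B (u s)) t := rfl

lemma memLp_mildSolution (x₀ : H) {u : ℝ → U} {T : ℝ} (hT : 0 ≤ T) (hu : MemLp u 2 (horizon T)) :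
    MemLp (mildSolution S B x₀ u) 2 (horizon T) := by
  obtain ⟨M, hM⟩ := S.exists_bound_exp T
  exact (S.memLp_op x₀ T).add (S.memLp_conv one_pos hT hM (memLp_clm B hu)).1

lemma mildSolution_add (x₀ x₁ : H) {u h : ℝ → U} {T t : ℝ} (hu : MemLp u 2 (horizon T))
    (hh : MemLp h 2 (horizon T)) (ht : 0 ≤ t) (htT : t ≤ T) :
    mildSolution S B (x₀ + x₁) (fun s => u s + h s) t
      = mildSolution S B x₀ u t + mildSolution S B x₁ h t := by
  simp only [mildSolution_eq, map_add]
  rw [S.conv_add ht (MemLp.intervalIntegrable_of_le (memLp_clm B hu) ht htT)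
    (MemLp.intervalIntegrable_of_le (memLp_clm B hh) ht htT)]
  abel

omit [CompleteSpace H] in
lemma mildSolution_zero_smul (r : ℝ) (h : ℝ → U) (t : ℝ) :
    mildSolution S B 0 (fun s => r • h s) t = r • mildSolution S B 0 h t := by
  simp only [mildSolution_eq, ContinuousLinearMap.map_smul_of_tower, S.conv_smul, map_zero,
    zero_add]

omit [CompleteSpace H] in
lemma mildSolution_congr_ae (x₀ : H) {u h : ℝ → U} {T t : ℝ} (huh : u =ᵐ[horizon T] h)
    (ht : 0 ≤ t) (htT : t ≤ T) : mildSolution S B x₀ u t = mildSolution S B x₀ h t := by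
  rw [mildSolution_eq, mildSolution_eq]
  congr 1
  refine S.conv_congr_ae ht ?_
  filter_upwards [ae_restrict_of_ae_restrict_of_subset (Set.Ioc_subset_Ioc_right htT) huh] with s hs
  rw [hs]

variable (C : H →L[ℂ] Y) (K : U →L[ℂ] H) (z : H) (v : U)

/-- Half the first variation of the total cost at the control `u` in the direction `h`. -/
noncomputable def firstVariation (T : ℝ) (x₀ : H) (u h : ℝ → U) : ℝ :=
  ∫ t, costDeriv C K z v (mildSolution S B x₀ u t) (u t) (mildSolution S B 0 h t) (h t) ∂horizon T

/-- The quadratic part of the total cost. -/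
noncomputable def secondVariation (T : ℝ) (h : ℝ → U) : ℝ :=
  energy T (fun t => C (mildSolution S B 0 h t)) + energy T (fun t => K (h t))

omit [CompleteSpace H] in
lemma firstVariation_smul (T : ℝ) (x₀ : H) (u h : ℝ → U) (r : ℝ) :
    firstVariation S B C K z v T x₀ u (fun t => r • h t)
      = r * firstVariation S B C K z v T x₀ u h := by
  simp only [firstVariation, mildSolution_zero_smul, costDeriv_smul, integral_const_mul]

omit [CompleteSpace H] in
lemma secondVariation_smul (T : ℝ) (h : ℝ → U) (r : ℝ) :
    secondVariation S B C K T (fun t => r • h t) = r ^ 2 * secondVariation S B C K T h := by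
  simp only [secondVariation, mildSolution_zero_smul, ContinuousLinearMap.map_smul_of_tower, energy,
    norm_smul, mul_pow, integral_const_mul, Real.norm_eq_abs, sq_abs, mul_add]

omit [CompleteSpace H] in
lemma firstVariation_congr_ae {T : ℝ} (x₀ : H) (u : ℝ → U) {h h' : ℝ → U}
    (hh : h =ᵐ[horizon T] h') :
    firstVariation S B C K z v T x₀ u h = firstVariation S B C K z v T x₀ u h' := by
  refine integral_congr_ae ?_
  filter_upwards [hh, ae_restrict_mem measurableSet_Ioc] with t ht htm
  rw [ht, mildSolution_congr_ae S B 0 hh htm.1.le htm.2]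

omit [CompleteSpace H] in
lemma secondVariation_congr_ae {T : ℝ} {h h' : ℝ → U} (hh : h =ᵐ[horizon T] h') :
    secondVariation S B C K T h = secondVariation S B C K T h' := by
  unfold secondVariation
  congr 1
  · refine energy_congr_ae ?_
    filter_upwards [ae_restrict_mem measurableSet_Ioc] with t htm
    rw [mildSolution_congr_ae S B 0 hh htm.1.le htm.2]
  · refine energy_congr_ae ?_
    filter_upwards [hh] with t ht
    rw [ht]

omit [CompleteSpace H] in
lemma totalCost_congr_ae {T : ℝ} (hT : 0 ≤ T) (x₀ : H) (ℓ : H → U → ℝ) {u u' : ℝ → U}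
    (hu : u =ᵐ[horizon T] u') : totalCost S B ℓ T x₀ u = totalCost S B ℓ T x₀ u' := by
  rw [totalCost, totalCost, intervalIntegral.integral_of_le hT, intervalIntegral.integral_of_le hT]
  refine integral_congr_ae ?_
  filter_upwards [hu, ae_restrict_mem measurableSet_Ioc] with t ht htm
  rw [ht, mildSolution_congr_ae S B x₀ hu htm.1.le htm.2]

section Integrability

variable {C K z v}
variable {T : ℝ} {x x' : ℝ → H} {u u' : ℝ → U}

omit [CompleteSpace H] in
lemma integrable_costForm (hx : MemLp x 2 (horizon T)) (hu : MemLp u 2 (horizon T))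
    (hx' : MemLp x' 2 (horizon T)) (hu' : MemLp u' 2 (horizon T)) :
    Integrable (fun t => costForm C K (x t) (u t) (x' t) (u' t)) (horizon T) :=
  (integrable_re_inner (memLp_clm C hx) (memLp_clm C hx')).add
    (integrable_re_inner (memLp_clm K hu) (memLp_clm K hu'))

omit [CompleteSpace H] in
lemma integrable_costDeriv (hx : MemLp x 2 (horizon T)) (hu : MemLp u 2 (horizon T))
    (hx' : MemLp x' 2 (horizon T)) (hu' : MemLp u' 2 (horizon T)) :
    Integrable (fun t => costDeriv C K z v (x t) (u t) (x' t) (u' t)) (horizon T) :=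
  (integrable_costForm hx hu hx' hu').add ((integrable_re_inner (memLp_const z) hx').add
    (integrable_re_inner (memLp_const v) hu'))

omit [CompleteSpace H] in
lemma integrable_runningCost (hx : MemLp x 2 (horizon T)) (hu : MemLp u 2 (horizon T)) :
    Integrable (fun t => runningCost C K z v (x t) (u t)) (horizon T) :=
  ((((memLp_clm C hx).integrable_norm_pow two_ne_zero).add
    ((memLp_clm K hu).integrable_norm_pow two_ne_zero)).add
    ((integrable_re_inner (memLp_const z) hx).const_mul 2)).add
    ((integrable_re_inner (memLp_const v) hu).const_mul 2)

end Integrability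

lemma totalCost_add {T : ℝ} (hT : 0 ≤ T) (x₀ : H) {u h : ℝ → U} (hu : MemLp u 2 (horizon T))
    (hh : MemLp h 2 (horizon T)) :
    totalCost S B (runningCost C K z v) T x₀ (fun t => u t + h t)
      = totalCost S B (runningCost C K z v) T x₀ u + 2 * firstVariation S B C K z v T x₀ u h
        + secondVariation S B C K T h := by
  have hx := memLp_mildSolution S B x₀ hT hu
  have hx' := memLp_mildSolution S B 0 hT hh
  have i1 := integrable_runningCost (C := C) (K := K) (z := z) (v := v) hx hu
  have i2 := (integrable_costDeriv (C := C) (K := K) (z := z) (v := v) hx hu hx' hh).const_mul 2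
  have i3 := (memLp_clm C hx').integrable_norm_pow two_ne_zero
  have i4 := (memLp_clm K hh).integrable_norm_pow two_ne_zero
  have i12 : Integrable (fun t => runningCost C K z v (mildSolution S B x₀ u t) (u t)
      + 2 * costDeriv C K z v (mildSolution S B x₀ u t) (u t) (mildSolution S B 0 h t) (h t))
      (horizon T) := i1.add i2
  have i34 : Integrable (fun t => ‖C (mildSolution S B 0 h t)‖ ^ 2 + ‖K (h t)‖ ^ 2) (horizon T) :=
    i3.add i4
  rw [totalCost, totalCost, intervalIntegral.integral_of_le hT, intervalIntegral.integral_of_le hT,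
    firstVariation, secondVariation, energy, energy, ← integral_const_mul, ← integral_add i3 i4,
    ← integral_add i1 i2, ← integral_add i12 i34]
  refine setIntegral_congr_fun measurableSet_Ioc fun t ht => ?_
  have e := mildSolution_add S B x₀ 0 hu hh ht.1.le ht.2
  rw [add_zero] at e
  simp only [e, runningCost_add]

lemma secondVariation_le {T : ℝ} (hT : 0 ≤ T) :
    ∃ c : ℝ, 0 ≤ c ∧ ∀ h : ℝ → U, MemLp h 2 (horizon T) →
      energy T (mildSolution S B 0 h) ≤ c * energy T h ∧
      secondVariation S B C K T h ≤ c * energy T h := by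
  obtain ⟨M, hM⟩ := S.exists_bound_exp T
  set a := (M / 1) ^ 2 * ‖B‖ ^ 2 with ha
  have ha0 : 0 ≤ a := by positivity
  have key : ∀ h : ℝ → U, MemLp h 2 (horizon T) →
      energy T (mildSolution S B 0 h) ≤ a * energy T h := by
    intro h hh
    have h1 := (S.memLp_conv one_pos hT hM (memLp_clm B hh)).2.1
    have h2 := energy_clm_le B hh
    have e : mildSolution S B 0 h = S.conv (fun s => B (h s)) := by
      ext t; rw [mildSolution_eq, map_zero, zero_add]
    rw [e, ha, mul_assoc]
    exact h1.trans (by gcongr)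
  refine ⟨a + (‖C‖ ^ 2 * a + ‖K‖ ^ 2), by positivity, fun h hh => ?_⟩
  have h1 := key h hh
  have h0 := energy_nonneg T h
  constructor
  · refine h1.trans ?_
    gcongr
    have : 0 ≤ ‖C‖ ^ 2 * a + ‖K‖ ^ 2 := by positivity
    linarith
  · have h2 := energy_clm_le C (memLp_mildSolution S B 0 hT hh)
    have h3 := energy_clm_le K hh
    have h4 : ‖C‖ ^ 2 * energy T (mildSolution S B 0 h) ≤ ‖C‖ ^ 2 * (a * energy T h) := by gcongr
    have h5 : 0 ≤ a * energy T h := by positivity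
    rw [secondVariation]
    nlinarith

/-- This crude form, from ab ≤ a² + b², suffices: `exists_minimizer_of_quadratic` upgrades it to a
linear bound. -/
lemma abs_firstVariation_le {T : ℝ} (hT : 0 ≤ T) (x₀ : H) {u : ℝ → U}
    (hu : MemLp u 2 (horizon T)) :
    ∃ a : ℝ, ∀ h : ℝ → U, MemLp h 2 (horizon T) →
      |firstVariation S B C K z v T x₀ u h| ≤ a * (1 + energy T h) := by
  obtain ⟨c, hc, hcb⟩ := secondVariation_le S B C K hT
  have hx := memLp_mildSolution S B x₀ hT hu
  set p : ℝ → ℝ := fun t => ‖C‖ ^ 2 * ‖mildSolution S B x₀ u t‖ + ‖z‖ with hp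
  set r : ℝ → ℝ := fun t => ‖K‖ ^ 2 * ‖u t‖ + ‖v‖ with hr
  have hpm : MemLp p 2 (horizon T) := (hx.norm.const_mul _).add (memLp_const _)
  have hrm : MemLp r 2 (horizon T) := (hu.norm.const_mul _).add (memLp_const _)
  refine ⟨energy T p + energy T r + c + 1, fun h hh => ?_⟩
  have hx' := memLp_mildSolution S B 0 hT hh
  have i1 := hpm.integrable_norm_pow two_ne_zero
  have i2 := hrm.integrable_norm_pow two_ne_zero
  have i3 := hx'.integrable_norm_pow two_ne_zero
  have i4 := hh.integrable_norm_pow two_ne_zero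
  have i13 : Integrable (fun t => ‖p t‖ ^ 2 + ‖mildSolution S B 0 h t‖ ^ 2) (horizon T) :=
    i1.add i3
  have i24 : Integrable (fun t => ‖r t‖ ^ 2 + ‖h t‖ ^ 2) (horizon T) := i2.add i4
  have h1 : |firstVariation S B C K z v T x₀ u h| ≤
      (energy T p + energy T (mildSolution S B 0 h)) + (energy T r + energy T h) := by
    rw [energy, energy, energy, energy, ← integral_add i1 i3, ← integral_add i2 i4,
      ← integral_add i13 i24]
    rw [firstVariation, ← Real.norm_eq_abs]
    refine norm_integral_le_of_norm_le (i13.add i24) (Eventually.of_forall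
      fun t => ?_)
    refine (abs_costDeriv_le C K z v _ _ _ _).trans ?_
    change p t * _ + r t * _ ≤ _
    simp only [Real.norm_eq_abs, sq_abs]
    nlinarith [sq_nonneg (p t - ‖mildSolution S B 0 h t‖), sq_nonneg (r t - ‖h t‖),
      sq_nonneg (p t), sq_nonneg (r t), sq_nonneg ‖h t‖, sq_nonneg ‖mildSolution S B 0 h t‖]
  have h2 := (hcb h hh).1
  have h3 := energy_nonneg T p
  have h4 := energy_nonneg T r
  have h5 := energy_nonneg T h
  nlinarith [mul_nonneg h3 h5, mul_nonneg h4 h5]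

variable {C K z v S B}

/-- First-order optimality condition for optimal controls. -/
lemma IsOptimalControl.firstVariation_eq_zero {T : ℝ} (hT : 0 ≤ T) {x₀ : H} {u : ℝ → U}
    (hopt : IsOptimalControl S B (runningCost C K z v) T x₀ u) {h : ℝ → U}
    (hh : MemLp h 2 (horizon T)) : firstVariation S B C K z v T x₀ u h = 0 := by
  have hu := isAdmissible_iff.1 hopt.1
  refine eq_zero_of_quadratic_nonneg (q := secondVariation S B C K T h) fun r => ?_
  have hrh : MemLp (fun t => r • h t) 2 (horizon T) := hh.const_smul r
  have h1 := hopt.2 _ (isAdmissible_iff.2 (hu.add hrh))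
  change _ ≤ totalCost S B (runningCost C K z v) T x₀ (fun t => u t + r • h t) at h1
  rw [totalCost_add S B C K z v hT x₀ hu hrh, firstVariation_smul, secondVariation_smul] at h1
  linarith

omit [CompleteSpace H] in
lemma le_secondVariation {m T : ℝ} (hK : ∀ u, m * ‖u‖ ^ 2 ≤ ‖K u‖ ^ 2) {h : ℝ → U}
    (hh : MemLp h 2 (horizon T)) : m * energy T h ≤ secondVariation S B C K T h := by
  have h1 : m * energy T h ≤ energy T (fun t => K (h t)) := by
    rw [energy, energy, ← integral_const_mul]
    exact integral_mono ((hh.integrable_norm_pow two_ne_zero).const_mul m)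
      ((memLp_clm K hh).integrable_norm_pow two_ne_zero) fun t => hK _
  have h2 := energy_nonneg T (fun t => C (mildSolution S B 0 h t))
  rw [secondVariation]
  linarith

/-- On L²(0,T) the cost is a continuous quadratic functional whose quadratic part is at least m‖h‖²,
by the K-term alone. At the minimizer the first variation vanishes, so any other optimal control
differs from it by zero energy. -/
theorem hasUniqueOptimalControls [CompleteSpace U] (hK : Coercive K) :
    HasUniqueOptimalControls S B (runningCost C K z v) := by
  intro T hT x₀
  obtain ⟨m, hm, hKm⟩ := hK.exists_le
  obtain ⟨c, hc, hcb⟩ := secondVariation_le S B C K hT.le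
  have hadd : ∀ f g : Lp U 2 (horizon T), ⇑(f + g) =ᵐ[horizon T] fun t => f t + g t :=
    fun f g => Lp.coeFn_add f g
  have hsmul : ∀ (r : ℝ) (f : Lp U 2 (horizon T)), ⇑(r • f) =ᵐ[horizon T] fun t => r • f t :=
    fun r f => Lp.coeFn_smul r f
  obtain ⟨f, hf⟩ := exists_minimizer_of_quadratic (E := Lp U 2 (horizon T))
    (fun f => totalCost S B (runningCost C K z v) T x₀ f)
    (fun f g => firstVariation S B C K z v T x₀ f g) (fun g => secondVariation S B C K T g)
    (m := m) (c := c) hm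
    (fun f g => by
      rw [totalCost_congr_ae S B hT.le x₀ _ (hadd f g),
        totalCost_add S B C K z v hT.le x₀ (Lp.memLp f) (Lp.memLp g)])
    (fun f r g => by
      rw [firstVariation_congr_ae S B C K z v x₀ f (hsmul r g), firstVariation_smul])
    (fun g => by
      have h1 : ⇑(-g) =ᵐ[horizon T] fun t => (-1 : ℝ) • g t := by
        filter_upwards [Lp.coeFn_neg g] with t ht
        rw [ht, neg_one_smul]
        rfl
      rw [secondVariation_congr_ae S B C K h1, secondVariation_smul]
      norm_num)
    (fun g => by
      rw [← energy_coeFn]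
      exact le_secondVariation hKm (Lp.memLp g))
    (fun g => by
      rw [← energy_coeFn]
      exact (hcb g (Lp.memLp g)).2)
    (fun f => by
      obtain ⟨a, ha⟩ := abs_firstVariation_le S B C K z v hT.le x₀ (Lp.memLp f)
      refine ⟨a, fun g => ?_⟩
      rw [← energy_coeFn]
      exact ha g (Lp.memLp g))
  -- The minimization runs over classes in L²; the cost does not depend on the representative.
  have hopt : IsOptimalControl S B (runningCost C K z v) T x₀ f := by
    refine ⟨isAdmissible_iff.2 (Lp.memLp f), fun u' hu' => ?_⟩
    have hu := isAdmissible_iff.1 hu'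
    rw [← totalCost_congr_ae S B hT.le x₀ _ hu.coeFn_toLp]
    exact hf _
  refine ⟨f, hopt, fun u' hu' => ?_⟩
  have hfm := Lp.memLp f
  have hum := isAdmissible_iff.1 hu'.1
  have hd : MemLp (fun t => u' t - f t) 2 (horizon T) := hum.sub hfm
  have h1 := totalCost_add S B C K z v hT.le x₀ hfm hd
  simp only [add_sub_cancel] at h1
  rw [hopt.firstVariation_eq_zero hT.le hd] at h1
  have h2 := hu'.2 f hopt.1
  have h3 := le_secondVariation (S := S) (B := B) (C := C) hKm hd
  have h4 : energy T (fun t => u' t - f t) ≤ 0 := by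
    by_contra hcon
    push Not at hcon
    have := mul_pos hm hcon
    change totalCost S B (runningCost C K z v) T x₀ u' = _ at h1
    linarith
  have h5 := (integral_eq_zero_iff_of_nonneg (fun t => by positivity)
    (hd.integrable_norm_pow two_ne_zero)).1 (le_antisymm h4 (energy_nonneg T _))
  rw [Measure.restrict_congr_set Ioc_ae_eq_Icc.symm]
  filter_upwards [h5] with t ht
  have : ‖u' t - f t‖ ^ 2 = 0 := ht
  exact sub_eq_zero.1 (norm_eq_zero.1 (pow_eq_zero_iff two_ne_zero |>.1 this))

end Control

/-! ### Closed-loop parametrization, uniform coercivity and the boundary term -/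

section Feedback

variable {H U Y : Type*}
  [NormedAddCommGroup H] [InnerProductSpace ℂ H] [CompleteSpace H]
  [NormedAddCommGroup U] [InnerProductSpace ℂ U]
  [NormedAddCommGroup Y] [InnerProductSpace ℂ Y]
  {A : H →ₗ.[ℂ] H} {S SF SL : C0Semigroup H} {B : U →L[ℂ] H} {F : H →L[ℂ] U}
  {C : H →L[ℂ] Y} {L : Y →L[ℂ] H} {K : U →L[ℂ] H} {z : H} {v : U}

/-- The feedback `u = w + F x` turns trajectories of the closed loop into trajectories of the
original system. -/
lemma mildSolution_feedback (hA : IsGenerator A S)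
    (hF : IsGenerator ((B.comp F).toLinearMap +ᵥ A) SF) {w : ℝ → U} {T : ℝ}
    (hw : MemLp w 2 (horizon T)) {t : ℝ} (ht : 0 ≤ t) (htT : t ≤ T) :
    mildSolution S B 0 (fun s => w s + F (SF.conv (fun r => B (w r)) s)) t
      = SF.conv (fun s => B (w s)) t := by
  have h := mild_of_perturbed hA hF (x₀ := 0) (f := fun s => B (w s))
    (y := SF.conv (fun s => B (w s))) ht
    (MemLp.intervalIntegrable_of_le (memLp_clm B hw) ht htT) (fun s _ => by simp)
  rw [h, mildSolution_eq]
  simp only [map_add]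
  rfl

lemma memLp_conv_feedback {M ω T : ℝ} (hω : 0 < ω) (hT : 0 ≤ T)
    (hSF : ∀ t, 0 ≤ t → ‖SF.op t‖ ≤ M * Real.exp (-ω * t)) {w : ℝ → U}
    (hw : MemLp w 2 (horizon T)) :
    MemLp (SF.conv (fun s => B (w s))) 2 (horizon T) ∧
      energy T (SF.conv (fun s => B (w s))) ≤ (M / ω) ^ 2 * ‖B‖ ^ 2 * energy T w ∧
      ∀ t ∈ Set.Icc 0 T, ‖SF.conv (fun s => B (w s)) t‖ ^ 2 ≤ M ^ 2 / ω * ‖B‖ ^ 2 * energy T w := by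
  obtain ⟨h1, h2, h3⟩ := SF.memLp_conv hω hT (fun s hs => hSF s hs.1) (memLp_clm B hw)
  have h4 := energy_clm_le B hw
  refine ⟨h1, h2.trans ?_, fun t ht => (h3 t ht).trans ?_⟩
  · rw [mul_assoc]; gcongr
  · rw [mul_assoc]; gcongr

/-- Detectability makes the quadratic cost coercive in the feedback offset, uniformly in the
horizon. -/
lemma exists_coercive (hA : IsGenerator A S)
    (hF : IsGenerator ((B.comp F).toLinearMap +ᵥ A) SF)
    (hL : IsGenerator ((L.comp C).toLinearMap +ᵥ A) SL)
    (hSF : SF.ExponentiallyStable) (hSL : SL.ExponentiallyStable) {m : ℝ} (hm : 0 < m)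
    (hK : ∀ u, m * ‖u‖ ^ 2 ≤ ‖K u‖ ^ 2) :
    ∃ κ : ℝ, 0 < κ ∧ ∀ T, 0 ≤ T → ∀ w : ℝ → U, MemLp w 2 (horizon T) →
      κ * energy T w ≤ energy T (fun t => C (SF.conv (fun s => B (w s)) t))
        + energy T (fun t => K (w t + F (SF.conv (fun s => B (w s)) t))) := by
  obtain ⟨M, ω, hM, hω, hSF⟩ := hSF
  obtain ⟨M', ω', hM', hω', hSL⟩ := hSL
  set a := (M' / ω') ^ 2 with ha
  -- The inverse collects the constants below: offset from control and state, state from control and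
  -- output, control from K. Only decay rates and operator norms enter, hence the independence of T.
  refine ⟨(2 / m + 2 * ‖F‖ ^ 2 * a * (2 * ‖B‖ ^ 2 / m) + 2 * ‖F‖ ^ 2 * a * (2 * ‖L‖ ^ 2))⁻¹,
    by positivity, fun T hT w hw => ?_⟩
  set y := SF.conv (fun s => B (w s)) with hy
  set yu : ℝ → U := fun t => w t + F (y t) with hyu
  have hym : MemLp y 2 (horizon T) := (memLp_conv_feedback hω hT hSF hw).1
  have hyum : MemLp yu 2 (horizon T) := hw.add (memLp_clm F hym)
  have hCy := memLp_clm C hym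
  -- The closed-loop state is also driven through the detecting semigroup, by B yu - L C y, so its
  -- energy is bounded by those of input and output.
  have hymild : ∀ t ∈ Set.Icc 0 T, y t = SL.conv (fun s => B (yu s) + -L (C (y s))) t := by
    intro t ht
    have h := perturbed_of_mild hA hL (x₀ := 0) (f := fun s => B (yu s)) (y := y) ht.1
      (MemLp.intervalIntegrable_of_le (memLp_clm B hyum) ht.1 ht.2) (fun s hs => by
        rw [← mildSolution_eq]
        exact (mildSolution_feedback hA hF hw hs.1 (hs.2.trans ht.2)).symm)
    rw [map_zero, zero_add] at h
    simpa [sub_eq_add_neg] using h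
  have h1 : energy T y ≤ a * (2 * (‖B‖ ^ 2 * energy T yu)
      + 2 * (‖L‖ ^ 2 * energy T (fun t => C (y t)))) := by
    have hLC : MemLp (fun t => -L (C (y t))) 2 (horizon T) := (memLp_clm L hCy).neg
    have hs : MemLp (fun s => B (yu s) + -L (C (y s))) 2 (horizon T) := (memLp_clm B hyum).add hLC
    have h2 : energy T y = energy T (SL.conv (fun s => B (yu s) + -L (C (y s)))) :=
      energy_congr_ae (by
        filter_upwards [ae_restrict_mem measurableSet_Ioc] with t ht
        exact hymild t ⟨ht.1.le, ht.2⟩)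
    have h3 := (SL.memLp_conv hω' hT (fun s hs => hSL s hs.1) hs).2.1
    have h4 := energy_add_le (memLp_clm B hyum) hLC
    have h5 : energy T (fun t => -L (C (y t))) = energy T (fun t => L (C (y t))) := by
      simp [energy]
    have h6 := energy_clm_le B hyum
    have h7 := energy_clm_le L hCy
    rw [h2]
    refine h3.trans ?_
    rw [← ha]
    gcongr
    linarith
  have h2 : energy T w ≤ 2 * energy T yu + 2 * (‖F‖ ^ 2 * energy T y) := by
    have hFy : MemLp (fun t => -F (y t)) 2 (horizon T) := (memLp_clm F hym).neg
    have h4 := energy_add_le hyum hFy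
    have h5 : energy T (fun t => -F (y t)) = energy T (fun t => F (y t)) := by
      simp [energy]
    have h6 := energy_clm_le F hym
    have h7 : (fun t => yu t + -F (y t)) = w := by ext t; simp [hyu]
    rw [h7, h5] at h4
    linarith
  have h3 : energy T yu ≤ energy T (fun t => K (yu t)) / m := by
    rw [le_div_iff₀ hm, mul_comm, energy, energy, ← integral_const_mul]
    exact integral_mono ((hyum.integrable_norm_pow two_ne_zero).const_mul m)
      ((memLp_clm K hyum).integrable_norm_pow two_ne_zero) fun t => hK _
  have h0C := energy_nonneg T (fun t => C (y t))
  have h0K := energy_nonneg T (fun t => K (yu t))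
  rw [inv_mul_le_iff₀ (by positivity)]
  set eC := energy T (fun t => C (y t))
  set eK := energy T (fun t => K (yu t))
  have ha0 : 0 ≤ a := by positivity
  have h4 : 2 * (‖F‖ ^ 2 * energy T y) ≤ 2 * (‖F‖ ^ 2 * (a * (2 * (‖B‖ ^ 2 * (eK / m))
      + 2 * (‖L‖ ^ 2 * eC)))) := by
    gcongr
    refine h1.trans ?_
    gcongr
  have e : (2 / m + 2 * ‖F‖ ^ 2 * a * (2 * ‖B‖ ^ 2 / m) + 2 * ‖F‖ ^ 2 * a * (2 * ‖L‖ ^ 2))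
      * (eC + eK) = 2 * (eK / m) + 2 * (‖F‖ ^ 2 * (a * (2 * (‖B‖ ^ 2 * (eK / m))
      + 2 * (‖L‖ ^ 2 * eC)))) + (2 / m * eC + 2 * ‖F‖ ^ 2 * a * (2 * ‖B‖ ^ 2 / m) * eC
      + 2 * ‖F‖ ^ 2 * a * (2 * ‖L‖ ^ 2) * eK) := by ring
  rw [e]
  have : 0 ≤ 2 / m * eC + 2 * ‖F‖ ^ 2 * a * (2 * ‖B‖ ^ 2 / m) * eC
      + 2 * ‖F‖ ^ 2 * a * (2 * ‖L‖ ^ 2) * eK := by positivity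
  linarith

/-- Integral of a mild solution starting at `0` in terms of the negative inverse of the
generator. -/
lemma integral_conv_eq {SF : C0Semigroup H} {R : H →L[ℂ] H}
    (hR : ∀ x t, 0 ≤ t → ∫ s in (0 : ℝ)..t, SF.op (max s 0) x = R x - R (SF.op t x))
    {f : ℝ → H} {T : ℝ} (hT : 0 ≤ T) (hf : IntervalIntegrable f volume 0 T) :
    ∫ t in (0 : ℝ)..T, SF.conv f t = R (∫ t in (0 : ℝ)..T, f t) - R (SF.conv f T) := by
  have hfI := (intervalIntegrable_iff_integrableOn_Ioc_of_le hT).1 hf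
  obtain ⟨M, hM, hb⟩ := SF.exists_bound T
  have hsw := integral_triangle_swap hT (g := fun t s => SF.op (max (t - s) 0) (f s))
    (integrable_prod_clm_apply (Φ := fun p : ℝ × ℝ => SF.op (max (p.1 - p.2) 0))
      (SF.stronglyMeasurable_op_max (by fun_prop)) (c := M) (by
        filter_upwards [ae_mem_prod_Ioc 0 T] with p hp
        exact hb _ ⟨le_max_right _ _, max_le (by linarith [hp.1.2, hp.2.1]) hT⟩) hfI)
  have e1 : ∫ t in (0 : ℝ)..T, SF.conv f t
      = ∫ t in (0 : ℝ)..T, ∫ s in (0 : ℝ)..t, SF.op (max (t - s) 0) (f s) := by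
    refine intervalIntegral.integral_congr fun t ht => ?_
    rw [Set.uIcc_of_le hT] at ht
    refine intervalIntegral.integral_congr fun s hs => ?_
    rw [Set.uIcc_of_le ht.1] at hs
    rw [max_eq_left (by linarith [hs.2])]
  rw [e1, hsw, C0Semigroup.conv, ← ContinuousLinearMap.intervalIntegral_comp_comm R hf,
    ← ContinuousLinearMap.intervalIntegral_comp_comm R (SF.intervalIntegrable_op hT hf),
    ← intervalIntegral.integral_sub
      ((intervalIntegrable_iff_integrableOn_Ioc_of_le hT).2 (R.integrable_comp hfI))
      ((intervalIntegrable_iff_integrableOn_Ioc_of_le hT).2 (R.integrable_comp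
        ((intervalIntegrable_iff_integrableOn_Ioc_of_le hT).1 (SF.intervalIntegrable_op hT hf))))]
  refine intervalIntegral.integral_congr fun s hs => ?_
  rw [Set.uIcc_of_le hT] at hs
  -- After the exchange, the inner integral is the orbit of f s over a time T - s, which `hR`
  -- evaluates; its end contributions assemble to R applied to the convolution at T.
  have h2 := intervalIntegral.integral_comp_sub_right (a := s) (b := T)
    (fun σ : ℝ => SF.op (max σ 0) (f s)) s
  rw [sub_self] at h2
  rw [h2, hR _ _ (by linarith [hs.2])]

/-- Along trajectories of the closed loop, the linearized cost at an optimal steady state is a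
boundary term. -/
lemma exists_abs_integral_costDeriv_le [CompleteSpace U] {M ω : ℝ} (hω : 0 < ω)
    (hSF : ∀ t, 0 ≤ t → ‖SF.op t‖ ≤ M * Real.exp (-ω * t)) {R : H →L[ℂ] H}
    (hR : ∀ x t, 0 ≤ t → ∫ s in (0 : ℝ)..t, SF.op (max s 0) x = R x - R (SF.op t x))
    {xe : H} {ue : U}
    (hEL : ∀ w, costDeriv C K z v xe ue (R (B w)) (w + F (R (B w))) = 0) :
    ∃ c : ℝ, 0 ≤ c ∧ ∀ T, 0 ≤ T → ∀ w : ℝ → U, MemLp w 2 (horizon T) →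
      |∫ t, costDeriv C K z v xe ue (SF.conv (fun s => B (w s)) t)
        (w t + F (SF.conv (fun s => B (w s)) t)) ∂horizon T|
        ≤ c * ‖SF.conv (fun s => B (w s)) T‖ := by
  -- In the variables (x, w) the derivative is the real part of bounded complex-linear functionals,
  -- which commute with the time integral.
  set Λ₂ : U →L[ℂ] ℂ := (innerSL ℂ (K ue)).comp K + innerSL ℂ v with hΛ₂
  set Λ₁ : H →L[ℂ] ℂ := (innerSL ℂ (C xe)).comp C + innerSL ℂ z + Λ₂.comp F with hΛ₁
  have hΛ : ∀ x w, costDeriv C K z v xe ue x (w + F x) = (Λ₁ x + Λ₂ w).re := by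
    intro x w
    simp only [costDeriv, costForm, hΛ₁, hΛ₂, map_add, inner_add_right, Complex.add_re,
      add_apply, ContinuousLinearMap.comp_apply, innerSL_apply_apply]
    ring
  refine ⟨‖Λ₁.comp R‖, norm_nonneg _, fun T hT w hw => ?_⟩
  set y := SF.conv (fun s => B (w s)) with hy
  have hym : MemLp y 2 (horizon T) := (memLp_conv_feedback hω hT hSF hw).1
  have hBw := MemLp.intervalIntegrable_of_le (memLp_clm B hw) hT le_rfl
  have i1 : Integrable y (horizon T) := hym.integrable one_le_two
  have i2 : Integrable w (horizon T) := hw.integrable one_le_two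
  have i3 : Integrable (fun s => B (w s)) (horizon T) := (memLp_clm B hw).integrable one_le_two
  have h1 : ∫ t, y t ∂horizon T = R (∫ t, B (w t) ∂horizon T) - R (y T) := by
    have := integral_conv_eq hR hT hBw
    rwa [intervalIntegral.integral_of_le hT, intervalIntegral.integral_of_le hT] at this
  have h2 : ∫ t, costDeriv C K z v xe ue (y t) (w t + F (y t)) ∂horizon T
      = (Λ₁ (∫ t, y t ∂horizon T) + Λ₂ (∫ t, w t ∂horizon T)).re := by
    simp only [hΛ]
    have i4 : Integrable (fun t => Λ₁ (y t)) (horizon T) := Λ₁.integrable_comp i1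
    have i5 : Integrable (fun t => Λ₂ (w t)) (horizon T) := Λ₂.integrable_comp i2
    rw [← Λ₁.integral_comp_comm i1, ← Λ₂.integral_comp_comm i2, ← integral_add i4 i5]
    exact integral_re (𝕜 := ℂ) (i4.add i5)
  -- The steady-state condition in the direction of the total offset ∫ w cancels everything but the
  -- term with R (y T).
  have h3 := hEL (∫ t, w t ∂horizon T)
  rw [hΛ, ← B.integral_comp_comm i2] at h3
  rw [h2, h1, map_sub, sub_add_eq_add_sub, Complex.sub_re, h3, zero_sub, abs_neg]
  exact (Complex.abs_re_le_norm _).trans ((Λ₁.comp R).le_opNorm _)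

/-- Optimal pairs, seen from an optimal steady state: closed-loop representation and first-order
condition. -/
lemma IsOptimalControl.deviation (hA : IsGenerator A S)
    (hF : IsGenerator ((B.comp F).toLinearMap +ᵥ A) SF) {M ω : ℝ} (hω : 0 < ω)
    (hSF : ∀ t, 0 ≤ t → ‖SF.op t‖ ≤ M * Real.exp (-ω * t))
    {xe : H} {ue : U} (he : IsControlledEquilibrium A B xe ue) {c : ℝ}
    (hc : ∀ T, 0 ≤ T → ∀ w : ℝ → U, MemLp w 2 (horizon T) →
      |∫ t, costDeriv C K z v xe ue (SF.conv (fun s => B (w s)) t)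
        (w t + F (SF.conv (fun s => B (w s)) t)) ∂horizon T|
        ≤ c * ‖SF.conv (fun s => B (w s)) T‖)
    {T : ℝ} (hT : 0 ≤ T) {x₀ : H} {u : ℝ → U}
    (hopt : IsOptimalControl S B (runningCost C K z v) T x₀ u) :
    ∃ w : ℝ → U, MemLp w 2 (horizon T) ∧
      (∀ t ∈ Set.Icc 0 T, mildSolution S B x₀ u t - xe
        = SF.op t (x₀ - xe) + SF.conv (fun s => B (w s)) t) ∧
      (∀ t, u t - ue = w t + F (mildSolution S B x₀ u t - xe)) ∧
      ∀ w' : ℝ → U, MemLp w' 2 (horizon T) →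
        |∫ t, costForm C K (mildSolution S B x₀ u t - xe) (u t - ue)
          (SF.conv (fun s => B (w' s)) t)
          (w' t + F (SF.conv (fun s => B (w' s)) t)) ∂horizon T|
          ≤ c * ‖SF.conv (fun s => B (w' s)) T‖ := by
  have hu := isAdmissible_iff.1 hopt.1
  set x := mildSolution S B x₀ u with hx
  have hxm : MemLp x 2 (horizon T) := memLp_mildSolution S B x₀ hT hu
  have hxem : MemLp (fun t => x t - xe) 2 (horizon T) := hxm.sub (memLp_const xe)
  have huem : MemLp (fun t => u t - ue) 2 (horizon T) := hu.sub (memLp_const ue)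
  refine ⟨fun t => (u t - ue) - F (x t - xe), huem.sub (memLp_clm F hxem), fun t ht => ?_,
    fun t => (sub_add_cancel _ _).symm, fun w' hw' => ?_⟩
  -- Subtracting the constant solution xe shows that x - xe is the mild solution for x₀ - xe and u -
  -- ue, which is then rewritten in closed loop.
  · have h2 := perturbed_of_mild hA hF (x₀ := x₀ - xe) (f := fun s => B (u s - ue))
      (y := fun s => x s - xe) ht.1
      (MemLp.intervalIntegrable_of_le (memLp_clm B huem) ht.1 ht.2) (fun s hs => by
        have e1 := mildSolution_add S B (x₀ - xe) xe huem (memLp_const ue) hs.1 (hs.2.trans ht.2)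
        have e2 := he.mild_eq hA hs.1
        simp only [sub_add_cancel] at e1
        rw [mildSolution_eq S B xe, e2] at e1
        rw [hx, e1, add_sub_cancel_right]
        rfl)
    rw [h2]
    congr 2
    ext s
    rw [map_sub B (u s - ue)]
    rfl
  · have h1 := hopt.firstVariation_eq_zero hT
      (h := fun s => w' s + F (SF.conv (fun r => B (w' r)) s))
      (hw'.add (memLp_clm F (memLp_conv_feedback hω hT hSF hw').1))
    have hy := (memLp_conv_feedback (B := B) hω hT hSF hw').1
    set y := SF.conv (fun r => B (w' r)) with hydef
    have hyu : MemLp (fun t => w' t + F (y t)) 2 (horizon T) := hw'.add (memLp_clm F hy)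
    -- The vanishing first variation splits by `costDeriv_sub`, so the quadratic form equals minus
    -- the integral already bounded by the boundary term.
    have h2 : firstVariation S B C K z v T x₀ u (fun s => w' s + F (y s))
        = (∫ t, costForm C K (x t - xe) (u t - ue) (y t) (w' t + F (y t)) ∂horizon T)
          + ∫ t, costDeriv C K z v xe ue (y t) (w' t + F (y t)) ∂horizon T := by
      rw [← integral_add (integrable_costForm hxem huem hy hyu)
        (integrable_costDeriv (memLp_const xe) (memLp_const ue) hy hyu)]
      refine setIntegral_congr_fun measurableSet_Ioc fun t ht => ?_
      dsimp only
      rw [hydef, mildSolution_feedback hA hF hw' ht.1.le ht.2, ← costDeriv_sub]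
    rw [h1] at h2
    have h3 := hc T hT w' hw'
    rwa [← abs_neg, ← eq_neg_of_add_eq_zero_left h2.symm] at h3

end Feedback

/-- A positive continuous weight whose logarithm is `δ`-Lipschitz. -/
structure IsSlowlyVarying (δ : ℝ) (ρ : ℝ → ℝ) : Prop where
  continuous : Continuous ρ
  pos : ∀ t, 0 < ρ t
  le : ∀ t s, ρ t ≤ Real.exp (δ * |t - s|) * ρ s

/-! ### Slowly varying weights -/

namespace IsSlowlyVarying

variable {δ : ℝ} {ρ : ℝ → ℝ}

lemma inv (h : IsSlowlyVarying δ ρ) : IsSlowlyVarying δ fun t => (ρ t)⁻¹ where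
  continuous := h.continuous.inv₀ fun t => (h.pos t).ne'
  pos t := inv_pos.2 (h.pos t)
  le t s := by
    have h1 := h.le s t
    have h2 := h.pos t
    have h3 := h.pos s
    rw [abs_sub_comm] at h1
    rw [← div_eq_mul_inv, le_div_iff₀ h3, inv_mul_le_iff₀ h2, mul_comm]
    exact h1

/-- With E the exponential, the ratio lies between E⁻¹ and E, and 1 - E⁻¹ ≤ E - 1. -/
lemma abs_mul_inv_sub_one_le (h : IsSlowlyVarying δ ρ) (t s : ℝ) :
    |ρ t * (ρ s)⁻¹ - 1| ≤ Real.exp (δ * |t - s|) - 1 := by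
  have h2 := h.pos t
  have h3 := h.pos s
  have hE := Real.exp_pos (δ * |t - s|)
  have h1 : ρ t * (ρ s)⁻¹ ≤ Real.exp (δ * |t - s|) := by
    rw [← div_eq_mul_inv, div_le_iff₀ h3]
    exact h.le t s
  have h4 : 1 ≤ Real.exp (δ * |t - s|) * (ρ t * (ρ s)⁻¹) := by
    rw [← mul_assoc, ← div_eq_mul_inv, le_div_iff₀ h3, one_mul, abs_sub_comm]
    exact h.le s t
  set E := Real.exp (δ * |t - s|)
  set r := ρ t * (ρ s)⁻¹
  rw [abs_le]
  constructor
  · nlinarith [sq_nonneg (E - 1)]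
  · linarith

lemma memLp_smul {E : Type*} [NormedAddCommGroup E] [NormedSpace ℝ E] (h : IsSlowlyVarying δ ρ)
    {T : ℝ} {f : ℝ → E} (hf : MemLp f 2 (horizon T)) :
    MemLp (fun t => ρ t • f t) 2 (horizon T) := by
  obtain ⟨c, hc⟩ := isCompact_Icc.exists_bound_of_continuousOn (s := Set.Icc 0 T)
    h.continuous.continuousOn
  refine MemLp.of_le_mul (c := c) hf (h.continuous.aestronglyMeasurable.smul hf.1) ?_
  filter_upwards [ae_restrict_mem measurableSet_Ioc] with t ht
  rw [norm_smul]
  gcongr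
  exact hc t ⟨ht.1.le, ht.2⟩

end IsSlowlyVarying

/-- Here e^{δτ} - 1 ≤ δτ e^{δτ}, and the factor τ is paid for with a quarter of the decay. With δ ≤
ω/4, half of the decay survives together with the small factor δ/ω. -/
lemma exp_sub_one_mul_exp_le {δ ω τ : ℝ} (hω : 0 < ω) (hδ : 0 ≤ δ) (hδω : δ ≤ ω / 4)
    (hτ : 0 ≤ τ) :
    (Real.exp (δ * τ) - 1) * Real.exp (-ω * τ) ≤ 4 * δ / ω * Real.exp (-(ω / 2) * τ) := by
  have h1 : Real.exp (δ * τ) - 1 ≤ δ * τ * Real.exp (δ * τ) := by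
    have h2 := mul_le_mul_of_nonneg_right (Real.add_one_le_exp (-(δ * τ)))
      (Real.exp_pos (δ * τ)).le
    rw [← Real.exp_add, neg_add_cancel, Real.exp_zero] at h2
    linarith
  have h3 : δ * τ ≤ 4 * δ / ω * Real.exp (ω / 4 * τ) := by
    have h4 := Real.add_one_le_exp (ω / 4 * τ)
    have h5 : 4 * δ / ω * (ω / 4 * τ) ≤ 4 * δ / ω * Real.exp (ω / 4 * τ) := by
      gcongr
      linarith
    have h6 : 4 * δ / ω * (ω / 4 * τ) = δ * τ := by field_simp
    linarith
  calc (Real.exp (δ * τ) - 1) * Real.exp (-ω * τ)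
      ≤ (4 * δ / ω * Real.exp (ω / 4 * τ) * Real.exp (δ * τ)) * Real.exp (-ω * τ) := by
        gcongr
        exact h1.trans (by gcongr)
    _ = 4 * δ / ω * Real.exp (ω / 4 * τ + δ * τ + -ω * τ) := by
        rw [Real.exp_add, Real.exp_add]; ring
    _ ≤ _ := by
        gcongr
        nlinarith

/-! ### Commutator of a weight with convolution -/

section Commutator

variable {H : Type*} [NormedAddCommGroup H] [InnerProductSpace ℂ H] [CompleteSpace H]
  {S : C0Semigroup H} {M ω δ T : ℝ} {ρ : ℝ → ℝ} {f : ℝ → H}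

/-- The commutator of convolution with an exponentially stable semigroup and a slowly varying
weight is small. -/
lemma norm_weighted_conv_sub_le (hω : 0 < ω) (hδ : 0 ≤ δ) (hδω : δ ≤ ω / 4) (hM : 0 ≤ M)
    (hS : ∀ t, 0 ≤ t → ‖S.op t‖ ≤ M * Real.exp (-ω * t)) (hρ : IsSlowlyVarying δ ρ)
    (hf : MemLp f 2 (horizon T)) {t : ℝ} (ht : t ∈ Set.Icc 0 T) :
    ‖ρ t • S.conv (fun s => (ρ s)⁻¹ • f s) t - S.conv f t‖
      ≤ M * (4 * δ / ω) * expConv (ω / 2) (fun s => ‖f s‖) t := by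
  have hfi := MemLp.intervalIntegrable_of_le hf ht.1 ht.2
  have hgi := MemLp.intervalIntegrable_of_le (hρ.inv.memLp_smul hf) ht.1 ht.2
  have hgi' : IntervalIntegrable (fun s => ρ t • (ρ s)⁻¹ • f s) volume 0 t := hgi.smul (ρ t)
  -- The commutator has kernel (ρ(t)/ρ(s) - 1) S_{t-s}, which is small for t near s and damped by
  -- the decay of S elsewhere.
  have e : ρ t • S.conv (fun s => (ρ s)⁻¹ • f s) t - S.conv f t
      = ∫ s in (0 : ℝ)..t, S.op (t - s) ((ρ t * (ρ s)⁻¹ - 1) • f s) := by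
    rw [← S.conv_smul, C0Semigroup.conv, C0Semigroup.conv, ← intervalIntegral.integral_sub
      (S.intervalIntegrable_op ht.1 hgi') (S.intervalIntegrable_op ht.1 hfi)]
    refine intervalIntegral.integral_congr fun s _ => ?_
    rw [← map_sub, sub_smul, one_smul, mul_smul]
  rw [e, expConv, ← intervalIntegral.integral_const_mul]
  refine intervalIntegral.norm_integral_le_of_norm_le ht.1 (Eventually.of_forall fun s hs => ?_)
    ((intervalIntegrable_exp_mul hfi.norm).const_mul _)
  have hts : 0 ≤ t - s := by linarith [hs.2]
  have h1 := hρ.abs_mul_inv_sub_one_le t s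
  rw [abs_of_nonneg hts] at h1
  have h2 := exp_sub_one_mul_exp_le hω hδ hδω hts
  calc ‖S.op (t - s) ((ρ t * (ρ s)⁻¹ - 1) • f s)‖
      ≤ M * Real.exp (-ω * (t - s)) * ((Real.exp (δ * (t - s)) - 1) * ‖f s‖) := by
        refine (S.op _).le_of_opNorm_le_of_le (hS _ hts) ?_
        rw [norm_smul]
        gcongr
        exact h1
    _ = M * ((Real.exp (δ * (t - s)) - 1) * Real.exp (-ω * (t - s))) * ‖f s‖ := by ring
    _ ≤ M * (4 * δ / ω * Real.exp (-(ω / 2) * (t - s))) * ‖f s‖ := by gcongr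
    _ = _ := by ring

/-- The energy bound keeps the factor δ², needed for the absorption later. The pointwise bound only
has to be uniform, so there 4δ/ω is replaced by one. -/
lemma memLp_weighted_conv_sub (hω : 0 < ω) (hδ : 0 ≤ δ) (hδω : δ ≤ ω / 4) (hM : 0 ≤ M)
    (hT : 0 ≤ T) (hS : ∀ t, 0 ≤ t → ‖S.op t‖ ≤ M * Real.exp (-ω * t))
    (hρ : IsSlowlyVarying δ ρ) (hf : MemLp f 2 (horizon T)) :
    MemLp (fun t => ρ t • S.conv (fun s => (ρ s)⁻¹ • f s) t - S.conv f t) 2 (horizon T) ∧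
    energy T (fun t => ρ t • S.conv (fun s => (ρ s)⁻¹ • f s) t - S.conv f t)
      ≤ (8 * M / ω ^ 2) ^ 2 * δ ^ 2 * energy T f ∧
    ∀ t ∈ Set.Icc 0 T, ‖ρ t • S.conv (fun s => (ρ s)⁻¹ • f s) t - S.conv f t‖ ^ 2
      ≤ 2 * M ^ 2 / ω * energy T f := by
  have hg := hρ.inv.memLp_smul hf
  obtain ⟨h1, h2, h3⟩ := memLp_of_norm_le_expConv (c := M * (4 * δ / ω)) (half_pos hω) hT
    ((hρ.continuous.aestronglyMeasurable.smul (S.aestronglyMeasurable_conv hg.1)).sub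
      (S.aestronglyMeasurable_conv hf.1)) hf.norm
    (fun t ht => norm_weighted_conv_sub_le hω hδ hδω hM hS hρ hf ht)
  have e : energy T (fun s => ‖f s‖) = energy T f := by simp [energy]
  rw [e] at h2 h3
  refine ⟨h1, h2.trans_eq ?_, fun t ht => (h3 t ht).trans ?_⟩
  · field_simp
    ring
  · have h0 := energy_nonneg T f
    gcongr ?_ * _
    have h4 : 4 * δ / ω ≤ 1 := by rw [div_le_one hω]; linarith
    have h5 : (M * (4 * δ / ω)) ^ 2 ≤ M ^ 2 := by
      have : 0 ≤ 4 * δ / ω := by positivity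
      gcongr
      nlinarith
    rw [div_div_eq_mul_div, mul_comm (2 : ℝ)]
    gcongr

end Commutator

/-! ### Weighted energy estimates -/

section Weighted

variable {H U Y : Type*}
  [NormedAddCommGroup H] [InnerProductSpace ℂ H]
  [NormedAddCommGroup U] [InnerProductSpace ℂ U]
  [NormedAddCommGroup Y] [InnerProductSpace ℂ Y]
  {SF : C0Semigroup H} {B : U →L[ℂ] H} {F : H →L[ℂ] U} {C : H →L[ℂ] Y} {K : U →L[ℂ] H}

/-- Used with reciprocal factors: φ on the deviation and φ⁻¹ on the variation leave the integrand
unchanged. -/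
lemma costForm_smul_smul (a b : ℝ) (x x' : H) (u u' : U) :
    costForm C K (a • x) (a • u) (b • x') (b • u') = a * b * costForm C K x u x' u' := by
  simp only [costForm, ContinuousLinearMap.map_smul_of_tower, inner_smul_right_eq_smul,
    inner_smul_left_eq_smul, Complex.smul_re, smul_eq_mul]
  ring

/-- Perturbs the diagonal value of the form. Young's inequality with parameter δ suits errors e₁, e₂
of order δ, for which δ⁻¹‖e‖² is again of order δ. The control errors are F e₁ and F e₂ because
moving the weight disturbs only the state. -/
lemma le_costForm_add {δ : ℝ} (hδ : 0 < δ) (y e₁ e₂ : H) (w : U) :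
    ‖C y‖ ^ 2 + ‖K w‖ ^ 2 - (‖C‖ ^ 2 + ‖K‖ ^ 2) * (1 + ‖F‖) ^ 2 *
        (2 * δ * (‖y‖ ^ 2 + ‖w‖ ^ 2) + (δ⁻¹ + 1) * (‖e₁‖ ^ 2 + ‖e₂‖ ^ 2))
      ≤ costForm C K (y + e₁) (w + F e₁) (y + e₂) (w + F e₂) := by
  -- A single constant dominating every coefficient of the cross and error terms.
  set D := (‖C‖ ^ 2 + ‖K‖ ^ 2) * (1 + ‖F‖) ^ 2 with hD
  have hF0 := norm_nonneg F
  have hC : ‖C‖ ^ 2 ≤ D := by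
    have : (1 : ℝ) ≤ (1 + ‖F‖) ^ 2 := by nlinarith
    nlinarith [sq_nonneg ‖C‖, sq_nonneg ‖K‖]
  have hKF : ‖K‖ ^ 2 * ‖F‖ ≤ D := by
    have : ‖F‖ ≤ (1 + ‖F‖) ^ 2 := by nlinarith
    nlinarith [sq_nonneg ‖C‖, sq_nonneg ‖K‖, sq_nonneg (1 + ‖F‖)]
  have hCKF : ‖C‖ ^ 2 + ‖K‖ ^ 2 * ‖F‖ ^ 2 ≤ D := by
    have h1 : ‖F‖ ^ 2 ≤ (1 + ‖F‖) ^ 2 := by nlinarith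
    have h2 : (1 : ℝ) ≤ (1 + ‖F‖) ^ 2 := by nlinarith
    nlinarith [sq_nonneg ‖C‖, sq_nonneg ‖K‖]
  have hD0 : 0 ≤ D := by positivity
  have young : ∀ a b : ℝ, a * b ≤ δ * a ^ 2 + δ⁻¹ / 4 * b ^ 2 := by
    intro a b
    have h1 : 0 ≤ δ * (a - δ⁻¹ / 2 * b) ^ 2 := by positivity
    have h2 : δ * (a - δ⁻¹ / 2 * b) ^ 2 = δ * a ^ 2 - (δ * δ⁻¹) * (a * b)
        + (δ * δ⁻¹) * (δ⁻¹ / 4 * b ^ 2) := by ring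
    rw [mul_inv_cancel₀ hδ.ne'] at h2
    linarith
  have cross : ∀ e : H, |costForm C K y w e (F e)|
      ≤ D * (δ * (‖y‖ ^ 2 + ‖w‖ ^ 2) + δ⁻¹ * ‖e‖ ^ 2) := by
    intro e
    have h1 := abs_costForm_le C K y e w (F e)
    have h2 : ‖K‖ ^ 2 * (‖w‖ * ‖F e‖) ≤ D * (‖w‖ * ‖e‖) := by
      calc ‖K‖ ^ 2 * (‖w‖ * ‖F e‖) ≤ ‖K‖ ^ 2 * (‖w‖ * (‖F‖ * ‖e‖)) := by
            gcongr; exact F.le_opNorm e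
        _ = (‖K‖ ^ 2 * ‖F‖) * (‖w‖ * ‖e‖) := by ring
        _ ≤ _ := by gcongr
    have h3 : ‖C‖ ^ 2 * (‖y‖ * ‖e‖) ≤ D * (‖y‖ * ‖e‖) := by gcongr
    have h4 := young ‖y‖ ‖e‖
    have h5 := young ‖w‖ ‖e‖
    have h6 : 0 ≤ δ⁻¹ * ‖e‖ ^ 2 := by positivity
    calc |costForm C K y w e (F e)| ≤ D * (‖y‖ * ‖e‖ + ‖w‖ * ‖e‖) := by linarith
      _ ≤ _ := mul_le_mul_of_nonneg_left (by linarith) hD0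
  have c1 := cross e₁
  have c2 := cross e₂
  have c3 : |costForm C K e₁ (F e₁) e₂ (F e₂)| ≤ D * (‖e₁‖ ^ 2 + ‖e₂‖ ^ 2) := by
    have h1 := abs_costForm_le C K e₁ e₂ (F e₁) (F e₂)
    have h2 : ‖K‖ ^ 2 * (‖F e₁‖ * ‖F e₂‖) ≤ ‖K‖ ^ 2 * ((‖F‖ * ‖e₁‖) * (‖F‖ * ‖e₂‖)) := by
      gcongr <;> exact F.le_opNorm _
    calc _ ≤ (‖C‖ ^ 2 + ‖K‖ ^ 2 * ‖F‖ ^ 2) * (‖e₁‖ * ‖e₂‖) := by linarith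
      _ ≤ D * (‖e₁‖ * ‖e₂‖) := by gcongr
      _ ≤ _ := mul_le_mul_of_nonneg_left
        (by nlinarith [sq_nonneg (‖e₁‖ - ‖e₂‖), sq_nonneg ‖e₁‖, sq_nonneg ‖e₂‖]) hD0
  have hsymm : costForm C K e₁ (F e₁) y w = costForm C K y w e₁ (F e₁) := by
    simp only [costForm]
    rw [← inner_conj_symm (C e₁), ← inner_conj_symm (K (F e₁)), Complex.conj_re, Complex.conj_re]
  have hdiag : costForm C K y w y w = ‖C y‖ ^ 2 + ‖K w‖ ^ 2 := by
    have h1 := inner_self_eq_norm_sq (𝕜 := ℂ) (C y)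
    have h2 := inner_self_eq_norm_sq (𝕜 := ℂ) (K w)
    simp only [RCLike.re_eq_complex_re] at h1 h2
    rw [costForm, h1, h2]
  have hexp : costForm C K (y + e₁) (w + F e₁) (y + e₂) (w + F e₂)
      = costForm C K y w y w + costForm C K y w e₂ (F e₂) + costForm C K e₁ (F e₁) y w
        + costForm C K e₁ (F e₁) e₂ (F e₂) := by
    simp only [costForm, map_add, inner_add_left, inner_add_right, Complex.add_re]
    ring
  rw [hexp, hsymm, hdiag]
  have d1 := (abs_le.1 c1).1
  have d2 := (abs_le.1 c2).1
  have d3 := (abs_le.1 c3).1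
  linarith

end Weighted

section WeightedEnergy

variable {H U Y : Type*}
  [NormedAddCommGroup H] [InnerProductSpace ℂ H] [CompleteSpace H]
  [NormedAddCommGroup U] [InnerProductSpace ℂ U]
  [NormedAddCommGroup Y] [InnerProductSpace ℂ Y]
  {SF : C0Semigroup H} {B : U →L[ℂ] H} {F : H →L[ℂ] U} {C : H →L[ℂ] Y} {K : U →L[ℂ] H}

omit [CompleteSpace H] in
/-- A weighted orbit of an exponentially stable semigroup. -/
lemma norm_weighted_op_le {M ω δ : ℝ} (hω : 0 < ω) (hδω : δ ≤ ω / 4) (hM : 0 ≤ M)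
    (hSF : ∀ t, 0 ≤ t → ‖SF.op t‖ ≤ M * Real.exp (-ω * t)) {φ : ℝ → ℝ} (hφ : IsSlowlyVarying δ φ)
    (hφ0 : φ 0 ≤ 1) (x : H) {t : ℝ} (ht : 0 ≤ t) :
    ‖φ t • SF.op t x‖ ≤ M * ‖x‖ * Real.exp (-(ω / 2) * t) := by
  have h1 := hφ.le t 0
  rw [sub_zero, abs_of_nonneg ht] at h1
  have h2 : φ t ≤ Real.exp (δ * t) := h1.trans (mul_le_of_le_one_right (Real.exp_pos _).le hφ0)
  have h3 := (SF.op t).le_of_opNorm_le (hSF t ht) x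
  rw [norm_smul, Real.norm_eq_abs, abs_of_pos (hφ.pos t)]
  calc φ t * ‖SF.op t x‖ ≤ Real.exp (δ * t) * (M * Real.exp (-ω * t) * ‖x‖) := by gcongr
    _ = M * ‖x‖ * Real.exp (δ * t + -ω * t) := by rw [Real.exp_add]; ring
    _ ≤ _ := by
      gcongr
      nlinarith

omit [CompleteSpace H] in
lemma energy_weighted_op_le {M ω δ T : ℝ} (hω : 0 < ω) (hδω : δ ≤ ω / 4) (hM : 0 ≤ M)
    (hT : 0 ≤ T) (hSF : ∀ t, 0 ≤ t → ‖SF.op t‖ ≤ M * Real.exp (-ω * t)) {φ : ℝ → ℝ}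
    (hφ : IsSlowlyVarying δ φ) (hφ0 : φ 0 ≤ 1) (x : H) :
    energy T (fun t => φ t • SF.op t x) ≤ M ^ 2 / ω * ‖x‖ ^ 2 := by
  have h1 : energy T (fun t => φ t • SF.op t x)
      ≤ ∫ t, (M * ‖x‖) ^ 2 * Real.exp (-ω * (t - 0)) ∂horizon T := by
    refine integral_mono_of_nonneg (Eventually.of_forall fun _ => by positivity) ?_ ?_
    · exact (Continuous.integrableOn_Icc (by fun_prop)).mono_set Set.Ioc_subset_Icc_self
    · filter_upwards [ae_restrict_mem measurableSet_Ioc] with t ht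
      have h2 := norm_weighted_op_le hω hδω hM hSF hφ hφ0 x ht.1.le
      calc ‖φ t • SF.op t x‖ ^ 2 ≤ (M * ‖x‖ * Real.exp (-(ω / 2) * t)) ^ 2 := by gcongr
        _ = (M * ‖x‖) ^ 2 * Real.exp (-ω * (t - 0)) := by
          rw [mul_pow, ← Real.exp_nat_mul]
          congr 2
          push_cast
          ring
  refine h1.trans ?_
  rw [integral_const_mul, ← intervalIntegral.integral_of_le hT]
  have h2 := integral_exp_tail_le (s := 0) (T := T) hω
  calc (M * ‖x‖) ^ 2 * ∫ t in (0 : ℝ)..T, Real.exp (-ω * (t - 0)) ≤ (M * ‖x‖) ^ 2 * (1 / ω) := by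
        gcongr
    _ = _ := by ring

omit [CompleteSpace H] in
lemma le_integral_costForm_add {δ T : ℝ} (hδ : 0 < δ) {y e₁ e₂ : ℝ → H} {yu : ℝ → U}
    (hy : MemLp y 2 (horizon T)) (he₁ : MemLp e₁ 2 (horizon T)) (he₂ : MemLp e₂ 2 (horizon T))
    (hyu : MemLp yu 2 (horizon T)) :
    energy T (fun t => C (y t)) + energy T (fun t => K (yu t))
      - (‖C‖ ^ 2 + ‖K‖ ^ 2) * (1 + ‖F‖) ^ 2 *
        (2 * δ * (energy T y + energy T yu) + (δ⁻¹ + 1) * (energy T e₁ + energy T e₂))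
      ≤ ∫ t, costForm C K (y t + e₁ t) (yu t + F (e₁ t)) (y t + e₂ t) (yu t + F (e₂ t))
        ∂horizon T := by
  have i1 := (memLp_clm C hy).integrable_norm_pow two_ne_zero
  have i2 := (memLp_clm K hyu).integrable_norm_pow two_ne_zero
  have i3 := hy.integrable_norm_pow two_ne_zero
  have i4 := hyu.integrable_norm_pow two_ne_zero
  have i5 := he₁.integrable_norm_pow two_ne_zero
  have i6 := he₂.integrable_norm_pow two_ne_zero
  have i12 : Integrable (fun t => ‖C (y t)‖ ^ 2 + ‖K (yu t)‖ ^ 2) (horizon T) := i1.add i2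
  have i34 : Integrable (fun t => ‖y t‖ ^ 2 + ‖yu t‖ ^ 2) (horizon T) := i3.add i4
  have i56 : Integrable (fun t => ‖e₁ t‖ ^ 2 + ‖e₂ t‖ ^ 2) (horizon T) := i5.add i6
  have i7 : Integrable (fun t => 2 * δ * (‖y t‖ ^ 2 + ‖yu t‖ ^ 2)
      + (δ⁻¹ + 1) * (‖e₁ t‖ ^ 2 + ‖e₂ t‖ ^ 2)) (horizon T) :=
    (i34.const_mul _).add (i56.const_mul _)
  simp only [energy]
  rw [← integral_add i1 i2, ← integral_add i3 i4, ← integral_add i5 i6, ← integral_const_mul,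
    ← integral_const_mul, ← integral_add (i34.const_mul _) (i56.const_mul _),
    ← integral_const_mul, ← integral_sub i12 (i7.const_mul _)]
  refine integral_mono (i12.sub (i7.const_mul _)) (integrable_costForm (hy.add he₁)
    (hyu.add (memLp_clm F he₁)) (hy.add he₂) (hyu.add (memLp_clm F he₂))) fun t => ?_
  exact le_costForm_add hδ _ _ _ _

/-- The arithmetic of the absorption. Here N is the energy of φw, ξ the norm of the variation at T,
X = ‖x₀‖² and f = ‖F‖². Young bounds cξ, and δ⁻¹ times errors of size δ²N is of size δN. -/
lemma absorb_energy {κ δ D c₁ c₃ c₄ c₅ f N X ξ c Ey Eu E₁ E₂ eC eK I : ℝ} (hδ : 0 < δ)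
    (hδ1 : δ ≤ 1) (hD0 : 0 ≤ D) (hE₁ : 0 ≤ E₁) (hE₂ : 0 ≤ E₂) (hco : κ * N ≤ eC + eK)
    (hlow : eC + eK - D * (2 * δ * (Ey + Eu) + (δ⁻¹ + 1) * (E₁ + E₂)) ≤ I) (hI : I ≤ c * ξ)
    (hξ : ξ ^ 2 ≤ c₅ * N) (h1 : Ey ≤ c₁ * N) (h2 : Eu ≤ 2 * N + 2 * f * (c₁ * N))
    (h3 : E₁ ≤ 2 * (c₃ * δ ^ 2 * N) + 2 * (c₄ * X)) (h4 : E₂ ≤ c₃ * δ ^ 2 * N) :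
    κ * N ≤ δ * (c₅ + 2 * D * (c₁ + 2 + 2 * f * c₁) + 6 * D * c₃) * N
      + δ⁻¹ * (4 * D * c₄ * X + c ^ 2) := by
  have hcx : c * ξ ≤ δ * (c₅ * N) + δ⁻¹ * c ^ 2 := by
    have h1 : 0 ≤ δ * (ξ - δ⁻¹ / 2 * c) ^ 2 := by positivity
    have h2 : δ * (ξ - δ⁻¹ / 2 * c) ^ 2 = δ * ξ ^ 2 - (δ * δ⁻¹) * (c * ξ)
        + (δ * δ⁻¹) * (δ⁻¹ / 4 * c ^ 2) := by ring
    rw [mul_inv_cancel₀ hδ.ne'] at h2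
    have h3 : δ * ξ ^ 2 ≤ δ * (c₅ * N) := by gcongr
    have h4 : 0 ≤ δ⁻¹ * c ^ 2 := by positivity
    linarith
  have hδi : 1 ≤ δ⁻¹ := (one_le_inv₀ hδ).2 hδ1
  have h12 : E₁ + E₂ ≤ 3 * (c₃ * δ ^ 2 * N) + 2 * (c₄ * X) := by linarith
  have h34 : Ey + Eu ≤ (c₁ + 2 + 2 * f * c₁) * N := by linarith
  have h5 : 0 ≤ E₁ + E₂ := add_nonneg hE₁ hE₂
  have hb : D * (2 * δ * (Ey + Eu) + (δ⁻¹ + 1) * (E₁ + E₂))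
      ≤ D * (2 * δ * ((c₁ + 2 + 2 * f * c₁) * N)
        + (2 * δ⁻¹) * (3 * (c₃ * δ ^ 2 * N) + 2 * (c₄ * X))) := by
    gcongr
    linarith
  have hid : δ⁻¹ * δ ^ 2 = δ := by rw [sq, ← mul_assoc, inv_mul_cancel₀ hδ.ne', one_mul]
  have he : D * (2 * δ * ((c₁ + 2 + 2 * f * c₁) * N)
        + (2 * δ⁻¹) * (3 * (c₃ * δ ^ 2 * N) + 2 * (c₄ * X)))
      = δ * (2 * D * (c₁ + 2 + 2 * f * c₁)) * N
        + 6 * D * c₃ * N * (δ⁻¹ * δ ^ 2) + δ⁻¹ * (4 * D * c₄ * X) := by ring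
  rw [he, hid] at hb
  linarith

/-- The weighted energy inequality behind the turnpike estimate. -/
lemma weighted_energy_inequality {M ω κ : ℝ} (hω : 0 < ω) (hM : 0 ≤ M)
    (hSF : ∀ t, 0 ≤ t → ‖SF.op t‖ ≤ M * Real.exp (-ω * t))
    (hκ : ∀ T, 0 ≤ T → ∀ w : ℝ → U, MemLp w 2 (horizon T) →
      κ * energy T w ≤ energy T (fun t => C (SF.conv (fun s => B (w s)) t))
        + energy T (fun t => K (w t + F (SF.conv (fun s => B (w s)) t)))) :
    ∃ a b : ℝ, 0 ≤ a ∧ 0 ≤ b ∧ ∀ δ, 0 < δ → δ ≤ 1 → δ ≤ ω / 4 → ∀ T, 0 ≤ T → ∀ φ : ℝ → ℝ,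
      IsSlowlyVarying δ φ → φ 0 ≤ 1 → φ T ≤ 1 → ∀ (x₀ : H) (x : ℝ → H) (u w : ℝ → U) (c : ℝ),
      0 ≤ c → MemLp w 2 (horizon T) →
      (∀ t ∈ Set.Icc 0 T, x t = SF.op t x₀ + SF.conv (fun s => B (w s)) t) →
      (∀ t, u t = w t + F (x t)) →
      (∀ w' : ℝ → U, MemLp w' 2 (horizon T) →
        |∫ t, costForm C K (x t) (u t) (SF.conv (fun s => B (w' s)) t)
          (w' t + F (SF.conv (fun s => B (w' s)) t)) ∂horizon T|
          ≤ c * ‖SF.conv (fun s => B (w' s)) T‖) →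
      κ * energy T (fun t => φ t • w t) ≤ δ * a * energy T (fun t => φ t • w t)
        + δ⁻¹ * (b * ‖x₀‖ ^ 2 + c ^ 2) := by
  set D := (‖C‖ ^ 2 + ‖K‖ ^ 2) * (1 + ‖F‖) ^ 2 with hD
  set c₁ := (M / ω) ^ 2 * ‖B‖ ^ 2 with hc₁
  set c₃ := (8 * M / ω ^ 2) ^ 2 * ‖B‖ ^ 2 with hc₃
  set c₄ := M ^ 2 / ω with hc₄
  set c₅ := 6 * c₄ * ‖B‖ ^ 2 with hc₅
  have hD0 : 0 ≤ D := by positivity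
  refine ⟨c₅ + 2 * D * (c₁ + 2 + 2 * ‖F‖ ^ 2 * c₁) + 6 * D * c₃, 4 * D * c₄, by positivity,
    by positivity, ?_⟩
  intro δ hδ hδ1 hδω T hT φ hφ hφ0 hφT x₀ x u w c hc hw hx hu hEL
  set wt : ℝ → U := fun t => φ t • w t with hwt
  have hwtm : MemLp wt 2 (horizon T) := hφ.memLp_smul hw
  have hBwt : MemLp (fun t => B (wt t)) 2 (horizon T) := memLp_clm B hwtm
  set y : ℝ → H := SF.conv (fun s => B (wt s)) with hy
  obtain ⟨hym, hyE, hyT⟩ := memLp_conv_feedback (B := B) hω hT hSF hwtm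
  rw [← hy] at hym hyE hyT
  set yu : ℝ → U := fun t => wt t + F (y t) with hyu
  have hyum : MemLp yu 2 (horizon T) := hwtm.add (memLp_clm F hym)
  -- The test offset is φ²w: divided by φ it gives φw, the same offset as that of the weighted
  -- deviation.
  set w' : ℝ → U := fun t => φ t • wt t with hw'
  have hw'm : MemLp w' 2 (horizon T) := hφ.memLp_smul hwtm
  set x' : ℝ → H := SF.conv (fun s => B (w' s)) with hx'
  have hx'e : SF.conv (fun s => ((φ s)⁻¹)⁻¹ • B (wt s)) = x' := by
    rw [hx']
    congr 1
    ext s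
    rw [inv_inv]
    exact (B.map_smul_of_tower (φ s) (wt s)).symm
  have hwe : SF.conv (fun s => (φ s)⁻¹ • B (wt s)) = SF.conv (fun s => B (w s)) := by
    congr 1
    ext s
    rw [hwt, ContinuousLinearMap.map_smul_of_tower, inv_smul_smul₀ (hφ.pos s).ne']
  obtain ⟨hg1m, hg1E, -⟩ := memLp_weighted_conv_sub hω hδ.le hδω hM hT hSF hφ hBwt
  obtain ⟨he2m, he2E, he2T⟩ := memLp_weighted_conv_sub hω hδ.le hδω hM hT hSF hφ.inv hBwt
  rw [hx'e, ← hy] at he2m he2E he2T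
  rw [hwe, ← hy] at hg1m hg1E
  -- y is the closed-loop response to φw. The commutators with φ⁻¹ and φ measure how far φ⁻¹x' and
  -- the convolution part of φx are from y; the initial value enters only through g₀.
  set e₂ : ℝ → H := fun t => (φ t)⁻¹ • x' t - y t with he₂
  set g₁ : ℝ → H := fun t => φ t • SF.conv (fun s => B (w s)) t - y t with hg₁
  set g₀ : ℝ → H := fun t => φ t • SF.op t x₀ with hg₀
  have hg0m : MemLp g₀ 2 (horizon T) := hφ.memLp_smul (SF.memLp_op x₀ T)
  set e₁ : ℝ → H := fun t => g₁ t + g₀ t with he₁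
  have he1m : MemLp e₁ 2 (horizon T) := hg1m.add hg0m
  have hN0 := energy_nonneg T wt
  have hBE := energy_clm_le B hwtm
  have hg0E := energy_weighted_op_le hω hδω hM hT hSF hφ hφ0 x₀
  have hE1 : energy T e₁ ≤ 2 * (c₃ * δ ^ 2 * energy T wt) + 2 * (c₄ * ‖x₀‖ ^ 2) := by
    have h1 := energy_add_le hg1m hg0m
    have h2 : (8 * M / ω ^ 2) ^ 2 * δ ^ 2 * energy T (fun t => B (wt t))
        ≤ (8 * M / ω ^ 2) ^ 2 * δ ^ 2 * (‖B‖ ^ 2 * energy T wt) := by gcongr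
    have h3 : (8 * M / ω ^ 2) ^ 2 * δ ^ 2 * (‖B‖ ^ 2 * energy T wt) = c₃ * δ ^ 2 * energy T wt := by
      ring
    linarith
  have hE2 : energy T e₂ ≤ c₃ * δ ^ 2 * energy T wt := by
    have h2 : (8 * M / ω ^ 2) ^ 2 * δ ^ 2 * energy T (fun t => B (wt t))
        ≤ (8 * M / ω ^ 2) ^ 2 * δ ^ 2 * (‖B‖ ^ 2 * energy T wt) := by gcongr
    have h3 : (8 * M / ω ^ 2) ^ 2 * δ ^ 2 * (‖B‖ ^ 2 * energy T wt) = c₃ * δ ^ 2 * energy T wt := by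
      ring
    linarith
  have hEyu : energy T yu ≤ 2 * energy T wt + 2 * ‖F‖ ^ 2 * (c₁ * energy T wt) := by
    have h1 := energy_add_le hwtm (memLp_clm F hym)
    have h2 := energy_clm_le F hym
    have h3 : ‖F‖ ^ 2 * energy T y ≤ ‖F‖ ^ 2 * (c₁ * energy T wt) := by gcongr
    linarith
  -- φ(T) ≤ 1 enters here: x'(T) = φ(T)(y(T) + e₂(T)), so the boundary term costs no more than the
  -- unweighted one.
  have hx'T : ‖x' T‖ ^ 2 ≤ c₅ * energy T wt := by
    have h1 : ‖x' T‖ ≤ ‖y T‖ + ‖e₂ T‖ := by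
      have h2 : x' T = φ T • (y T + e₂ T) := by
        rw [he₂, add_sub_cancel, smul_inv_smul₀ (hφ.pos T).ne']
      rw [h2, norm_smul, Real.norm_eq_abs, abs_of_pos (hφ.pos T)]
      exact (mul_le_of_le_one_left (norm_nonneg _) hφT).trans (norm_add_le _ _)
    have h3 := hyT T ⟨hT, le_rfl⟩
    have h4 := he2T T ⟨hT, le_rfl⟩
    have h5 : 2 * M ^ 2 / ω * energy T (fun t => B (wt t))
        ≤ 2 * M ^ 2 / ω * (‖B‖ ^ 2 * energy T wt) := by gcongr
    have h6 : 2 * M ^ 2 / ω * (‖B‖ ^ 2 * energy T wt) = 2 * (c₄ * ‖B‖ ^ 2 * energy T wt) := by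
      rw [hc₄]; ring
    have h7 : ‖x' T‖ ^ 2 ≤ (‖y T‖ + ‖e₂ T‖) ^ 2 := by gcongr
    have h8 : (‖y T‖ + ‖e₂ T‖) ^ 2 ≤ 2 * ‖y T‖ ^ 2 + 2 * ‖e₂ T‖ ^ 2 := by
      nlinarith [sq_nonneg (‖y T‖ - ‖e₂ T‖)]
    rw [hc₅]
    change ‖e₂ T‖ ^ 2 ≤ _ at h4
    linarith
  have hpt : ∀ t ∈ Set.Ioc 0 T, costForm C K (x t) (u t) (x' t) (w' t + F (x' t))
      = costForm C K (y t + e₁ t) (yu t + F (e₁ t)) (y t + e₂ t) (yu t + F (e₂ t)) := by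
    intro t ht
    have hp := (hφ.pos t).ne'
    have f1 : y t + e₁ t = φ t • x t := by
      change y t + ((φ t • SF.conv (fun s => B (w s)) t - y t) + φ t • SF.op t x₀) = φ t • x t
      rw [hx t ⟨ht.1.le, ht.2⟩, smul_add]
      abel
    have f2 : yu t + F (e₁ t) = φ t • u t := by
      change φ t • w t + F (y t) + F (e₁ t) = φ t • u t
      rw [hu, smul_add, ← F.map_smul_of_tower (φ t), ← f1, add_assoc, ← map_add]
    have f3 : y t + e₂ t = (φ t)⁻¹ • x' t := add_sub_cancel _ _
    have f4 : yu t + F (e₂ t) = (φ t)⁻¹ • (w' t + F (x' t)) := by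
      change wt t + F (y t) + F (e₂ t) = (φ t)⁻¹ • (φ t • wt t + F (x' t))
      rw [smul_add, ← F.map_smul_of_tower (φ t)⁻¹, ← f3, add_assoc, ← map_add, inv_smul_smul₀ hp]
    rw [f1, f2, f3, f4, costForm_smul_smul, mul_inv_cancel₀ hp, one_mul]
  have hI := hEL w' hw'm
  rw [← hx', setIntegral_congr_fun measurableSet_Ioc hpt] at hI
  have hlow := le_integral_costForm_add (C := C) (K := K) (F := F) hδ hym he1m he2m hyum
  exact absorb_energy hδ hδ1 hD0 (energy_nonneg _ _) (energy_nonneg _ _) (hκ T hT wt hwtm) hlow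
    ((le_abs_self _).trans hI) hx'T hyE hEyu hE1 hE2

/-- A weighted energy bound that is uniform in the horizon. -/
lemma exists_weighted_energy_le {M ω κ : ℝ} (hω : 0 < ω) (hM : 0 ≤ M)
    (hSF : ∀ t, 0 ≤ t → ‖SF.op t‖ ≤ M * Real.exp (-ω * t)) (hκ0 : 0 < κ)
    (hκ : ∀ T, 0 ≤ T → ∀ w : ℝ → U, MemLp w 2 (horizon T) →
      κ * energy T w ≤ energy T (fun t => C (SF.conv (fun s => B (w s)) t))
        + energy T (fun t => K (w t + F (SF.conv (fun s => B (w s)) t)))) :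
    ∃ δ b : ℝ, 0 < δ ∧ δ ≤ ω / 4 ∧ 0 ≤ b ∧ ∀ T, 0 ≤ T → ∀ φ : ℝ → ℝ,
      IsSlowlyVarying δ φ → φ 0 ≤ 1 → φ T ≤ 1 → ∀ (x₀ : H) (x : ℝ → H) (u w : ℝ → U) (c : ℝ),
      0 ≤ c → MemLp w 2 (horizon T) →
      (∀ t ∈ Set.Icc 0 T, x t = SF.op t x₀ + SF.conv (fun s => B (w s)) t) →
      (∀ t, u t = w t + F (x t)) →
      (∀ w' : ℝ → U, MemLp w' 2 (horizon T) →
        |∫ t, costForm C K (x t) (u t) (SF.conv (fun s => B (w' s)) t)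
          (w' t + F (SF.conv (fun s => B (w' s)) t)) ∂horizon T|
          ≤ c * ‖SF.conv (fun s => B (w' s)) T‖) →
      energy T (fun t => φ t • w t) ≤ b * (‖x₀‖ ^ 2 + c ^ 2) := by
  obtain ⟨a, b, ha, hb, h⟩ := weighted_energy_inequality hω hM hSF hκ
  -- The last entry makes δa ≤ κ/2, so half of the left side absorbs the error.
  set δ := min (min 1 (ω / 4)) (κ / (2 * (a + 1))) with hδ
  have hδ0 : 0 < δ := lt_min (lt_min one_pos (by positivity)) (by positivity)
  have hδ1 : δ ≤ 1 := (min_le_left _ _).trans (min_le_left _ _)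
  have hδω : δ ≤ ω / 4 := (min_le_left _ _).trans (min_le_right _ _)
  have hδa : δ * a ≤ κ / 2 := by
    have h1 : δ ≤ κ / (2 * (a + 1)) := min_le_right _ _
    rw [le_div_iff₀ (by positivity)] at h1
    nlinarith
  refine ⟨δ, 2 / κ * (δ⁻¹ * (b + 1)), hδ0, hδω, by positivity, ?_⟩
  intro T hT φ hφ hφ0 hφT x₀ x u w c hc hw hx hu hEL
  have h1 := h δ hδ0 hδ1 hδω T hT φ hφ hφ0 hφT x₀ x u w c hc hw hx hu hEL
  have hN0 := energy_nonneg T (fun t => φ t • w t)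
  set N := energy T (fun t => φ t • w t)
  have h2 : δ * a * N ≤ κ / 2 * N := by gcongr
  have h3 : b * ‖x₀‖ ^ 2 + c ^ 2 ≤ (b + 1) * (‖x₀‖ ^ 2 + c ^ 2) := by
    have : 0 ≤ b * c ^ 2 := by positivity
    nlinarith [sq_nonneg ‖x₀‖]
  have h4 : δ⁻¹ * (b * ‖x₀‖ ^ 2 + c ^ 2) ≤ δ⁻¹ * ((b + 1) * (‖x₀‖ ^ 2 + c ^ 2)) := by gcongr
  have h5 : κ / 2 * N ≤ δ⁻¹ * ((b + 1) * (‖x₀‖ ^ 2 + c ^ 2)) := by linarith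
  calc N = 2 / κ * (κ / 2 * N) := by field_simp
    _ ≤ 2 / κ * (δ⁻¹ * ((b + 1) * (‖x₀‖ ^ 2 + c ^ 2))) := by gcongr
    _ = _ := by ring

end WeightedEnergy

/-! ### Pointwise weighted bounds for state and control -/

section PointwiseBounds

variable {H U Y : Type*}
  [NormedAddCommGroup H] [InnerProductSpace ℂ H] [CompleteSpace H]
  [NormedAddCommGroup U] [InnerProductSpace ℂ U]
  [NormedAddCommGroup Y] [InnerProductSpace ℂ Y]
  {SF : C0Semigroup H} {B : U →L[ℂ] H} {F : H →L[ℂ] U} {C : H →L[ℂ] Y} {K : U →L[ℂ] H}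

/-- Weighted state bounds in terms of the weighted energy of the feedback offset. -/
lemma exists_weighted_state_bound {M ω δ : ℝ} (hω : 0 < ω) (hδ : 0 ≤ δ) (hδω : δ ≤ ω / 4)
    (hM : 0 ≤ M) (hSF : ∀ t, 0 ≤ t → ‖SF.op t‖ ≤ M * Real.exp (-ω * t)) (B : U →L[ℂ] H) :
    ∃ a : ℝ, 0 ≤ a ∧ ∀ T, 0 ≤ T → ∀ φ : ℝ → ℝ, IsSlowlyVarying δ φ → φ 0 ≤ 1 →
      ∀ (x₀ : H) (x : ℝ → H) (w : ℝ → U), MemLp w 2 (horizon T) →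
      (∀ t ∈ Set.Icc 0 T, x t = SF.op t x₀ + SF.conv (fun s => B (w s)) t) →
      energy T (fun t => φ t • x t) ≤ a * (energy T (fun t => φ t • w t) + ‖x₀‖ ^ 2) ∧
      ∀ t ∈ Set.Icc 0 T, ‖φ t • x t‖ ^ 2 ≤ a * (energy T (fun t => φ t • w t) + ‖x₀‖ ^ 2) := by
  set c₁ := (M / ω) ^ 2 * ‖B‖ ^ 2 with hc₁
  set c₂ := M ^ 2 / ω * ‖B‖ ^ 2 with hc₂
  set c₃ := (8 * M / ω ^ 2) ^ 2 * δ ^ 2 * ‖B‖ ^ 2 with hc₃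
  have h10 : 0 ≤ c₁ := by positivity
  have h20 : 0 ≤ c₂ := by positivity
  have h30 : 0 ≤ c₃ := by positivity
  refine ⟨2 * c₁ + 4 * c₃ + 4 * (M ^ 2 / ω) + 9 * c₂ + 3 * M ^ 2, by positivity, ?_⟩
  intro T hT φ hφ hφ0 x₀ x w hw hx
  have hwt : MemLp (fun t => φ t • w t) 2 (horizon T) := hφ.memLp_smul hw
  have hBwt := memLp_clm B hwt
  obtain ⟨hym, hyE, hyT⟩ := memLp_conv_feedback (B := B) hω hT hSF hwt
  obtain ⟨hgm, hgE, hgT⟩ := memLp_weighted_conv_sub hω hδ hδω hM hT hSF hφ hBwt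
  have hwe : SF.conv (fun s => (φ s)⁻¹ • B (φ s • w s)) = SF.conv (fun s => B (w s)) := by
    congr 1
    ext s
    rw [B.map_smul_of_tower, inv_smul_smul₀ (hφ.pos s).ne']
  rw [hwe] at hgm hgE hgT
  have h0m : MemLp (fun t => φ t • SF.op t x₀) 2 (horizon T) := hφ.memLp_smul (SF.memLp_op x₀ T)
  have h0E := energy_weighted_op_le hω hδω hM hT hSF hφ hφ0 x₀
  have hBE := energy_clm_le B hwt
  have hN0 := energy_nonneg T (fun t => φ t • w t)
  generalize energy T (fun t => φ t • w t) = N at *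
  -- Weighted state = response to the weighted offset + commutator + weighted free orbit; each piece
  -- has an energy bound and a pointwise bound.
  have hdec : ∀ t ∈ Set.Icc 0 T, φ t • x t = SF.conv (fun s => B (φ s • w s)) t
      + ((φ t • SF.conv (fun s => B (w s)) t - SF.conv (fun s => B (φ s • w s)) t)
        + φ t • SF.op t x₀) := by
    intro t ht
    rw [hx t ht, smul_add]
    abel
  constructor
  · have h1 : energy T (fun t => φ t • x t) = energy T (fun t => SF.conv (fun s => B (φ s • w s)) t
      + ((φ t • SF.conv (fun s => B (w s)) t - SF.conv (fun s => B (φ s • w s)) t)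
        + φ t • SF.op t x₀)) := energy_congr_ae (by
      filter_upwards [ae_restrict_mem measurableSet_Ioc] with t ht
      exact hdec t ⟨ht.1.le, ht.2⟩)
    have h2 := energy_add_le hym (hgm.add h0m)
    have h3 := energy_add_le hgm h0m
    have h4 : (8 * M / ω ^ 2) ^ 2 * δ ^ 2 * energy T (fun t => B (φ t • w t)) ≤ c₃ * N := by
      rw [hc₃, mul_assoc _ (‖B‖ ^ 2)]
      gcongr
    rw [h1]
    refine h2.trans ?_
    have h5 : energy T (fun t => (φ t • SF.conv (fun s => B (w s)) t
        - SF.conv (fun s => B (φ s • w s)) t) + φ t • SF.op t x₀)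
        ≤ 2 * (c₃ * N) + 2 * (M ^ 2 / ω * ‖x₀‖ ^ 2) := by linarith
    have p1 : 0 ≤ (4 * (M ^ 2 / ω) + 9 * c₂ + 3 * M ^ 2) * N := by positivity
    have p2 : 0 ≤ (2 * c₁ + 4 * c₃ + 9 * c₂ + 3 * M ^ 2) * ‖x₀‖ ^ 2 := by positivity
    calc _ ≤ 2 * (c₁ * N) + 2 * (2 * (c₃ * N) + 2 * (M ^ 2 / ω * ‖x₀‖ ^ 2)) := by gcongr; exact h5
      _ ≤ _ := by linarith
  · intro t ht
    have h1 := hyT t ht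
    have h2 := hgT t ht
    have h3 : ‖φ t • SF.op t x₀‖ ≤ M * ‖x₀‖ := by
      refine (norm_weighted_op_le hω hδω hM hSF hφ hφ0 x₀ ht.1).trans ?_
      refine mul_le_of_le_one_right (by positivity) (Real.exp_le_one_iff.2 ?_)
      nlinarith [ht.1]
    have h4 : 2 * M ^ 2 / ω * energy T (fun t => B (φ t • w t)) ≤ 2 * (c₂ * N) := by
      calc _ ≤ 2 * M ^ 2 / ω * (‖B‖ ^ 2 * N) := by gcongr
        _ = _ := by rw [hc₂]; ring
    have h5 : ‖φ t • SF.op t x₀‖ ^ 2 ≤ M ^ 2 * ‖x₀‖ ^ 2 := by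
      rw [← mul_pow]
      gcongr
    rw [hdec t ht]
    generalize SF.conv (fun s => B (φ s • w s)) t = y at *
    generalize φ t • SF.conv (fun s => B (w s)) t - y = g at *
    generalize φ t • SF.op t x₀ = g₀ at *
    have h6 : ‖y + (g + g₀)‖ ≤ ‖y‖ + (‖g‖ + ‖g₀‖) :=
      (norm_add_le _ _).trans (by gcongr; exact norm_add_le _ _)
    have h7 : ‖y + (g + g₀)‖ ^ 2 ≤ (‖y‖ + (‖g‖ + ‖g₀‖)) ^ 2 := by gcongr
    have h8 : (‖y‖ + (‖g‖ + ‖g₀‖)) ^ 2 ≤ 3 * ‖y‖ ^ 2 + 3 * ‖g‖ ^ 2 + 3 * ‖g₀‖ ^ 2 := by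
      nlinarith [sq_nonneg (‖y‖ - ‖g‖), sq_nonneg (‖y‖ - ‖g₀‖), sq_nonneg (‖g‖ - ‖g₀‖)]
    have p1 : 0 ≤ (2 * c₁ + 4 * c₃ + 4 * (M ^ 2 / ω) + 3 * M ^ 2) * N := by positivity
    have p2 : 0 ≤ (2 * c₁ + 4 * c₃ + 4 * (M ^ 2 / ω) + 9 * c₂) * ‖x₀‖ ^ 2 := by positivity
    have h9 : ‖y‖ ^ 2 ≤ c₂ * N := h1
    linarith

omit [CompleteSpace H] in
lemma norm_conv_clm_le {M ω T : ℝ} (hSF : ∀ t, 0 ≤ t → ‖SF.op t‖ ≤ M * Real.exp (-ω * t))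
    {w : ℝ → U} (hw : MemLp w 2 (horizon T)) {t : ℝ} (ht : t ∈ Set.Icc 0 T) :
    ‖SF.conv (fun s => B (w s)) t‖ ≤ M * ‖B‖ * expConv ω (fun s => ‖w s‖) t := by
  have hwi := MemLp.intervalIntegrable_of_le hw ht.1 ht.2
  rw [expConv, ← intervalIntegral.integral_const_mul]
  refine intervalIntegral.norm_integral_le_of_norm_le ht.1 (Eventually.of_forall fun s hs => ?_)
    ((intervalIntegrable_exp_mul hwi.norm).const_mul _)
  refine ((SF.op _).le_of_opNorm_le_of_le (hSF _ (by linarith [hs.2])) (B.le_opNorm _)).trans_eq ?_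
  ring

/-- A weighted bound for the tail of an exponentially weighted integral. -/
lemma weighted_tail_le {ω δ T s : ℝ} (hω : 0 < ω) (hδω : δ ≤ ω / 4) {φ g : ℝ → ℝ}
    (hφ : IsSlowlyVarying δ φ) (hg : MemLp g 2 (horizon T)) (hg0 : ∀ t, 0 ≤ g t)
    (hs : s ∈ Set.Ioc 0 T) :
    φ s * ∫ t in s..T, Real.exp (-ω * (t - s)) * g t
      ≤ (2 / ω + energy T (fun t => φ t * g t)) / 2 := by
  have hsub : Set.Ioc s T ⊆ Set.Ioc 0 T := Set.Ioc_subset_Ioc_left hs.1.le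
  have hφg : MemLp (fun t => φ t * g t) 2 (horizon T) := hφ.memLp_smul hg
  have i2 : IntegrableOn (fun t => (φ t * g t) ^ 2) (Set.Ioc 0 T) := hφg.integrable_sq
  have i2' : IntervalIntegrable (fun t => (φ t * g t) ^ 2) volume s T := by
    rw [intervalIntegrable_iff_integrableOn_Ioc_of_le hs.2]
    exact i2.mono_set hsub
  have i1 : IntervalIntegrable g volume s T := by
    rw [intervalIntegrable_iff_integrableOn_Ioc_of_le hs.2]
    exact IntegrableOn.mono_set (hg.integrable one_le_two) hsub
  have i0 : IntervalIntegrable (fun t => Real.exp (-ω * (t - s)) * g t) volume s T :=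
    i1.continuousOn_mul (by fun_prop)
  have i3 : IntervalIntegrable (fun t => Real.exp (-(ω / 2) * (t - s))) volume s T :=
    Continuous.intervalIntegrable (by fun_prop) _ _
  rw [← intervalIntegral.integral_const_mul]
  have h1 : ∫ t in s..T, φ s * (Real.exp (-ω * (t - s)) * g t)
      ≤ ∫ t in s..T, (Real.exp (-(ω / 2) * (t - s)) + (φ t * g t) ^ 2) / 2 := by
    refine intervalIntegral.integral_mono_on hs.2 (i0.const_mul _) ((i3.add i2').div_const 2)
      fun t ht => ?_
    have hts : 0 ≤ t - s := by linarith [ht.1]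
    have h2 := hφ.le s t
    rw [abs_sub_comm, abs_of_nonneg hts] at h2
    have h3 : φ s * (Real.exp (-ω * (t - s)) * g t)
        ≤ Real.exp (-(ω / 2) * (t - s)) * (φ t * g t) := by
      calc φ s * (Real.exp (-ω * (t - s)) * g t)
          ≤ (Real.exp (δ * (t - s)) * φ t) * (Real.exp (-ω * (t - s)) * g t) := by
            have := hg0 t
            gcongr
        _ = Real.exp (δ * (t - s) + -ω * (t - s)) * (φ t * g t) := by
            rw [Real.exp_add]; ring
        _ ≤ _ := by
            have := hg0 t
            have := (hφ.pos t).le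
            gcongr
            nlinarith
    -- Since E ≤ 1, E² ≤ E, so EG ≤ (E + G²)/2 and no square of the kernel has to be integrated.
    have h4 : Real.exp (-(ω / 2) * (t - s)) ≤ 1 := Real.exp_le_one_iff.2 (by nlinarith)
    have h5 := Real.exp_pos (-(ω / 2) * (t - s))
    generalize Real.exp (-(ω / 2) * (t - s)) = E at *
    generalize φ t * g t = G at *
    have h6 : E * G ≤ (E + G ^ 2) / 2 := by nlinarith [sq_nonneg (E - G)]
    exact h3.trans h6
  refine h1.trans ?_
  rw [intervalIntegral.integral_div, intervalIntegral.integral_add i3 i2']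
  have h2 := integral_exp_tail_le (s := s) (T := T) (half_pos hω)
  have h3 : ∫ t in s..T, (φ t * g t) ^ 2 ≤ energy T (fun t => φ t * g t) := by
    rw [intervalIntegral.integral_of_le hs.2, energy]
    simp only [Real.norm_eq_abs, sq_abs]
    exact setIntegral_mono_set i2 (Eventually.of_forall fun _ => sq_nonneg _)
      hsub.eventuallyLE
  rw [one_div_div] at h2
  gcongr

/-- Weighted pointwise control bound from the first-order condition. -/
lemma weighted_control_bound {M ω δ m c T : ℝ} (hω : 0 < ω) (hδω : δ ≤ ω / 4)
    (hM : 0 ≤ M) (hSF : ∀ t, 0 ≤ t → ‖SF.op t‖ ≤ M * Real.exp (-ω * t))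
    (hK : ∀ u, m * ‖u‖ ^ 2 ≤ ‖K u‖ ^ 2) (hc : 0 ≤ c) (hT : 0 ≤ T) {φ : ℝ → ℝ}
    (hφ : IsSlowlyVarying δ φ) (hφT : φ T ≤ 1) {x : ℝ → H} {u : ℝ → U}
    (hx : MemLp x 2 (horizon T)) (hu : MemLp u 2 (horizon T))
    (hEL : ∀ w' : ℝ → U, MemLp w' 2 (horizon T) →
        |∫ t, costForm C K (x t) (u t) (SF.conv (fun s => B (w' s)) t)
          (w' t + F (SF.conv (fun s => B (w' s)) t)) ∂horizon T|
          ≤ c * ‖SF.conv (fun s => B (w' s)) T‖) :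
    ∀ᵐ t ∂horizon T, m * (φ t * ‖u t‖) ≤ M * ‖B‖ * (c + (2 / ω + energy T
      (fun t => φ t * (‖C‖ ^ 2 * ‖x t‖ + ‖K‖ ^ 2 * ‖F‖ * ‖u t‖))) / 2) := by
  set g : ℝ → ℝ := fun t => ‖C‖ ^ 2 * ‖x t‖ + ‖K‖ ^ 2 * ‖F‖ * ‖u t‖ with hg
  have hgm : MemLp g 2 (horizon T) := (hx.norm.const_mul _).add (hu.norm.const_mul _)
  have hg0 : ∀ t, 0 ≤ g t := fun t => by positivity
  set Q := (2 / ω + energy T (fun t => φ t * g t)) / 2 with hQ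
  have hQ0 : 0 ≤ Q := by
    have := energy_nonneg T (fun t => φ t * g t)
    positivity
  set P := M * ‖B‖ * (c + Q) with hP
  have hP0 : 0 ≤ P := by positivity
  -- The cutoff is positive exactly where the claimed bound fails, and θ ≤ 1 keeps θu in L². Testing
  -- with w' = θu will force θu to vanish almost everywhere.
  set θ : ℝ → ℝ := fun t => min (max (m * (φ t * ‖u t‖) - P) 0) 1 with hθ
  have hθ0 : ∀ t, 0 ≤ θ t := fun t => le_min (le_max_right _ _) zero_le_one
  have hθ1 : ∀ t, θ t ≤ 1 := fun t => min_le_right _ _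
  have hθm : AEStronglyMeasurable θ (horizon T) := by
    have h1 : AEStronglyMeasurable (fun t => m * (φ t * ‖u t‖)) (horizon T) :=
      (hφ.continuous.aestronglyMeasurable.mul hu.1.norm).const_mul m
    have h2 : Continuous fun r : ℝ => min (max (r - P) 0) 1 := by fun_prop
    exact h2.comp_aestronglyMeasurable h1
  set w' : ℝ → U := fun t => θ t • u t with hw'
  have hw'n : ∀ t, ‖w' t‖ = θ t * ‖u t‖ := fun t => by
    rw [hw', norm_smul, Real.norm_eq_abs, abs_of_nonneg (hθ0 t)]
  have hw'm : MemLp w' 2 (horizon T) := by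
    refine hu.mono (hθm.smul hu.1) (Eventually.of_forall fun t => ?_)
    rw [hw'n]
    exact mul_le_of_le_one_left (norm_nonneg _) (hθ1 t)
  set b : ℝ → ℝ := fun t => ‖w' t‖ with hb
  have hbm : MemLp b 2 (horizon T) := hw'm.norm
  set x' := SF.conv (fun s => B (w' s)) with hx'
  have hx'm : MemLp x' 2 (horizon T) := (memLp_conv_feedback hω hT hSF hw'm).1
  have hx'b : ∀ t ∈ Set.Icc 0 T, ‖x' t‖ ≤ M * ‖B‖ * expConv ω b t := fun t ht =>
    norm_conv_clm_le hSF hw'm ht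
  have hbI := MemLp.intervalIntegrable_of_le hbm hT le_rfl
  have hgI := MemLp.intervalIntegrable_of_le hgm hT le_rfl
  have hφb : Integrable (fun t => (φ t)⁻¹ * b t) (horizon T) :=
    (hφ.inv.memLp_smul hbm).integrable one_le_two
  -- the boundary term
  have hend : expConv ω b T ≤ ∫ t, (φ t)⁻¹ * b t ∂horizon T := by
    rw [expConv, ← intervalIntegral.integral_of_le hT]
    refine intervalIntegral.integral_mono_on hT (intervalIntegrable_exp_mul hbI)
      ((intervalIntegrable_iff_integrableOn_Ioc_of_le hT).2 hφb) fun s hs => ?_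
    refine mul_le_mul_of_nonneg_right ?_ (norm_nonneg _)
    have hTs : 0 ≤ T - s := by linarith [hs.2]
    have h1 := hφ.le s T
    rw [abs_sub_comm, abs_of_nonneg hTs] at h1
    have h2 : φ s ≤ Real.exp (ω * (T - s)) := by
      refine (h1.trans (mul_le_of_le_one_right (Real.exp_pos _).le hφT)).trans ?_
      gcongr
      linarith
    rw [neg_mul, Real.exp_neg]
    exact inv_anti₀ (hφ.pos s) h2
  -- the interior term
  have hint : ∫ t, g t * expConv ω b t ∂horizon T ≤ Q * ∫ t, (φ t)⁻¹ * b t ∂horizon T := by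
    rw [← intervalIntegral.integral_of_le hT, integral_mul_expConv hT hgI hbI,
      intervalIntegral.integral_of_le hT, ← integral_const_mul]
    refine integral_mono_of_nonneg ?_ (hφb.const_mul Q) ?_
    · filter_upwards [ae_restrict_mem measurableSet_Ioc] with s hs
      refine mul_nonneg (norm_nonneg _) (intervalIntegral.integral_nonneg hs.2 fun t _ => ?_)
      exact mul_nonneg (Real.exp_pos _).le (hg0 t)
    · filter_upwards [ae_restrict_mem measurableSet_Ioc] with s hs
      have h1 := weighted_tail_le hω hδω hφ hgm hg0 hs
      rw [mul_comm, ← le_div_iff₀ (hφ.pos s), div_eq_mul_inv] at h1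
      calc b s * ∫ t in s..T, Real.exp (-ω * (t - s)) * g t
          ≤ b s * (Q * (φ s)⁻¹) := mul_le_mul_of_nonneg_left h1 (norm_nonneg _)
        _ = Q * ((φ s)⁻¹ * b s) := by ring
  have hEL' := hEL w' hw'm
  rw [← hx'] at hEL'
  have i1 : Integrable (fun t => θ t * (m * ‖u t‖ ^ 2)) (horizon T) := by
    refine ((hu.integrable_norm_pow two_ne_zero).const_mul m).bdd_mul (c := 1) hθm
      (Eventually.of_forall fun t => ?_)
    rw [Real.norm_eq_abs, abs_of_nonneg (hθ0 t)]
    exact hθ1 t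
  have i2 : Integrable (fun t => g t * expConv ω b t) (horizon T) :=
    hgm.integrable_mul (integral_sq_expConv_le hω hT hbm).1
  have hlow : ∫ t, (θ t * (m * ‖u t‖ ^ 2) - M * ‖B‖ * (g t * expConv ω b t)) ∂horizon T
      ≤ ∫ t, costForm C K (x t) (u t) (x' t) (w' t + F (x' t)) ∂horizon T := by
    refine setIntegral_mono_on (i1.sub (i2.const_mul _))
      (integrable_costForm hx hu hx'm (hw'm.add (memLp_clm F hx'm))) measurableSet_Ioc
      fun t ht => ?_
    have e : costForm C K (x t) (u t) (x' t) (w' t + F (x' t))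
        = θ t * ‖K (u t)‖ ^ 2 + costForm C K (x t) (u t) (x' t) (F (x' t)) := by
      have h1 : (inner ℂ (K (u t)) (K (w' t))).re = θ t * ‖K (u t)‖ ^ 2 := by
        have h2 := inner_self_eq_norm_sq (𝕜 := ℂ) (K (u t))
        simp only [RCLike.re_eq_complex_re] at h2
        rw [hw', ← h2]
        simp only [ContinuousLinearMap.map_smul_of_tower, inner_smul_right_eq_smul,
          Complex.smul_re, smul_eq_mul]
      simp only [costForm, map_add, inner_add_right, Complex.add_re]
      rw [h1]
      ring
    rw [e]
    have h1 := (abs_le.1 (abs_costForm_le C K (x t) (x' t) (u t) (F (x' t)))).1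
    have h2 : ‖C‖ ^ 2 * (‖x t‖ * ‖x' t‖) + ‖K‖ ^ 2 * (‖u t‖ * ‖F (x' t)‖) ≤ g t * ‖x' t‖ := by
      have h3 : ‖K‖ ^ 2 * (‖u t‖ * ‖F (x' t)‖) ≤ ‖K‖ ^ 2 * (‖u t‖ * (‖F‖ * ‖x' t‖)) := by
        gcongr
        exact F.le_opNorm _
      simp only [hg]
      linarith
    have h4 : g t * ‖x' t‖ ≤ g t * (M * ‖B‖ * expConv ω b t) :=
      mul_le_mul_of_nonneg_left (hx'b t ⟨ht.1.le, ht.2⟩) (hg0 t)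
    have h5 := mul_le_mul_of_nonneg_left (hK (u t)) (hθ0 t)
    linarith
  rw [integral_sub i1 (i2.const_mul _), integral_const_mul] at hlow
  -- The diagonal K-term of the form gives the left side; the boundary term and the state response
  -- to w' are both bounded by multiples of ∫ φ⁻¹‖w'‖, whose constants add up to P.
  have hmain : ∫ t, θ t * (m * ‖u t‖ ^ 2) ∂horizon T ≤ P * ∫ t, (φ t)⁻¹ * b t ∂horizon T := by
    have h1 := (le_abs_self _).trans hEL'
    have h2 : c * ‖x' T‖ ≤ c * (M * ‖B‖ * ∫ t, (φ t)⁻¹ * b t ∂horizon T) := by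
      refine mul_le_mul_of_nonneg_left ((hx'b T ⟨hT, le_rfl⟩).trans ?_) hc
      exact mul_le_mul_of_nonneg_left hend (by positivity)
    have h3 : M * ‖B‖ * ∫ t, g t * expConv ω b t ∂horizon T
        ≤ M * ‖B‖ * (Q * ∫ t, (φ t)⁻¹ * b t ∂horizon T) :=
      mul_le_mul_of_nonneg_left hint (by positivity)
    rw [hP]
    linarith
  -- The difference of the two integrands factors as φ⁻¹‖u‖ θ (mφ‖u‖ - P), which is nonnegative. By
  -- `hmain` its integral is at most zero, so it vanishes almost everywhere.
  have hnn : ∀ t, 0 ≤ θ t * (m * ‖u t‖ ^ 2) - P * ((φ t)⁻¹ * b t) := by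
    intro t
    have hp := hφ.pos t
    have e : θ t * (m * ‖u t‖ ^ 2) - P * ((φ t)⁻¹ * b t)
        = (φ t)⁻¹ * ‖u t‖ * (θ t * (m * (φ t * ‖u t‖) - P)) := by
      simp only [hb, hw'n]
      field_simp
    rw [e]
    refine mul_nonneg (mul_nonneg (inv_pos.2 hp).le (norm_nonneg _)) ?_
    rcases le_total 0 (m * (φ t * ‖u t‖) - P) with h | h
    · exact mul_nonneg (hθ0 t) h
    · have : θ t = 0 := by simp only [hθ]; rw [max_eq_right h]; simp
      rw [this, zero_mul]
  have hzero : ∫ t, (θ t * (m * ‖u t‖ ^ 2) - P * ((φ t)⁻¹ * b t)) ∂horizon T = 0 := by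
    refine le_antisymm ?_ (integral_nonneg hnn)
    rw [integral_sub i1 (hφb.const_mul P), integral_const_mul]
    linarith
  have hae := (integral_eq_zero_iff_of_nonneg hnn (i1.sub (hφb.const_mul P))).1 hzero
  filter_upwards [hae] with t ht
  by_contra hcon
  push Not at hcon
  have hp := hφ.pos t
  have hpos : 0 < m * (φ t * ‖u t‖) - P := by linarith
  have hθpos : 0 < θ t := lt_min (lt_max_of_lt_left hpos) one_pos
  have hupos : 0 < ‖u t‖ := by
    rcases (norm_nonneg (u t)).eq_or_lt with h | h
    · rw [← h, mul_zero, mul_zero] at hpos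
      linarith
    · exact h
  have e : θ t * (m * ‖u t‖ ^ 2) - P * ((φ t)⁻¹ * b t)
      = (φ t)⁻¹ * ‖u t‖ * (θ t * (m * (φ t * ‖u t‖) - P)) := by
    simp only [hb, hw'n]
    field_simp
  have ht0 : θ t * (m * ‖u t‖ ^ 2) - P * ((φ t)⁻¹ * b t) = 0 := ht
  rw [e] at ht0
  have : 0 < (φ t)⁻¹ * ‖u t‖ * (θ t * (m * (φ t * ‖u t‖) - P)) := by positivity
  linarith

end PointwiseBounds

/-! ### The turnpike weight and the final estimates -/

section Weight

/-- The turnpike weight on `[0,T]` is slowly varying. -/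
lemma isSlowlyVarying_turnpikeWeight {δ : ℝ} (hδ : 0 ≤ δ) (T : ℝ) :
    IsSlowlyVarying δ fun t => (Real.exp (-δ * t) + Real.exp (-δ * (T - t)))⁻¹ := by
  refine IsSlowlyVarying.inv ⟨by fun_prop, fun t => by positivity, fun t s => ?_⟩
  rw [mul_add, ← Real.exp_add, ← Real.exp_add]
  have h1 := mul_le_mul_of_nonneg_left (neg_abs_le (t - s)) hδ
  have h2 := mul_le_mul_of_nonneg_left (le_abs_self (t - s)) hδ
  gcongr <;> linarith

lemma turnpikeWeight_zero_le (δ T : ℝ) :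
    (Real.exp (-δ * 0) + Real.exp (-δ * (T - 0)))⁻¹ ≤ 1 := by
  apply inv_le_one_of_one_le₀
  rw [mul_zero, Real.exp_zero]
  linarith [Real.exp_pos (-δ * (T - 0))]

lemma turnpikeWeight_self_le (δ T : ℝ) :
    (Real.exp (-δ * T) + Real.exp (-δ * (T - T)))⁻¹ ≤ 1 := by
  apply inv_le_one_of_one_le₀
  rw [sub_self, mul_zero, Real.exp_zero]
  linarith [Real.exp_pos (-δ * T)]

end Weight

lemma energy_const_mul_norm {E : Type*} [NormedAddCommGroup E] (T α : ℝ) (f : ℝ → E) :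
    energy T (fun t => α * ‖f t‖) = α ^ 2 * energy T f := by
  simp only [energy]
  rw [← integral_const_mul]
  refine integral_congr_ae (Eventually.of_forall fun t => ?_)
  simp [mul_pow]

section Estimates

variable {H U Y : Type*}
  [NormedAddCommGroup H] [InnerProductSpace ℂ H] [CompleteSpace H]
  [NormedAddCommGroup U] [InnerProductSpace ℂ U]
  [NormedAddCommGroup Y] [InnerProductSpace ℂ Y]
  {A : H →ₗ.[ℂ] H} {S SF SL : C0Semigroup H} {B : U →L[ℂ] H} {F : H →L[ℂ] U}
  {C : H →L[ℂ] Y} {L : Y →L[ℂ] H} {K : U →L[ℂ] H} {z : H} {v : U}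

/-- Approximate critical points of the quadratic cost, with start value in a ball, are bounded
in every slowly varying weight that is at most one at both ends of the horizon. -/
lemma exists_weighted_bound {M ω κ m : ℝ} (hω : 0 < ω) (hM : 0 ≤ M)
    (hSF : ∀ t, 0 ≤ t → ‖SF.op t‖ ≤ M * Real.exp (-ω * t)) (hκ0 : 0 < κ)
    (hκ : ∀ T, 0 ≤ T → ∀ w : ℝ → U, MemLp w 2 (horizon T) →
      κ * energy T w ≤ energy T (fun t => C (SF.conv (fun s => B (w s)) t))
        + energy T (fun t => K (w t + F (SF.conv (fun s => B (w s)) t))))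
    (hm : 0 < m) (hK : ∀ u, m * ‖u‖ ^ 2 ≤ ‖K u‖ ^ 2) :
    ∃ δ : ℝ, 0 < δ ∧ ∀ r c, 0 ≤ c → ∃ M' : ℝ, 0 < M' ∧ ∀ T, 0 ≤ T → ∀ φ : ℝ → ℝ,
      IsSlowlyVarying δ φ → φ 0 ≤ 1 → φ T ≤ 1 → ∀ (x₀ : H) (x : ℝ → H) (u w : ℝ → U),
      ‖x₀‖ ≤ r → MemLp w 2 (horizon T) → MemLp x 2 (horizon T) →
      (∀ t ∈ Set.Icc 0 T, x t = SF.op t x₀ + SF.conv (fun s => B (w s)) t) →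
      (∀ t, u t = w t + F (x t)) →
      (∀ w' : ℝ → U, MemLp w' 2 (horizon T) →
        |∫ t, costForm C K (x t) (u t) (SF.conv (fun s => B (w' s)) t)
          (w' t + F (SF.conv (fun s => B (w' s)) t)) ∂horizon T|
          ≤ c * ‖SF.conv (fun s => B (w' s)) T‖) →
      ∀ᵐ t ∂horizon T, φ t * (‖x t‖ + ‖u t‖) ≤ M' := by
  obtain ⟨δ, b, hδ0, hδω, hb, hw⟩ := exists_weighted_energy_le hω hM hSF hκ0 hκ
  obtain ⟨a, ha, hx⟩ := exists_weighted_state_bound hω hδ0.le hδω hM hSF B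
  refine ⟨δ, hδ0, fun r c hc => ?_⟩
  -- N, X, V and G bound the weighted energies of the offset, the state, the control and the
  -- function g of `weighted_control_bound`; X also bounds the weighted state pointwise, squared.
  set N := b * (r ^ 2 + c ^ 2) with hN
  set X := a * (N + r ^ 2) with hX
  set V := 2 * N + 2 * (‖F‖ ^ 2 * X) with hV
  set G := 2 * ((‖C‖ ^ 2) ^ 2 * X) + 2 * ((‖K‖ ^ 2 * ‖F‖) ^ 2 * V) with hG
  have hN0 : 0 ≤ N := by positivity
  have hX0 : 0 ≤ X := by positivity
  have hV0 : 0 ≤ V := by positivity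
  have hG0 : 0 ≤ G := by positivity
  refine ⟨1 + X + M * ‖B‖ * (c + (2 / ω + G) / 2) / m, by positivity, ?_⟩
  intro T hT φ hφ hφ0 hφT x₀ x u w hx₀ hwm hxm hxw huw hEL
  have hr : ‖x₀‖ ^ 2 ≤ r ^ 2 := by gcongr
  have hwN : energy T (fun t => φ t • w t) ≤ N :=
    (hw T hT φ hφ hφ0 hφT x₀ x u w c hc hwm hxw huw hEL).trans (by rw [hN]; gcongr)
  obtain ⟨hxE, hxP⟩ := hx T hT φ hφ hφ0 x₀ x w hwm hxw
  have haX : a * (energy T (fun t => φ t • w t) + ‖x₀‖ ^ 2) ≤ X := by rw [hX]; gcongr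
  have hφw : MemLp (fun t => φ t • w t) 2 (horizon T) := hφ.memLp_smul hwm
  have hφx : MemLp (fun t => φ t • x t) 2 (horizon T) := hφ.memLp_smul hxm
  have hum : MemLp u 2 (horizon T) := by
    rw [show u = fun t => w t + F (x t) from funext huw]
    exact hwm.add (memLp_clm F hxm)
  have hφu : MemLp (fun t => φ t • u t) 2 (horizon T) := hφ.memLp_smul hum
  have huE : energy T (fun t => φ t • u t) ≤ V := by
    have e : (fun t => φ t • u t) = fun t => φ t • w t + F (φ t • x t) := by
      ext t
      rw [huw, smul_add, F.map_smul_of_tower]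
    rw [e]
    refine (energy_add_le hφw (memLp_clm F hφx)).trans ?_
    have h1 := (energy_clm_le F hφx).trans
      (mul_le_mul_of_nonneg_left (hxE.trans haX) (sq_nonneg ‖F‖))
    linarith
  have hgE : energy T (fun t => φ t * (‖C‖ ^ 2 * ‖x t‖ + ‖K‖ ^ 2 * ‖F‖ * ‖u t‖)) ≤ G := by
    have e : (fun t => φ t * (‖C‖ ^ 2 * ‖x t‖ + ‖K‖ ^ 2 * ‖F‖ * ‖u t‖)) =
        fun t => ‖C‖ ^ 2 * ‖φ t • x t‖ + ‖K‖ ^ 2 * ‖F‖ * ‖φ t • u t‖ := by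
      ext t
      rw [norm_smul, norm_smul, Real.norm_of_nonneg (hφ.pos t).le]
      ring
    rw [e]
    refine (energy_add_le (hφx.norm.const_mul _) (hφu.norm.const_mul _)).trans ?_
    rw [energy_const_mul_norm, energy_const_mul_norm, hG]
    have h1 := hxE.trans haX
    gcongr
  filter_upwards [weighted_control_bound hω hδω hM hSF hK hc hT hφ hφT hxm hum hEL,
    ae_restrict_mem measurableSet_Ioc] with t ht htT
  have h1 := (hxP t ⟨htT.1.le, htT.2⟩).trans haX
  rw [norm_smul, Real.norm_of_nonneg (hφ.pos t).le] at h1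
  -- From s ≤ 1 + s², which avoids a square root.
  have h2 : φ t * ‖x t‖ ≤ 1 + X := by nlinarith [sq_nonneg (φ t * ‖x t‖ - 1)]
  have h3 : φ t * ‖u t‖ ≤ M * ‖B‖ * (c + (2 / ω + G) / 2) / m := by
    rw [le_div_iff₀' hm]
    refine ht.trans ?_
    gcongr
  rw [mul_add]
  exact add_le_add h2 h3

/-- The exponential estimate of the turnpike property. -/
lemma exists_exponential_bound [CompleteSpace U] (hA : IsGenerator A S)
    (hF : IsGenerator ((B.comp F).toLinearMap +ᵥ A) SF)
    (hL : IsGenerator ((L.comp C).toLinearMap +ᵥ A) SL)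
    (hSF : SF.ExponentiallyStable) (hSL : SL.ExponentiallyStable) (hK : Coercive K)
    {R : H →L[ℂ] H}
    (hR : ∀ x t, 0 ≤ t → ∫ s in (0 : ℝ)..t, SF.op (max s 0) x = R x - R (SF.op t x))
    {xe : H} {ue : U} (he : IsControlledEquilibrium A B xe ue)
    (hEL : ∀ w, costDeriv C K z v xe ue (R (B w)) (w + F (R (B w))) = 0)
    {N : Set H} (hN : Bornology.IsBounded N) :
    ∃ M w : ℝ, 0 < M ∧ 0 < w ∧ ∀ T : ℝ, 0 < T → ∀ x₀ ∈ N, ∀ u : ℝ → U,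
      IsOptimalControl S B (runningCost C K z v) T x₀ u →
        ∀ᵐ t ∂horizon T, ‖mildSolution S B x₀ u t - xe‖ + ‖u t - ue‖ ≤
          M * (Real.exp (-w * t) + Real.exp (-w * (T - t))) := by
  obtain ⟨m, hm, hKm⟩ := hK.exists_le
  obtain ⟨κ, hκ0, hκ⟩ := exists_coercive hA hF hL hSF hSL hm hKm
  obtain ⟨M, ω, hM, hω, hSF⟩ := hSF
  obtain ⟨c, hc, hcE⟩ := exists_abs_integral_costDeriv_le hω hSF hR hEL
  obtain ⟨δ, hδ, h⟩ := exists_weighted_bound hω hM.le hSF hκ0 hκ hm hKm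
  obtain ⟨r, hr⟩ := hN.exists_norm_le
  -- The deviation starts at x₀ - xe, hence the enlarged radius.
  obtain ⟨M', hM', h⟩ := h (r + ‖xe‖) c hc
  refine ⟨M', δ, hM', hδ, fun T hT x₀ hx₀ u hu => ?_⟩
  obtain ⟨w, hwm, hxw, huw, hw⟩ := hu.deviation hA hF hω hSF he hcE hT.le
  have hum : MemLp u 2 (horizon T) := isAdmissible_iff.1 hu.1
  have hxm : MemLp (fun t => mildSolution S B x₀ u t - xe) 2 (horizon T) :=
    (memLp_mildSolution S B x₀ hT.le hum).sub (memLp_const xe)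
  filter_upwards [h T hT.le _ (isSlowlyVarying_turnpikeWeight hδ.le T) (turnpikeWeight_zero_le δ T)
    (turnpikeWeight_self_le δ T) (x₀ - xe) _ (fun t => u t - ue) w
    ((norm_sub_le _ _).trans (by gcongr; exact hr x₀ hx₀)) hwm hxm hxw huw hw] with t ht
  rwa [inv_mul_le_iff₀ (by positivity), mul_comm] at ht

/-- The average over a part of the horizon of a function that is exponentially close to `e` away
from the ends of the horizon. -/
lemma norm_average_sub_le {E : Type*} [NormedAddCommGroup E] [NormedSpace ℝ E] [CompleteSpace E]
    {M w T a b : ℝ} (hM : 0 ≤ M) (hw : 0 < w) (hT : 0 < T) (ha : a ∈ Set.Icc (0 : ℝ) 1)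
    (hb : b ∈ Set.Icc (0 : ℝ) 1) (hab : a ≠ b) {f : ℝ → E} {e : E} (hf : MemLp f 2 (horizon T))
    (h : ∀ᵐ t ∂horizon T, ‖f t - e‖ ≤ M * (Real.exp (-w * t) + Real.exp (-w * (T - t)))) :
    ‖((b - a) * T)⁻¹ • (∫ t in (a * T)..(b * T), f t) - e‖ ≤ 2 * M / w / (|b - a| * T) := by
  have hsub : ∀ {s : ℝ}, s ∈ Set.Icc (0 : ℝ) 1 → s * T ∈ Set.Icc 0 T := fun hs =>
    ⟨by have := hs.1; positivity, by nlinarith [hs.2]⟩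
  have haT := hsub ha
  have hbT := hsub hb
  have hfi : ∀ s ∈ Set.Icc 0 T, IntervalIntegrable f volume 0 s := fun s hs =>
    MemLp.intervalIntegrable_of_le hf hs.1 hs.2
  have hfab : IntervalIntegrable f volume (a * T) (b * T) := (hfi _ haT).symm.trans (hfi _ hbT)
  have hne : (b - a) * T ≠ 0 := mul_ne_zero (sub_ne_zero.2 hab.symm) hT.ne'
  have e1 : ((b - a) * T)⁻¹ • (∫ t in (a * T)..(b * T), f t) - e
      = ((b - a) * T)⁻¹ • ∫ t in (a * T)..(b * T), (f t - e) := by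
    rw [intervalIntegral.integral_sub hfab intervalIntegrable_const,
      intervalIntegral.integral_const, smul_sub, ← sub_mul, inv_smul_smul₀ hne]
  set g : ℝ → ℝ := fun t => M * (Real.exp (-w * t) + Real.exp (-w * (T - t))) with hg
  have hg0 : ∀ t, 0 ≤ g t := fun t => by positivity
  have hgc : Continuous g := by fun_prop
  -- The interval is enlarged to the whole horizon, in either order of a and b. The bound 2M/w on
  -- the integral is independent of T, so the average decays like 1/T.
  have e2 : ‖∫ t in (a * T)..(b * T), (f t - e)‖ ≤ ∫ t in (0 : ℝ)..T, g t := by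
    rw [intervalIntegral.norm_integral_eq_norm_integral_uIoc, intervalIntegral.integral_of_le hT.le]
    have hs : Set.uIoc (a * T) (b * T) ⊆ Set.Ioc 0 T :=
      Set.Ioc_subset_Ioc (le_min haT.1 hbT.1) (max_le haT.2 hbT.2)
    have hgI : IntegrableOn g (Set.Ioc 0 T) := hgc.integrableOn_Ioc
    refine (norm_integral_le_of_norm_le (hgI.mono_set hs)
      (ae_restrict_of_ae_restrict_of_subset hs h)).trans ?_
    exact setIntegral_mono_set hgI (Eventually.of_forall hg0) hs.eventuallyLE
  have e3 : ∫ t in (0 : ℝ)..T, g t ≤ 2 * M / w := by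
    have h1 := integral_exp_le (t := T) hw
    have h2 := integral_exp_tail_le (s := 0) (T := T) hw
    simp only [sub_zero] at h2
    rw [hg, intervalIntegral.integral_const_mul, intervalIntegral.integral_add
      (Continuous.intervalIntegrable (by fun_prop) _ _)
      (Continuous.intervalIntegrable (by fun_prop) _ _)]
    calc _ ≤ M * (1 / w + 1 / w) := by gcongr
      _ = _ := by ring
  rw [e1, norm_smul, norm_inv, Real.norm_eq_abs, abs_mul, abs_of_pos hT, inv_mul_eq_div]
  have : 0 < |b - a| := abs_pos.2 (sub_ne_zero.2 hab.symm)
  gcongr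
  exact e2.trans e3

/-- The exponential estimate implies the integral turnpike property. -/
lemma hasExponentialTurnpike_of_bound [CompleteSpace U] {ℓ : H → U → ℝ} {xe : H} {ue : U}
    (h : ∀ N : Set H, Bornology.IsBounded N →
      ∃ M w : ℝ, 0 < M ∧ 0 < w ∧ ∀ T : ℝ, 0 < T → ∀ x₀ ∈ N, ∀ u : ℝ → U,
      IsOptimalControl S B ℓ T x₀ u →
        ∀ᵐ t ∂horizon T, ‖mildSolution S B x₀ u t - xe‖ + ‖u t - ue‖ ≤
          M * (Real.exp (-w * t) + Real.exp (-w * (T - t)))) :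
    HasExponentialTurnpike S B ℓ xe ue := by
  constructor
  · intro N hN _ ε hε a b ha hb hab
    obtain ⟨M, w, hM, hw, h⟩ := h N hN
    have hd : 0 < |b - a| := abs_pos.2 (sub_ne_zero.2 hab.symm)
    -- Chosen so that the bound on the average is at most ε/2 for all T ≥ T₀, which gives the strict
    -- inequality.
    refine ⟨2 * M / w / (|b - a| * (ε / 2)), by positivity, fun T hT x₀ hx₀ u hu => ?_⟩
    have hT0 : 0 < T := lt_of_lt_of_le (by positivity) hT
    have hum : MemLp u 2 (horizon T) := isAdmissible_iff.1 hu.1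
    have hlt : 2 * M / w / (|b - a| * T) < ε := by
      have : 2 * M / w / (|b - a| * T) ≤ ε / 2 := by
        rw [div_le_iff₀ (by positivity)] at hT ⊢
        linarith
      linarith
    have hb' := h T hT0 x₀ hx₀ u hu
    constructor
    · refine (norm_average_sub_le hM.le hw hT0 ha hb hab
        (memLp_mildSolution S B x₀ hT0.le hum) ?_).trans_lt hlt
      filter_upwards [hb'] with t ht
      linarith [norm_nonneg (u t - ue)]
    · refine (norm_average_sub_le hM.le hw hT0 ha hb hab hum ?_).trans_lt hlt
      filter_upwards [hb'] with t ht
      linarith [norm_nonneg (mildSolution S B x₀ u t - xe)]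
  · intro N hN _
    obtain ⟨M, w, hM, hw, h⟩ := h N hN
    refine ⟨M, w, hM, hw, fun T hT x₀ hx₀ u hu => ?_⟩
    rw [← Measure.restrict_congr_set Ioc_ae_eq_Icc]
    exact h T hT x₀ hx₀ u hu

end Estimates

end Turnpike

theorem theorem2
    {H U Y : Type*}
    [NormedAddCommGroup H] [InnerProductSpace ℂ H] [CompleteSpace H]
    [NormedAddCommGroup U] [InnerProductSpace ℂ U] [CompleteSpace U]
    [NormedAddCommGroup Y] [InnerProductSpace ℂ Y] [CompleteSpace Y]
    (A : H →ₗ.[ℂ] H) (S : Turnpike.C0Semigroup H) (hA : Turnpike.IsGenerator A S)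
    (B : U →L[ℂ] H) (C : H →L[ℂ] Y) (K : U →L[ℂ] H) (hK : Turnpike.Coercive K)
    (z : H) (v : U)
    (hAB : Turnpike.ExponentiallyStabilizable A B)
    (hAC : Turnpike.ExponentiallyDetectable A C) :
    Turnpike.HasUniqueOptimalControls S B (Turnpike.runningCost C K z v) ∧
    ∃ (xe : H) (ue : U),
      Turnpike.IsOptimalSteadyState A B (Turnpike.runningCost C K z v) xe ue ∧
      (∀ (x : H) (u : U),
        Turnpike.IsOptimalSteadyState A B (Turnpike.runningCost C K z v) x u →
          x = xe ∧ u = ue) ∧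
      Turnpike.HasExponentialTurnpike S B (Turnpike.runningCost C K z v) xe ue := by

  obtain ⟨F, SF, hF, hSF⟩ := hAB
  obtain ⟨L, SL, hL, hSL⟩ := hAC
  obtain ⟨R, hR1, hR2, hR3⟩ := Turnpike.exists_neg_inverse_of_stable hF hSF
  obtain ⟨Q, -, hQ, -⟩ := Turnpike.exists_neg_inverse_of_stable hL hSL
  obtain ⟨xe, ue, hopt, huniq, hEL⟩ := Turnpike.exists_optimalSteadyState hK z v hR1 hR2 hQ
  exact ⟨Turnpike.hasUniqueOptimalControls hK, xe, ue, hopt, huniq,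
    Turnpike.hasExponentialTurnpike_of_bound fun N hN =>
      Turnpike.exists_exponential_bound hA hF hL hSF hSL hK hR3 hopt.1 hEL hN⟩
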